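/- Let $H$ be a finite-dimensional complex Hilbert space with scalar product $(\cdot,\cdot)$ (linear in the first argument), let $l\ge 0$, $n=2l$, and let $A(\lambda)=A_0+\lambda A_1+\dots+\lambda^nA_n$ be a pencil of linear operators in $H$ such that $\operatorname{Ker}A_n=0$, $\operatorname{Im}(A(\lambda)x,x)\le 0$ for all $x\in H$ and $\lambda\in\mathbb R$, and, for some $\lambda_0\in\mathbb R$, $0\notin\Theta(A(\lambda_0))$, where $\Theta(T)=\{(Tu,u):\|u\|=1\}$ is the numerical range. *Definitions.* A chain of eigen- and associated vectors (EAV) of a pencil $A$ at $c\in\mathbb C$ is a sequence $y^0\neq0,y^1,\dots,y^p$ with $\sum_{j=0}^{s}\frac1{j!}A^{(j)}(c)\,y^{s-j}=0$ for $0\le s\le p$; its length is $p+1$. A canonical system of $A$ at $c$ is a family of chains $w_k^0,\dots,w_k^{p_k}$ $(1\le k\le N)$ such that $w_1^0,\dots,w_N^0$ is a basis of $\operatorname{Ker}A(c)$ and $\sum_k(p_k+1)$ is the largest possible (the numbering of the chains is immaterial; the system is empty if $c$ is not an eigenvalue). Its adjoint system $z_k^0,\dots,z_k^{p_k}$ is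 the canonical system, at $\bar c$, of the pencil $A^*(\lambda)=[A(\bar\lambda)]^*$ for which $$\sum_{k}\sum_{h=0}^{p_k}(\lambda-c)^{-(p_k+1-h)}\sum_{j=0}^{h}(\cdot,z_k^{h-j})\,w_k^j$$ is the principal part of $A(\lambda)^{-1}$ at $\lambda=c$. The Keldysh derived chain (of length $n$, at $c$) of $y^0,\dots,y^p$ is the sequence of vectors $\tilde y^s\in H^n$ with coordinates $\frac{d^r}{dt^r}\big[e^{ct}\big(y^s+\frac{t}{1!}y^{s-1}+\dots+\frac{t^s}{s!}y^0\big)\big]_{t=0}$, $0\le r\le n-1$. A canonical system at a real point $c$ is called regular, with sign characteristics $\varepsilon_k$, if $\varepsilon_k=0$ for every odd $p_k$, while for every even $p_k=2m$ one has $\varepsilon_k=\pm1$ and $$\tilde z_k^{m}=\varepsilon_k\tilde w_k^{m}+\tilde w,\qquad \tilde w\in\operatorname{span}\{\tilde w_j^h:\ 0\le h\le[(p_j-1)/2]\}$$ (chains with $p_j=0$ contribute nothing to the span), where $z$ is the adjoint system and $[\,\cdot\,]$ is the integer part (floor). Choose a canonical system of $A$ at every $c\in\mathbb C$, a regular one,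 with its sign characteristics, at every real $c$. Let $E^+$ consist of the vectors $w_k^h$, $0\le h\le p_k$, at all $c$ with $\operatorname{Im}c>0$, together with the vectors $w_k^h$, $0\le h\le[(p_k+\varepsilon_k)/2]$, at all real $c$ (no vector of the chain if $[(p_k+\varepsilon_k)/2]=-1$). Let $E^-$ be defined in the same way with $\operatorname{Im}c<0$ and $[(p_k-\varepsilon_k)/2]$. *Theorem.* Such a choice is possible, and for every such choice $A$ admits a factorization $A(\lambda)=L(\lambda)K(\lambda)$ with a monic pencil $K(\lambda)=\lambda^lI-\lambda^{l-1}K_{l-1}-\dots-K_0$ and a pencil $L$ of degree $l$ with invertible leading coefficient, such that the system of eigen- and associated vectors of $K$ coincides with $E^+$: at every $c\in\mathbb C$, the nonempty (truncated) chains of $E^+$ belonging to $c$ form a canonical system of $K$ at $c$ (in particular, $c$ is not an eigenvalue of $K$ if there are none). Likewise, there is such a factorization, in general with other $L$ and $K$, for which the system of eigen- and associated vectors of $K$ coincides with $E^-$. -/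

import Mathlib

open Topology

noncomputable section

/-- An operator pencil `A(μ) = A₀ + μ A₁ + ⋯ + μⁿ Aₙ` with bounded operator coefficients, as a
polynomial over the (noncommutative) ring of bounded operators. -/
abbrev Pencil (H : Type*) [NormedAddCommGroup H] [InnerProductSpace ℂ H] : Type _ :=
  Polynomial (H →L[ℂ] H)

/-- Numerical range: all numbers `(Tu, u)` with `‖u‖ = 1`. The scalar product `(x, y)`, linear in
`x`, is `inner ℂ y x`. -/
def numericalRange {H : Type*} [NormedAddCommGroup H] [InnerProductSpace ℂ H]
    (T : H →L[ℂ] H) : Set ℂ :=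
  {ζ | ∃ u : H, ‖u‖ = 1 ∧ ζ = inner ℂ u (T u)}

namespace Pencil

variable {H : Type*} [NormedAddCommGroup H] [InnerProductSpace ℂ H]

/-- The operator `A(μ)`. -/
def value (A : Pencil H) (μ : ℂ) : H →L[ℂ] H :=
  Polynomial.eval (algebraMap ℂ (H →L[ℂ] H) μ) A

/-- The operator `(1 / s!) A⁽ˢ⁾(μ)`. -/
def taylorCoeff (A : Pencil H) (s : ℕ) (μ : ℂ) : H →L[ℂ] H :=
  ((s.factorial : ℂ)⁻¹) • value (Polynomial.derivative^[s] A) μ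

/-- `A` has order `n`, and `Ker Aₙ = 0`. -/
def IsNondegenerateOfOrder (A : Pencil H) (n : ℕ) : Prop :=
  A.natDegree ≤ n ∧ LinearMap.ker (A.coeff n : H →ₗ[ℂ] H) = ⊥

/-- `A(μ) = μⁿ I + (terms of lower order)`. -/
def IsMonicOfDegree (A : Pencil H) (n : ℕ) : Prop :=
  A.natDegree ≤ n ∧ A.coeff n = 1

/-- `Im (A(t)x, x) ≤ 0` for all real `t`. -/
def IsDissipative (A : Pencil H) : Prop :=
  ∀ (t : ℝ) (x : H), (inner ℂ x (A.value (t : ℂ) x)).im ≤ 0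

/-- The adjoint pencil `A*(μ) = [A(conj μ)]*`, whose coefficients are the adjoints `A_j*`. -/
def adjointPencil [CompleteSpace H] (A : Pencil H) : Pencil H :=
  Polynomial.sum A fun j T => Polynomial.monomial j (ContinuousLinearMap.adjoint T)

/-- `y 0, …, y p` is a chain of an eigenvector and associated vectors of `A` at `c`. The values
`y s` with `s > p` are irrelevant. -/
def IsEAVChain (A : Pencil H) (c : ℂ) (p : ℕ) (y : ℕ → H) : Prop :=
  y 0 ≠ 0 ∧ ∀ s ≤ p, ∑ j ∈ Finset.range (s + 1), A.taylorCoeff j c (y (s - j)) = 0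

/-- `(y k)`, `k : ι`, is a family of chains, the `k`-th of length `p k + 1`, whose eigenvectors
form a basis of `Ker A(c)`. -/
def IsFullChainSystem {ι : Type} (A : Pencil H) (c : ℂ) (p : ι → ℕ) (y : ι → ℕ → H) : Prop :=
  (∀ k, A.IsEAVChain c (p k) (y k)) ∧
  LinearIndependent ℂ (fun k => y k 0) ∧
  Submodule.span ℂ (Set.range fun k => y k 0) = LinearMap.ker (A.value c : H →ₗ[ℂ] H)

/-- A canonical system of eigen- and associated vectors of `A` at `c`: the total number of its
elements is the largest possible one. The chains may be numbered in any order. If `c` is not an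
eigenvalue, exactly the empty system is canonical. -/
def IsCanonicalSystem {ι : Type} [Fintype ι] (A : Pencil H) (c : ℂ) (p : ι → ℕ)
    (y : ι → ℕ → H) : Prop :=
  A.IsFullChainSystem c p y ∧
  ∀ (p' : ι → ℕ) (y' : ι → ℕ → H), A.IsFullChainSystem c p' y' →
    ∑ k, (p' k + 1) ≤ ∑ k, (p k + 1)

/-- The sum `∑ₖ ∑_{h ≤ pₖ} (μ - c)^{-(pₖ+1-h)} ∑_{j ≤ h} (·, zₖ^{h-j}) wₖ^j`. Here
`InnerProductSpace.rankOne ℂ w z` is the operator `(·, z) w`. -/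
def principalPart {ι : Type} [Fintype ι] (c : ℂ) (p : ι → ℕ) (w z : ι → ℕ → H) (μ : ℂ) :
    H →L[ℂ] H :=
  ∑ k, ∑ h ∈ Finset.range (p k + 1), ((μ - c) ^ (p k + 1 - h))⁻¹ •
    ∑ j ∈ Finset.range (h + 1), InnerProductSpace.rankOne ℂ (w k j) (z k (h - j))

/-- `z` is the canonical system of `A*` at `conj c` adjoint to the system `w` of `A` at `c`:
`principalPart c p w z` is the principal part of `A(μ)⁻¹` at `c`. -/
def IsAdjointSystem [CompleteSpace H] {ι : Type} [Fintype ι] (A : Pencil H) (c : ℂ) (p : ι → ℕ)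
    (w z : ι → ℕ → H) : Prop :=
  A.adjointPencil.IsCanonicalSystem (starRingEnd ℂ c) p z ∧
  ∃ R : ℂ → (H →L[ℂ] H), AnalyticAt ℂ R c ∧
    ∀ᶠ μ in 𝓝[≠] c, IsUnit (A.value μ) ∧
      Ring.inverse (A.value μ) = principalPart c p w z μ + R μ

/-- The `s`-th member of the Keldysh derived chain of length `n` of `y` at `c`: its `r`-th
coordinate, `r < n`, is the value at `t = 0` of the `r`-th derivative of
`e^{ct} (y^s + (t/1!) y^{s-1} + ⋯ + (t^s/s!) y^0)`, in explicit form. -/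
def keldysh (c : ℂ) (n : ℕ) (y : ℕ → H) (s : ℕ) : Fin n → H := fun r =>
  ∑ q ∈ Finset.range (s + 1), (((r : ℕ).choose q : ℂ) * c ^ ((r : ℕ) - q)) • y (s - q)

/-- `w` is a regular canonical system of a pencil `A` of order `n` at the real point `c`, with
sign characteristics `ε`: for chains of odd length `p k + 1 = 2 m + 1` the sign `ε k = ±1` is
determined by `z̃ₖᵐ = ε k • w̃ₖᵐ + w̃`, where `z` is the adjoint system, tildes denote Keldysh derived
chains of length `n`, and `w̃` lies in the span of all `w̃ⱼʰ` with `h ≤ [(pⱼ - 1) / 2]`.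
For chains of even length, `ε k = 0`. -/
def IsRegularSystem [CompleteSpace H] {ι : Type} [Fintype ι] (A : Pencil H) (n : ℕ) (c : ℝ)
    (p : ι → ℕ) (w : ι → ℕ → H) (ε : ι → ℤ) : Prop :=
  A.IsCanonicalSystem (c : ℂ) p w ∧
  ∃ z : ι → ℕ → H, A.IsAdjointSystem (c : ℂ) p w z ∧
    ∀ k, (Odd (p k) → ε k = 0) ∧
      ∀ m : ℕ, p k = 2 * m → (ε k = 1 ∨ ε k = -1) ∧
        keldysh (c : ℂ) n (z k) m - (ε k : ℂ) • keldysh (c : ℂ) n (w k) m ∈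
          Submodule.span ℂ {v | ∃ (j : ι) (h : ℕ), 2 * h + 1 ≤ p j ∧
            v = keldysh (c : ℂ) n (w j) h}

/-- Data of a finite family of signed chains attached to every point `c : ℂ`; at `c` there are
`N c` chains, the `k`-th being `w c k 0, …, w c k (p c k)`, with sign `ε c k` (used for real `c`). -/
structure ChainFamily (H : Type*) where
  N : ℂ → ℕ
  p : (c : ℂ) → Fin (N c) → ℕ
  w : (c : ℂ) → Fin (N c) → ℕ → H
  ε : (c : ℂ) → Fin (N c) → ℤ

/-- `E` consists of canonical systems of `A` at all points, regular ones at the real points, with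
their sign characteristics. -/
def IsRegularFamily [CompleteSpace H] (A : Pencil H) (n : ℕ) (E : ChainFamily H) : Prop :=
  (∀ c : ℂ, A.IsCanonicalSystem c (E.p c) (E.w c)) ∧
  ∀ c : ℝ, A.IsRegularSystem n c (E.p c) (E.w c) (E.ε c)

/-- Largest index `h` such that `w c k h` is selected for `E⁺` (nothing is selected from the
chain if this is `-1`). Division is floor division. -/
def ChainFamily.plusIndex (E : ChainFamily H) (c : ℂ) (k : Fin (E.N c)) : ℤ :=
  if 0 < c.im then E.p c k else if c.im = 0 then ((E.p c k : ℤ) + E.ε c k) / 2 else -1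

/-- Largest index `h` such that `w c k h` is selected for `E⁻`. -/
def ChainFamily.minusIndex (E : ChainFamily H) (c : ℂ) (k : Fin (E.N c)) : ℤ :=
  if c.im < 0 then E.p c k else if c.im = 0 then ((E.p c k : ℤ) - E.ε c k) / 2 else -1

/-- The eigen- and associated vectors of `K` coincide with the part of `E` made of the vectors
`w c k h`, `0 ≤ h ≤ b c k`: at every point `c` the nonempty truncated chains form a canonical
system of `K` (so `c` is not an eigenvalue of `K` if there are none). -/
def HasEAVSystem (K : Pencil H) (E : ChainFamily H) (b : (c : ℂ) → Fin (E.N c) → ℤ) : Prop :=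
  ∀ c : ℂ, K.IsCanonicalSystem c (fun k : {k : Fin (E.N c) // 0 ≤ b c k} => (b c k).toNat)
    (fun k => E.w c k)

end Pencil

end

/-! Replace the pencil by the recurrence `∑ A_j u_{i+j} = 0`. Its solution space `sol A` is
shift-invariant and, since `A_n` is invertible, is identified with `H^n` by the first `n` members.
Keldysh derived chains, continued to infinite length, are the Jordan chains of the shift on `sol A`
(`kd_mem_sol_iff`, `eq_kd`), so canonical systems are Jordan bases of the root spaces. A
shift-invariant `S ≤ sol A` on which the first `l` members are arbitrary and determine the sequence
is `sol K` for a monic `K` of degree `l`, and then `K` divides `A` on the right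
(`exists_factorization`).

Let `S⁺`, `S⁻` be the spans of the selected chain members. The floor rule makes the two selections
from each chain add up to its length, so `dim S⁺ + dim S⁻ = 2l dim H`. It is therefore enough that
on both spaces the first `l` members determine the sequence.

The tool is the sesquilinear pairing `form`, for which the shifts on `sol A` and on `sol A*` are
mutually adjoint. If `U = (t - shift)⁻¹ u`, then `(A(t)U_0, U_0)` is `form u U` plus a polynomial,
which vanishes when the first `l` members of `u` do (`inner_resolvent`, `remPoly_eq_zero`). At a
real point dissipativity makes the first half of every chain of `A` a chain of `A*` as well
(`half_chain`): a simple pole cannot change sign, and a Cauchy-Schwarz inequality passes from `A(t)`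
to `A(t)*`. On these halves `form` is Hermitian, the strict halves are isotropic, and the middle
members of chains of equal odd length have an invertible Gram matrix. Reducing it to a diagonal of
signs gives a regular system, because adjoint systems are exactly the `form`-dual ones; conversely,
in any regular system the Gram matrix is the diagonal of the sign characteristics
(`IsRegularSystem.form_middle`).

Hence for `u ∈ S⁺` with vanishing first `l` members the function `(A(t)U_0, U_0)` is rational, has
poles only in the closed lower half-plane, the real ones simple with nonnegative residues, is of
second order at infinity, and has nonpositive imaginary part on the real line. Phragmén-Lindelöf and
the maximum principle force it to vanish (`rational_eq_zero`). At `t₀` the numerical range condition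
gives `U_0 = 0`, and a dimension comparison turns this into `u = 0`
(`IsHalfFamily.eq_zero_of_init`). The space `S⁻` is treated by reflection. -/

set_option linter.unusedSectionVars false

/-! ### Pencils acting on sequences; derived chains as Jordan chains of the shift -/

noncomputable section

namespace Pencil

variable {H : Type*} [NormedAddCommGroup H] [InnerProductSpace ℂ H]

/-- The left shift on sequences. -/
def shift : Module.End ℂ (ℕ → H) where
  toFun u := fun i => u (i + 1)
  map_add' _ _ := rfl
  map_smul' _ _ := rfl

@[simp] lemma shift_apply (u : ℕ → H) (i : ℕ) : shift u i = u (i + 1) := rfl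

lemma shift_pow_apply (u : ℕ → H) (j i : ℕ) : (shift ^ j) u i = u (i + j) := by
  induction j generalizing u with
  | zero => rfl
  | succ j ih => rw [pow_succ, Module.End.mul_apply, ih, shift_apply, add_assoc]

/-- Coordinatewise action of an operator on sequences. -/
def opSeq : (H →L[ℂ] H) →+* Module.End ℂ (ℕ → H) where
  toFun T :=
    { toFun := fun u i => T (u i)
      map_add' := fun u v => by ext i; simp
      map_smul' := fun a u => by ext i; simp }
  map_one' := rfl
  map_mul' _ _ := rfl
  map_zero' := rfl
  map_add' _ _ := rfl

@[simp] lemma opSeq_apply (T : H →L[ℂ] H) (u : ℕ → H) (i : ℕ) : opSeq T u i = T (u i) := rfl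

/-- The action of a pencil on sequences, the variable acting as the shift. -/
def act : Pencil H →+* Module.End ℂ (ℕ → H) :=
  Polynomial.eval₂RingHom' opSeq shift fun T => by
    refine LinearMap.ext fun u => ?_
    rfl

lemma act_apply_sum (A : Pencil H) (u : ℕ → H) (i : ℕ) :
    act A u i = A.sum fun j T => T (u (i + j)) := by
  change Polynomial.eval₂ opSeq shift A u i = _
  rw [Polynomial.eval₂_eq_sum, Polynomial.sum, Polynomial.sum, LinearMap.sum_apply,
    Finset.sum_apply]
  refine Finset.sum_congr rfl fun j _ => ?_
  rw [Module.End.mul_apply, opSeq_apply, shift_pow_apply]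

lemma act_apply {A : Pencil H} {n : ℕ} (hn : A.natDegree ≤ n) (u : ℕ → H) (i : ℕ) :
    act A u i = ∑ j ∈ Finset.range (n + 1), A.coeff j (u (i + j)) := by
  rw [act_apply_sum, Polynomial.sum_over_range' A (by simp) (n + 1) (by omega)]

lemma act_shift_comm (A : Pencil H) (u : ℕ → H) : act A (shift u) = shift (act A u) := by
  ext i
  rw [shift_apply, act_apply_sum, act_apply_sum]
  simp only [shift_apply, add_right_comm]

/-- The sequences annihilated by a pencil. -/
def sol (A : Pencil H) : Submodule ℂ (ℕ → H) := LinearMap.ker (act A)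

lemma mem_sol {A : Pencil H} {u : ℕ → H} : u ∈ sol A ↔ act A u = 0 := LinearMap.mem_ker

lemma shift_mem_sol {A : Pencil H} {u : ℕ → H} (hu : u ∈ sol A) : shift u ∈ sol A := by
  rw [mem_sol] at *
  rw [act_shift_comm, hu, map_zero]

/-- The shift minus a scalar. -/
def dev (c : ℂ) : Module.End ℂ (ℕ → H) := shift - algebraMap ℂ _ c

lemma dev_apply (c : ℂ) (u : ℕ → H) : dev c u = shift u - c • u := rfl

lemma dev_apply_apply (c : ℂ) (u : ℕ → H) (i : ℕ) : dev c u i = u (i + 1) - c • u i := rfl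

lemma shift_eq_dev (c : ℂ) (u : ℕ → H) : shift u = c • u + dev c u := by
  rw [dev_apply]; abel

lemma act_dev_comm (A : Pencil H) (c : ℂ) (u : ℕ → H) : act A (dev c u) = dev c (act A u) := by
  rw [dev_apply, dev_apply, map_sub, map_smul, act_shift_comm]

lemma act_dev_pow_comm (A : Pencil H) (c : ℂ) (j : ℕ) (u : ℕ → H) :
    act A ((dev c ^ j) u) = (dev c ^ j) (act A u) := by
  induction j with
  | zero => rfl
  | succ j ih => rw [pow_succ', Module.End.mul_apply, Module.End.mul_apply, act_dev_comm, ih]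

lemma dev_pow_mem_sol {A : Pencil H} {u : ℕ → H} (hu : u ∈ sol A) (c : ℂ) (j : ℕ) :
    (dev c ^ j) u ∈ sol A := by
  rw [mem_sol] at *
  rw [act_dev_pow_comm, hu, map_zero]

lemma dev_mem_sol {A : Pencil H} {u : ℕ → H} (hu : u ∈ sol A) (c : ℂ) : dev c u ∈ sol A := by
  simpa using dev_pow_mem_sol hu c 1

/-- Since `shift = c + dev c`, the member `u i` is a combination of the zeroth members of `(dev c ^
j) u`. Identities between sequences are thereby reduced to index zero. -/
lemma eq_zero_of_dev_pow_apply_zero (c : ℂ) {u : ℕ → H} (h : ∀ j, (dev c ^ j) u 0 = 0) :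
    u = 0 := by
  have key : ∀ i : ℕ, ∀ j, (dev c ^ j) u i = 0 := by
    intro i
    induction i with
    | zero => exact h
    | succ i ih =>
      intro j
      have := ih (j + 1)
      rw [pow_succ', Module.End.mul_apply, dev_apply_apply, ih j, smul_zero, sub_zero] at this
      exact this
  ext i
  exact key i 0

/-- The Keldysh derived chain of infinite length. -/
def kd (c : ℂ) (y : ℕ → H) (s : ℕ) : ℕ → H := fun r =>
  ∑ q ∈ Finset.range (s + 1), ((r.choose q : ℂ) * c ^ (r - q)) • y (s - q)

@[simp] lemma kd_apply_zero (c : ℂ) (y : ℕ → H) (s : ℕ) : kd c y s 0 = y s := by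
  rw [kd, Finset.sum_range_succ']
  simp

lemma choose_mul_pow_succ (c : ℂ) (r q : ℕ) :
    (((r + 1).choose (q + 1) : ℕ) : ℂ) * c ^ (r + 1 - (q + 1))
      = c * (((r.choose (q + 1) : ℕ) : ℂ) * c ^ (r - (q + 1)))
        + ((r.choose q : ℕ) : ℂ) * c ^ (r - q) := by
  rw [Nat.choose_succ_succ, Nat.add_sub_add_right]
  rcases lt_or_ge q r with h | h
  · have : r - q = (r - (q + 1)) + 1 := by omega
    rw [this]; push_cast; ring
  · rw [Nat.choose_eq_zero_of_lt (show r < q + 1 by omega)]; push_cast; ring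

lemma dev_kd_zero (c : ℂ) (y : ℕ → H) : dev c (kd c y 0) = 0 := by
  ext r
  simp only [dev_apply_apply, kd, zero_add, Finset.sum_range_one, Nat.choose_zero_right,
    Nat.sub_zero, Nat.cast_one, one_mul, Pi.zero_apply, smul_smul, pow_succ']
  simp

/-- The derived sequence consists of the derivatives at zero of `e^{ct}` times a polynomial in `t`.
The shift is `d/dt`, so `dev c` differentiates only the polynomial, which moves one step down the
chain. -/
lemma dev_kd_succ (c : ℂ) (y : ℕ → H) (s : ℕ) : dev c (kd c y (s + 1)) = kd c y s := by
  ext r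
  rw [dev_apply_apply, kd, kd, kd, Finset.sum_range_succ', Finset.sum_range_succ' _ (s + 1)]
  simp only [choose_mul_pow_succ, add_smul, Finset.sum_add_distrib, smul_add, Finset.smul_sum,
    smul_smul]
  simp only [Nat.choose_zero_right, Nat.cast_one, one_mul, Nat.sub_zero, pow_succ',
    Nat.add_sub_add_right]
  abel

lemma dev_pow_kd (c : ℂ) (y : ℕ → H) (s j : ℕ) :
    (dev c ^ j) (kd c y s) = if j ≤ s then kd c y (s - j) else 0 := by
  induction j generalizing s with
  | zero => simp
  | succ j ih =>
    rw [pow_succ, Module.End.mul_apply]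
    cases s with
    | zero => rw [dev_kd_zero, map_zero, if_neg (by omega)]
    | succ s => rw [dev_kd_succ, ih]; simp

lemma dev_pow_kd_of_le {j s : ℕ} (h : j ≤ s) (c : ℂ) (y : ℕ → H) :
    (dev c ^ j) (kd c y s) = kd c y (s - j) := by
  rw [dev_pow_kd, if_pos h]

lemma dev_pow_kd_of_lt {j s : ℕ} (h : s < j) (c : ℂ) (y : ℕ → H) :
    (dev c ^ j) (kd c y s) = 0 := by
  rw [dev_pow_kd, if_neg (by omega)]

lemma dev_kd (c : ℂ) (y : ℕ → H) (s : ℕ) :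
    dev c (kd c y s) = if 1 ≤ s then kd c y (s - 1) else 0 := by
  simpa using dev_pow_kd c y s 1

/-- A sequence annihilated by a power of `dev c` is a derived sequence. -/
lemma eq_kd {c : ℂ} {u : ℕ → H} {s : ℕ} (hu : (dev c ^ (s + 1)) u = 0) :
    u = kd c (fun j => (dev c ^ (s - j)) u 0) s := by
  rw [← sub_eq_zero]
  refine eq_zero_of_dev_pow_apply_zero c fun j => ?_
  rw [map_sub, dev_pow_kd, Pi.sub_apply]
  split_ifs with h
  · rw [kd_apply_zero, Nat.sub_sub_self h, sub_self]
  · obtain ⟨i, rfl⟩ : ∃ i, j = i + (s + 1) := ⟨j - (s + 1), by omega⟩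
    rw [pow_add, Module.End.mul_apply, hu, map_zero]
    simp

lemma kd_congr {c : ℂ} {y y' : ℕ → H} {s : ℕ} (h : ∀ j ≤ s, y j = y' j) :
    kd c y s = kd c y' s := by
  ext r
  exact Finset.sum_congr rfl fun q _ => by rw [h (s - q) (by omega)]

lemma taylorCoeff_add (A B : Pencil H) (s : ℕ) (c : ℂ) :
    taylorCoeff (A + B) s c = taylorCoeff A s c + taylorCoeff B s c := by
  simp only [taylorCoeff, value, iterate_map_add, Polynomial.eval_add, smul_add]

lemma value_eq_sum (A : Pencil H) (c : ℂ) : value A c = A.sum fun j T => c ^ j • T := by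
  rw [value, Polynomial.eval_eq_sum]
  refine Finset.sum_congr rfl fun j _ => ?_
  change A.coeff j * _ = c ^ j • A.coeff j
  rw [← map_pow, ← Algebra.commutes, Algebra.smul_def]

lemma value_eq_sum_range {A : Pencil H} {n : ℕ} (hn : A.natDegree ≤ n) (c : ℂ) :
    value A c = ∑ j ∈ Finset.range (n + 1), c ^ j • A.coeff j := by
  rw [value_eq_sum, Polynomial.sum_over_range' A (by simp) (n + 1) (by omega)]

lemma iterate_derivative_monomial (s j : ℕ) (T : H →L[ℂ] H) :
    Polynomial.derivative^[s] (Polynomial.monomial j T)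
      = Polynomial.monomial (j - s) (j.descFactorial s • T) := by
  induction s with
  | zero => simp
  | succ s ih =>
    rw [Function.iterate_succ_apply', ih, Polynomial.derivative_monomial, Nat.descFactorial_succ,
      Nat.sub_sub, ← nsmul_eq_mul', smul_smul]

lemma taylorCoeff_eq_sum (A : Pencil H) (s : ℕ) (c : ℂ) :
    taylorCoeff A s c = A.sum fun j T => ((j.choose s : ℂ) * c ^ (j - s)) • T := by
  induction A using Polynomial.induction_on' with
  | add p q hp hq =>
    rw [taylorCoeff_add, hp, hq, ← Polynomial.sum_add_index] <;> simp
  | monomial j T =>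
    rw [Polynomial.sum_monomial_index _ _ (by simp), taylorCoeff,
      iterate_derivative_monomial, value, Polynomial.eval_monomial, ← map_pow,
      ← Algebra.commutes, ← Algebra.smul_def, Nat.descFactorial_eq_factorial_mul_choose]
    have : (s.factorial : ℂ) ≠ 0 := by exact_mod_cast s.factorial_ne_zero
    rw [← Nat.cast_smul_eq_nsmul ℂ]
    simp only [smul_smul]
    congr 1
    push_cast
    field_simp

lemma taylorCoeff_zero (A : Pencil H) (c : ℂ) : taylorCoeff A 0 c = value A c := by
  simp [taylorCoeff]

/-- The left side of the `s`-th chain equation is the zeroth member of the recurrence applied to the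
derived sequence; only the order of two summations differs. -/
lemma act_kd_apply_zero (A : Pencil H) (c : ℂ) (y : ℕ → H) (s : ℕ) :
    act A (kd c y s) 0 = ∑ j ∈ Finset.range (s + 1), A.taylorCoeff j c (y (s - j)) := by
  rw [act_apply_sum]
  simp only [taylorCoeff_eq_sum, kd, zero_add, Polynomial.sum, map_sum, map_smul,
    sum_apply, smul_apply]
  exact Finset.sum_comm

/-- All chain equations are encoded in the top derived sequence alone: powers of `dev c` commute
with `act A` and produce the lower members. -/
lemma kd_mem_sol_iff (A : Pencil H) (c : ℂ) (y : ℕ → H) (p : ℕ) :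
    kd c y p ∈ sol A ↔
      ∀ s ≤ p, ∑ j ∈ Finset.range (s + 1), A.taylorCoeff j c (y (s - j)) = 0 := by
  constructor
  · intro h s hs
    rw [← act_kd_apply_zero, ← Nat.sub_sub_self hs, ← dev_pow_kd_of_le (by omega),
      mem_sol.1 (dev_pow_mem_sol h c _)]
    rfl
  · intro h
    refine mem_sol.2 (eq_zero_of_dev_pow_apply_zero c fun j => ?_)
    rw [← act_dev_pow_comm, dev_pow_kd]
    split_ifs with hj
    · rw [act_kd_apply_zero, h _ (by omega)]
    · simp

lemma isEAVChain_iff {A : Pencil H} {c : ℂ} {p : ℕ} {y : ℕ → H} :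
    A.IsEAVChain c p y ↔ y 0 ≠ 0 ∧ kd c y p ∈ sol A := by
  rw [kd_mem_sol_iff]; rfl

lemma kd_mem_sol_of_le {A : Pencil H} {c : ℂ} {p : ℕ} {y : ℕ → H} (h : kd c y p ∈ sol A)
    {s : ℕ} (hs : s ≤ p) : kd c y s ∈ sol A := by
  have := dev_pow_mem_sol h c (p - s)
  rwa [dev_pow_kd_of_le (by omega), Nat.sub_sub_self hs] at this

lemma mem_ker_value_iff {A : Pencil H} {c : ℂ} {x : H} :
    x ∈ LinearMap.ker (A.value c : H →ₗ[ℂ] H) ↔ kd c (fun _ => x) 0 ∈ sol A := by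
  rw [kd_mem_sol_iff]
  simp [taylorCoeff_zero]

/-- The root space of a pencil at `c`. -/
def rootSpace (A : Pencil H) (c : ℂ) : Submodule ℂ (ℕ → H) :=
  sol A ⊓ Module.End.maxGenEigenspace shift c

lemma mem_maxGen_iff {c : ℂ} {u : ℕ → H} :
    u ∈ Module.End.maxGenEigenspace shift c ↔ ∃ k : ℕ, (dev c ^ k) u = 0 := by
  rw [Module.End.mem_maxGenEigenspace]; rfl

lemma mem_rootSpace {A : Pencil H} {c : ℂ} {u : ℕ → H} :
    u ∈ rootSpace A c ↔ u ∈ sol A ∧ ∃ k : ℕ, (dev c ^ k) u = 0 := by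
  rw [rootSpace, Submodule.mem_inf, mem_maxGen_iff]

lemma rootSpace_le_sol (A : Pencil H) (c : ℂ) : rootSpace A c ≤ sol A := inf_le_left

lemma dev_pow_mem_rootSpace {A : Pencil H} {c : ℂ} {u : ℕ → H} (hu : u ∈ rootSpace A c) (j : ℕ) :
    (dev c ^ j) u ∈ rootSpace A c := by
  rw [mem_rootSpace] at *
  refine ⟨dev_pow_mem_sol hu.1 c j, ?_⟩
  obtain ⟨k, hk⟩ := hu.2
  exact ⟨k, by rw [← Module.End.mul_apply, ← pow_add, add_comm, pow_add, Module.End.mul_apply, hk,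
    map_zero]⟩

lemma dev_mem_rootSpace {A : Pencil H} {c : ℂ} {u : ℕ → H} (hu : u ∈ rootSpace A c) :
    dev c u ∈ rootSpace A c := by simpa using dev_pow_mem_rootSpace hu 1

lemma kd_mem_rootSpace {A : Pencil H} {c : ℂ} {p : ℕ} {y : ℕ → H} (h : kd c y p ∈ sol A)
    {s : ℕ} (hs : s ≤ p) : kd c y s ∈ rootSpace A c :=
  mem_rootSpace.2 ⟨kd_mem_sol_of_le h hs, s + 1, dev_pow_kd_of_lt (by omega) c y⟩

/-- The members of all chains of a family, indexed by chain and position. -/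
def chainVec {ι : Type*} (c : ℂ) (p : ι → ℕ) (y : ι → ℕ → H) (i : Σ k, Fin (p k + 1)) : ℕ → H :=
  kd c (y i.1) i.2

/-- Coefficients are eliminated from the highest position downwards. Applying `dev c ^ h` to a
relation and taking the zeroth member kills the positions below `h`, those above are already gone,
and a relation between eigenvectors remains. -/
lemma chainVec_linearIndependent {ι : Type*} [Fintype ι] (c : ℂ) (p : ι → ℕ) (y : ι → ℕ → H)
    (h : LinearIndependent ℂ fun k => y k 0) : LinearIndependent ℂ (chainVec c p y) := by
  rw [Fintype.linearIndependent_iff] at *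
  intro a ha
  have main : ∀ d : ℕ, ∀ i : Σ k, Fin (p k + 1), (i.2 : ℕ) + d = Finset.univ.sup p → a i = 0 := by
    intro d
    induction d using Nat.strong_induction_on with
    | _ d ih =>
    intro i hid
    set P := Finset.univ.sup p
    have hz : ∀ i' : Σ k, Fin (p k + 1), (i.2 : ℕ) < i'.2 → a i' = 0 := by
      intro i' hi'
      have h1 : (i'.2 : ℕ) ≤ P :=
        (Nat.lt_succ_iff.1 i'.2.2).trans (Finset.le_sup (f := p) (Finset.mem_univ i'.1))
      exact ih (P - i'.2) (by omega) i' (by omega)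
    have h2 := congrArg (fun u => (dev c ^ (i.2 : ℕ)) u 0) ha
    simp only [map_sum, map_smul, chainVec, map_zero, Finset.sum_apply, Pi.smul_apply,
      Pi.zero_apply, dev_pow_kd] at h2
    rw [Fintype.sum_sigma] at h2
    have h3 : ∑ k, (if hk : (i.2 : ℕ) < p k + 1 then a ⟨k, ⟨i.2, hk⟩⟩ else 0) • y k 0 = 0 := by
      rw [← h2]
      refine Finset.sum_congr rfl fun k _ => ?_
      split_ifs with hk
      · rw [Finset.sum_eq_single ⟨(i.2 : ℕ), hk⟩]
        · simp
        · intro b _ hb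
          rcases lt_trichotomy (b : ℕ) (i.2 : ℕ) with hlt | heq | hgt
          · rw [if_neg (show ¬(i.2 : ℕ) ≤ (b : ℕ) by omega)]; simp
          · exact absurd (Fin.ext heq) hb
          · rw [hz ⟨k, b⟩ hgt, zero_smul]
        · simp
      · rw [zero_smul]
        symm
        refine Finset.sum_eq_zero fun b _ => ?_
        rw [if_neg (show ¬(i.2 : ℕ) ≤ (b : ℕ) by have := b.2; omega)]
        simp
    have h4 := h _ h3 i.1
    rw [dif_pos i.2.2] at h4
    exact h4
  intro i
  have h1 : (i.2 : ℕ) ≤ Finset.univ.sup p :=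
    (Nat.lt_succ_iff.1 i.2.2).trans (Finset.le_sup (f := p) (Finset.mem_univ i.1))
  exact main (Finset.univ.sup p - i.2) i (by omega)

end Pencil
end

/-! ### Existence of Jordan systems in the root spaces -/

noncomputable section

namespace Pencil

variable {H : Type*} [NormedAddCommGroup H] [InnerProductSpace ℂ H]

lemma kd_add (c : ℂ) (y y' : ℕ → H) (s : ℕ) : kd c (y + y') s = kd c y s + kd c y' s := by
  ext r
  simp only [kd, Pi.add_apply, smul_add, Finset.sum_add_distrib]

lemma kd_smul (c a : ℂ) (y : ℕ → H) (s : ℕ) : kd c (a • y) s = a • kd c y s := by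
  ext r
  simp only [kd, Pi.smul_apply, Finset.smul_sum, smul_smul, mul_comm]

/-- `kd` as a linear map. -/
def kdL (c : ℂ) (s : ℕ) : (ℕ → H) →ₗ[ℂ] (ℕ → H) where
  toFun y := kd c y s
  map_add' y y' := kd_add c y y' s
  map_smul' a y := kd_smul c a y s

@[simp] lemma kdL_apply (c : ℂ) (s : ℕ) (y : ℕ → H) : kdL c s y = kd c y s := rfl

/-- The eigenvectors at `c` which start a chain of length `s + 1`, together with zero. -/
def chainStart (A : Pencil H) (c : ℂ) (s : ℕ) : Submodule ℂ H :=
  ((sol A).comap (kdL c s)).map (LinearMap.proj 0)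

lemma mem_chainStart {A : Pencil H} {c : ℂ} {s : ℕ} {x : H} :
    x ∈ chainStart A c s ↔ ∃ y : ℕ → H, kd c y s ∈ sol A ∧ y 0 = x := by
  simp [chainStart]

lemma chainStart_antitone (A : Pencil H) (c : ℂ) : Antitone (chainStart A c) := by
  intro s t hst x hx
  rw [mem_chainStart] at *
  obtain ⟨y, hy, rfl⟩ := hx
  exact ⟨y, kd_mem_sol_of_le hy hst, rfl⟩

lemma exists_dev_pow_eq_zero (A : Pencil H) (c : ℂ) [FiniteDimensional ℂ (rootSpace A c)] :
    ∃ S : ℕ, ∀ u ∈ rootSpace A c, (dev c ^ S) u = 0 := by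
  obtain ⟨t, ht⟩ := (Submodule.fg_iff_finiteDimensional (rootSpace A c)).2 inferInstance
  have h : ∀ v ∈ t, ∃ k : ℕ, (dev c ^ k) v = 0 := fun v hv =>
    (mem_rootSpace.1 (ht ▸ Submodule.subset_span hv : v ∈ rootSpace A c)).2
  choose! k hk using h
  refine ⟨t.sup k, fun u hu => ?_⟩
  have : rootSpace A c ≤ LinearMap.ker (dev c ^ (t.sup k)) := by
    rw [← ht, Submodule.span_le]
    intro v hv
    obtain ⟨d, hd⟩ := Nat.exists_eq_add_of_le (Finset.le_sup (f := k) hv)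
    rw [SetLike.mem_coe, LinearMap.mem_ker, hd, add_comm, pow_add, Module.End.mul_apply, hk v hv,
      map_zero]
  exact this hu

/-- A basis of `Ker A(c)` adapted to the decreasing filtration by `chainStart`. It is built from the
level `S`, where the filtration is zero, downwards; vectors new at level `s` start chains with last
index `s`. -/
lemma exists_adapted_chains [FiniteDimensional ℂ H] (A : Pencil H) (c : ℂ) {S : ℕ}
    (hS : ∀ u ∈ rootSpace A c, (dev c ^ S) u = 0) (s : ℕ) (hs : s ≤ S) :
    ∃ (ι : Type) (_ : Fintype ι) (p : ι → ℕ) (y : ι → ℕ → H),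
      (∀ k, kd c (y k) (p k) ∈ sol A) ∧ LinearIndependent ℂ (fun k => y k 0) ∧
      (∀ k, y k 0 ∈ chainStart A c s) ∧
      ∀ t, s ≤ t → chainStart A c t ≤ Submodule.span ℂ {x | ∃ k, t ≤ p k ∧ x = y k 0} := by
  induction hs using Nat.decreasingInduction with
  | self =>
    refine ⟨Fin 0, inferInstance, Fin.elim0, Fin.elim0, fun k => k.elim0,
      linearIndependent_empty_type, fun k => k.elim0, fun t ht x hx => ?_⟩
    obtain ⟨y, hy, rfl⟩ := mem_chainStart.1 (chainStart_antitone A c ht hx)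
    have := hS _ (kd_mem_rootSpace hy le_rfl)
    rw [dev_pow_kd_of_le le_rfl, Nat.sub_self] at this
    rw [← kd_apply_zero c y 0, this]
    exact Submodule.zero_mem _
  | of_succ s _ ih =>
    obtain ⟨ι, _, p, y, hsol, hli, hin, hsp⟩ := ih
    obtain ⟨C', hC'⟩ := Submodule.exists_isCompl (chainStart A c (s + 1))
    set C := chainStart A c s ⊓ C' with hC
    let b := Module.finBasis ℂ C
    have hb : ∀ i, ∃ z : ℕ → H, kd c z s ∈ sol A ∧ z 0 = b i := fun i =>
      mem_chainStart.1 (b i).2.1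
    choose z hz hz0 using hb
    have hspan : Submodule.span ℂ (Set.range fun k => y k 0) ≤ chainStart A c (s + 1) :=
      Submodule.span_le.2 (by rintro _ ⟨k, rfl⟩; exact hin k)
    have hbspan : Submodule.span ℂ (Set.range fun i => z i 0) = C := by
      have : (Set.range fun i => z i 0) = C.subtype '' Set.range b := by
        rw [← Set.range_comp]; exact congrArg Set.range (funext hz0)
      rw [this, Submodule.span_image, b.span_eq, Submodule.map_top, Submodule.range_subtype]
    refine ⟨ι ⊕ Fin (Module.finrank ℂ C), inferInstance, Sum.elim p (fun _ => s), Sum.elim y z,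
      ?_, ?_, ?_, ?_⟩
    · rintro (k | i)
      exacts [hsol k, hz i]
    · have : (fun k => Sum.elim y z k 0) = Sum.elim (fun k => y k 0) (fun i => z i 0) := by
        ext (k | i) <;> rfl
      rw [this]
      refine hli.sum_type ?_ ?_
      · rw [funext hz0]
        exact b.linearIndependent.map' C.subtype (Submodule.ker_subtype C)
      · rw [hbspan]
        exact (hC'.disjoint.mono_left hspan).mono_right inf_le_right
    · rintro (k | i)
      · exact chainStart_antitone A c (Nat.le_succ s) (hin k)
      · exact mem_chainStart.2 ⟨z i, hz i, rfl⟩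
    · intro t ht
      rcases ht.eq_or_lt with rfl | hlt
      · have hmod : chainStart A c s = chainStart A c (s + 1) ⊔ C := by
          rw [hC, inf_comm, ← sup_inf_assoc_of_le _ (chainStart_antitone A c (Nat.le_succ s)),
            hC'.sup_eq_top, top_inf_eq]
        rw [hmod]
        refine sup_le ((hsp (s + 1) le_rfl).trans (Submodule.span_mono ?_)) ?_
        · rintro _ ⟨k, hk, rfl⟩
          exact ⟨Sum.inl k, by simp; omega, rfl⟩
        · refine hbspan.ge.trans (Submodule.span_mono ?_)
          rintro _ ⟨i, rfl⟩
          exact ⟨Sum.inr i, by simp, rfl⟩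
      · refine (hsp t hlt).trans (Submodule.span_mono ?_)
        rintro _ ⟨k, hk, rfl⟩
        exact ⟨Sum.inl k, hk, rfl⟩

lemma span_chainVec_le {A : Pencil H} {c : ℂ} {ι : Type*} {p : ι → ℕ} {y : ι → ℕ → H}
    (h : ∀ k, kd c (y k) (p k) ∈ sol A) :
    Submodule.span ℂ (Set.range (chainVec c p y)) ≤ rootSpace A c := by
  rw [Submodule.span_le]
  rintro _ ⟨i, rfl⟩
  exact kd_mem_rootSpace (h i.1) (Nat.lt_succ_iff.1 i.2.2)

/-- Chains with independent eigenvectors whose members span the root space. -/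
structure IsJordanSystem {ι : Type*} (A : Pencil H) (c : ℂ) (p : ι → ℕ) (y : ι → ℕ → H) :
    Prop where
  mem : ∀ k, kd c (y k) (p k) ∈ sol A
  li : LinearIndependent ℂ fun k => y k 0
  span : Submodule.span ℂ (Set.range (chainVec c p y)) = rootSpace A c

/-- For `u` with `(dev c ^ (t + 1)) u = 0`, the eigenvector `(dev c ^ t) u 0` starts a chain with
last index `t`, so it is a combination of adapted eigenvectors with `t ≤ p k`. Subtracting the same
combination of members at position `t` lowers the order of nilpotency. -/
lemma exists_jordanSystem [FiniteDimensional ℂ H] (A : Pencil H) (c : ℂ)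
    [FiniteDimensional ℂ (rootSpace A c)] :
    ∃ (r : ℕ) (p : Fin r → ℕ) (y : Fin r → ℕ → H), IsJordanSystem A c p y := by
  obtain ⟨S, hS⟩ := exists_dev_pow_eq_zero A c
  obtain ⟨ι, _, p, y, hsol, hli, -, hsp⟩ := exists_adapted_chains A c hS 0 (Nat.zero_le _)
  have main : ∀ t : ℕ, ∀ u ∈ rootSpace A c, (dev c ^ t) u = 0 →
      u ∈ Submodule.span ℂ (Set.range (chainVec c p y)) := by
    intro t
    induction t with
    | zero => intro u _ h; rw [pow_zero, Module.End.one_apply] at h; rw [h]; exact zero_mem _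
    | succ t ih =>
      intro u hu hut
      have lift : ∀ x ∈ Submodule.span ℂ {x | ∃ k, t ≤ p k ∧ x = y k 0},
          ∃ v ∈ Submodule.span ℂ (Set.range (chainVec c p y)),
            (dev c ^ t) v = kd c (fun _ => x) 0 := by
        intro x hx
        induction hx using Submodule.span_induction with
        | mem x hx =>
          obtain ⟨k, hk, rfl⟩ := hx
          refine ⟨_, Submodule.subset_span ⟨⟨k, ⟨t, Nat.lt_succ_iff.2 hk⟩⟩, rfl⟩, ?_⟩
          rw [chainVec, dev_pow_kd_of_le le_rfl, Nat.sub_self]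
          exact kd_congr (by simp)
        | zero => exact ⟨0, zero_mem _, by rw [map_zero]; exact (map_zero (kdL c 0)).symm⟩
        | add x x' _ _ h h' =>
          obtain ⟨v, hv, hvx⟩ := h
          obtain ⟨v', hv', hvx'⟩ := h'
          exact ⟨v + v', add_mem hv hv', by rw [map_add, hvx, hvx', ← kd_add]; rfl⟩
        | smul a x _ h =>
          obtain ⟨v, hv, hvx⟩ := h
          exact ⟨a • v, Submodule.smul_mem _ a hv, by rw [map_smul, hvx, ← kd_smul]; rfl⟩
      have hkd := eq_kd hut
      set w : ℕ → H := fun j => (dev c ^ (t - j)) u 0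
      obtain ⟨v, hv, hvx⟩ := lift (w 0) (hsp t (Nat.zero_le _)
        (mem_chainStart.2 ⟨w, hkd ▸ (mem_rootSpace.1 hu).1, rfl⟩))
      have h0 : (dev c ^ t) (u - v) = 0 := by
        rw [map_sub, hvx, hkd, dev_pow_kd_of_le le_rfl, Nat.sub_self, sub_eq_zero]
        exact kd_congr (by simp)
      have := ih (u - v) (sub_mem hu (span_chainVec_le hsol hv)) h0
      simpa using add_mem this hv
  have hspan : Submodule.span ℂ (Set.range (chainVec c p y)) = rootSpace A c :=
    le_antisymm (span_chainVec_le hsol) fun u hu => main S u hu (hS u hu)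
  let e := (Fintype.equivFin ι).symm
  refine ⟨Fintype.card ι, p ∘ e, y ∘ e, fun k => hsol (e k), hli.comp e e.injective, ?_⟩
  rw [← hspan]
  congr 1
  ext v
  constructor
  · rintro ⟨⟨k, h⟩, rfl⟩
    exact ⟨⟨e k, h⟩, rfl⟩
  · rintro ⟨⟨k, h⟩, rfl⟩
    obtain ⟨k, rfl⟩ := e.surjective k
    exact ⟨⟨k, h⟩, rfl⟩

end Pencil
end

/-! ### Canonical systems are Jordan bases of the root spaces -/

noncomputable section

namespace Pencil

variable {H : Type*} [NormedAddCommGroup H] [InnerProductSpace ℂ H]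

section Chains

variable {ι : Type*} [Fintype ι] {A : Pencil H} {c : ℂ} {p : ι → ℕ} {y : ι → ℕ → H}

lemma sum_chainVec (a : ι → ℕ → ℂ) :
    ∑ i, a i.1 (i.2 : ℕ) • chainVec c p y i
      = ∑ k, ∑ h ∈ Finset.range (p k + 1), a k h • kd c (y k) h := by
  rw [Fintype.sum_sigma]
  exact Finset.sum_congr rfl fun k _ =>
    Fin.sum_univ_eq_sum_range (fun h => a k h • kd c (y k) h) (p k + 1)

lemma coeff_eq_zero_of_sum_kd (hli : LinearIndependent ℂ fun k => y k 0) {a : ι → ℕ → ℂ}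
    (h0 : ∑ k, ∑ h ∈ Finset.range (p k + 1), a k h • kd c (y k) h = 0) (k : ι) {h : ℕ}
    (hh : h ≤ p k) : a k h = 0 := by
  rw [← sum_chainVec] at h0
  exact Fintype.linearIndependent_iff.1 (chainVec_linearIndependent c p y hli)
    (fun i => a i.1 i.2) h0 ⟨k, ⟨_, Nat.lt_succ_iff.2 hh⟩⟩

lemma exists_sum_kd {u : ℕ → H} (hu : u ∈ Submodule.span ℂ (Set.range (chainVec c p y))) :
    ∃ a : ι → ℕ → ℂ, u = ∑ k, ∑ h ∈ Finset.range (p k + 1), a k h • kd c (y k) h := by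
  obtain ⟨a, rfl⟩ := (Submodule.mem_span_range_iff_exists_fun ℂ).1 hu
  refine ⟨fun k h => if hh : h < p k + 1 then a ⟨k, ⟨h, hh⟩⟩ else 0, ?_⟩
  rw [← sum_chainVec]
  exact Finset.sum_congr rfl fun i _ => by rw [dif_pos i.2.2]

lemma kd_mem_span_chainVec (k : ι) {h : ℕ} (hh : h ≤ p k) :
    kd c (y k) h ∈ Submodule.span ℂ (Set.range (chainVec c p y)) :=
  Submodule.subset_span ⟨⟨k, ⟨h, Nat.lt_succ_iff.2 hh⟩⟩, rfl⟩

lemma card_chainIndex : Fintype.card (Σ k, Fin (p k + 1)) = ∑ k, (p k + 1) := by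
  simp [Fintype.card_sigma]

lemma IsJordanSystem.finiteDimensional (h : IsJordanSystem A c p y) :
    FiniteDimensional ℂ (rootSpace A c) := by
  rw [← h.span]; exact FiniteDimensional.span_of_finite ℂ (Set.finite_range _)

lemma IsJordanSystem.finrank_rootSpace (h : IsJordanSystem A c p y) :
    Module.finrank ℂ (rootSpace A c) = ∑ k, (p k + 1) := by
  rw [← h.span, finrank_span_eq_card (chainVec_linearIndependent c p y h.li), card_chainIndex]

/-- Expand a derived eigenvector in the chain members and apply `dev c`: by independence only the
coefficients at position zero survive. -/
lemma IsJordanSystem.span_ker (h : IsJordanSystem A c p y) :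
    Submodule.span ℂ (Set.range fun k => y k 0) = LinearMap.ker (A.value c : H →ₗ[ℂ] H) := by
  refine le_antisymm (Submodule.span_le.2 ?_) fun x hx => ?_
  · rintro _ ⟨k, rfl⟩
    refine mem_ker_value_iff.2 ?_
    have : kd c (fun _ => y k 0) 0 = kd c (y k) 0 := kd_congr (by simp)
    rw [this]
    exact kd_mem_sol_of_le (h.mem k) (Nat.zero_le _)
  · have hu := kd_mem_rootSpace (mem_ker_value_iff.1 hx) le_rfl
    rw [← h.span] at hu
    obtain ⟨a, ha⟩ := exists_sum_kd hu
    have h1 := congrArg (dev c) ha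
    rw [dev_kd_zero, map_sum] at h1
    have h2 : ∑ k, ∑ h ∈ Finset.range (p k + 1),
        (if h < p k then a k (h + 1) else 0) • kd c (y k) h = 0 := by
      rw [h1]
      refine Finset.sum_congr rfl fun k _ => ?_
      rw [Finset.sum_range_succ, if_neg (lt_irrefl _), zero_smul, add_zero, map_sum,
        Finset.sum_range_succ', map_smul, dev_kd_zero, smul_zero, add_zero]
      exact Finset.sum_congr rfl fun j hj => by
        rw [if_pos (Finset.mem_range.1 hj), map_smul, dev_kd_succ]
    have h3 := congrFun ha 0
    rw [kd_apply_zero, Finset.sum_apply] at h3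
    rw [h3]
    refine Submodule.sum_mem _ fun k _ => ?_
    rw [Finset.sum_apply, Finset.sum_range_succ', Finset.sum_eq_zero, zero_add, Pi.smul_apply,
      kd_apply_zero]
    · exact Submodule.smul_mem _ _ (Submodule.subset_span ⟨k, rfl⟩)
    · intro j hj
      have hj' := Finset.mem_range.1 hj
      have h4 := coeff_eq_zero_of_sum_kd (a := fun k h => if h < p k then a k (h + 1) else 0)
        h.li h2 k hj'.le
      rw [if_pos hj'] at h4
      rw [h4, zero_smul]
      rfl

end Chains

section Canonical

variable {ι : Type} {A : Pencil H} {c : ℂ} {p : ι → ℕ} {y : ι → ℕ → H}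

lemma IsFullChainSystem.mem (h : A.IsFullChainSystem c p y) (k : ι) : kd c (y k) (p k) ∈ sol A :=
  (isEAVChain_iff.1 (h.1 k)).2

variable [Fintype ι]

lemma IsJordanSystem.isFullChainSystem (h : IsJordanSystem A c p y) :
    A.IsFullChainSystem c p y :=
  ⟨fun k => isEAVChain_iff.2 ⟨h.li.ne_zero k, h.mem k⟩, h.li, h.span_ker⟩

lemma IsFullChainSystem.finrank_span (h : A.IsFullChainSystem c p y) :
    Module.finrank ℂ (Submodule.span ℂ (Set.range (chainVec c p y))) = ∑ k, (p k + 1) := by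
  rw [finrank_span_eq_card (chainVec_linearIndependent c p y h.2.1), card_chainIndex]

/-- Maximality: the members of any full chain system are independent in the root space, so their
number is at most its dimension. -/
lemma IsJordanSystem.isCanonicalSystem (h : IsJordanSystem A c p y) :
    A.IsCanonicalSystem c p y := by
  refine ⟨h.isFullChainSystem, fun p' y' h' => ?_⟩
  have := h.finiteDimensional
  rw [← h'.finrank_span, ← h.finrank_rootSpace]
  exact Submodule.finrank_mono (span_chainVec_le h'.mem)

/-- A Jordan system has as many chains, both sets of eigenvectors being bases of the kernel. After
reindexing it competes in the maximality condition and forces the total length up to the dimension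
of the root space. -/
lemma IsCanonicalSystem.isJordanSystem [FiniteDimensional ℂ H]
    [FiniteDimensional ℂ (rootSpace A c)] (h : A.IsCanonicalSystem c p y) :
    IsJordanSystem A c p y := by
  refine ⟨h.1.mem, h.1.2.1, ?_⟩
  obtain ⟨r, p', y', h'⟩ := exists_jordanSystem A c
  have hcard : Fintype.card ι = Fintype.card (Fin r) := by
    rw [← finrank_span_eq_card h.1.2.1, ← finrank_span_eq_card h'.li, h.1.2.2, h'.span_ker]
  let e := Fintype.equivOfCardEq hcard
  have hfull : A.IsFullChainSystem c (p' ∘ e) (y' ∘ e) := by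
    have hf := h'.isFullChainSystem
    refine ⟨fun k => hf.1 (e k), hf.2.1.comp e e.injective, ?_⟩
    rw [← hf.2.2]
    congr 1
    exact e.surjective.range_comp (fun k => y' k 0)
  have hle := h.2 _ _ hfull
  rw [← h.1.finrank_span] at hle
  refine Submodule.eq_of_le_of_finrank_le (span_chainVec_le h.1.mem) (le_trans ?_ hle)
  rw [h'.finrank_rootSpace, ← Equiv.sum_comp e]
  rfl

end Canonical

/-! ### The solution space: dimension and spectral decomposition -/

section Solutions

/-- The first `n` members of a sequence. -/
def restr (n : ℕ) : (ℕ → H) →ₗ[ℂ] (Fin n → H) where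
  toFun u := fun r => u r
  map_add' _ _ := rfl
  map_smul' _ _ := rfl

@[simp] lemma restr_apply (n : ℕ) (u : ℕ → H) (r : Fin n) : restr n u r = u r := rfl

variable {A : Pencil H} {n : ℕ}

lemma sol_eq_zero_of_init (hA : A.IsNondegenerateOfOrder n) {u : ℕ → H} (hu : u ∈ sol A)
    (h0 : ∀ i < n, u i = 0) : u = 0 := by
  ext i
  induction i using Nat.strong_induction_on with
  | _ i ih =>
  rcases lt_or_ge i n with h | h
  · exact h0 i h
  · obtain ⟨d, rfl⟩ := Nat.exists_eq_add_of_le h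
    have h1 := congrFun (mem_sol.1 hu) d
    rw [act_apply hA.1, Finset.sum_range_succ, Finset.sum_eq_zero, zero_add] at h1
    · have := (LinearMap.ker_eq_bot'.1 hA.2) _ h1
      rwa [add_comm] at this
    · intro j hj
      have := Finset.mem_range.1 hj
      rw [ih (d + j) (by omega)]
      simp

/-- The sequence with prescribed first `n` members `x` satisfying a linear recurrence. -/
def recSeq (n : ℕ) (F : (Fin n → H) → H) (x : Fin n → H) : ℕ → H
  | i => if h : i < n then x ⟨i, h⟩ else F fun j : Fin n => recSeq n F x (i - n + j)
decreasing_by have := j.2; omega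

lemma recSeq_of_lt (n : ℕ) (F : (Fin n → H) → H) (x : Fin n → H) (r : Fin n) :
    recSeq n F x r = x r := by
  rw [recSeq, dif_pos r.2]

lemma recSeq_add (n : ℕ) (F : (Fin n → H) → H) (x : Fin n → H) (i : ℕ) :
    recSeq n F x (i + n) = F fun j : Fin n => recSeq n F x (i + j) := by
  rw [recSeq, dif_neg (by omega)]
  simp

lemma coeff_bijective [FiniteDimensional ℂ H] (hA : A.IsNondegenerateOfOrder n) :
    Function.Bijective (A.coeff n) := by
  have : Function.Injective (A.coeff n : H →ₗ[ℂ] H) := LinearMap.ker_eq_bot.1 hA.2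
  exact ⟨this, LinearMap.injective_iff_surjective.1 this⟩

lemma exists_sol [FiniteDimensional ℂ H] (hA : A.IsNondegenerateOfOrder n) (x : Fin n → H) :
    ∃ u ∈ sol A, restr n u = x := by
  choose B hB using (coeff_bijective hA).2
  let F : (Fin n → H) → H := fun v => B (-∑ j : Fin n, A.coeff j (v j))
  refine ⟨recSeq n F x, mem_sol.2 ?_, funext fun r => recSeq_of_lt n F x r⟩
  ext i
  rw [act_apply hA.1, Finset.sum_range_succ, recSeq_add, hB, ← Fin.sum_univ_eq_sum_range
    (fun j => A.coeff j (recSeq n F x (i + j)))]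
  simp

/-- Solutions are determined by their first `n` members, which are arbitrary. -/
def solEquiv [FiniteDimensional ℂ H] (hA : A.IsNondegenerateOfOrder n) :
    sol A ≃ₗ[ℂ] (Fin n → H) :=
  LinearEquiv.ofBijective ((restr n).domRestrict (sol A)) <| by
    constructor
    · rw [← LinearMap.ker_eq_bot, LinearMap.ker_eq_bot']
      intro u hu
      refine Subtype.ext (sol_eq_zero_of_init hA u.2 fun i hi => congrFun hu ⟨i, hi⟩)
    · intro x
      obtain ⟨u, hu, hx⟩ := exists_sol hA x
      exact ⟨⟨u, hu⟩, hx⟩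

lemma finiteDimensional_sol [FiniteDimensional ℂ H] (hA : A.IsNondegenerateOfOrder n) :
    FiniteDimensional ℂ (sol A) :=
  LinearEquiv.finiteDimensional (solEquiv hA).symm

lemma finrank_sol [FiniteDimensional ℂ H] (hA : A.IsNondegenerateOfOrder n) :
    Module.finrank ℂ (sol A) = n * Module.finrank ℂ H := by
  rw [(solEquiv hA).finrank_eq, Module.finrank_pi_fintype]
  simp

lemma finiteDimensional_rootSpace [FiniteDimensional ℂ H] (hA : A.IsNondegenerateOfOrder n)
    (c : ℂ) : FiniteDimensional ℂ (rootSpace A c) := by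
  have := finiteDimensional_sol hA
  exact Submodule.finiteDimensional_of_le (rootSpace_le_sol A c)

/-- The shift on the solutions of a pencil. -/
def solShift (A : Pencil H) : Module.End ℂ (sol A) :=
  shift.restrict fun _ hu => shift_mem_sol hu

lemma coe_solShift_sub_pow (c : ℂ) (k : ℕ) (v : sol A) :
    (((solShift A - algebraMap ℂ _ c) ^ k) v : ℕ → H) = (dev c ^ k) (v : ℕ → H) := by
  induction k with
  | zero => rfl
  | succ k ih =>
    rw [pow_succ', Module.End.mul_apply, pow_succ', Module.End.mul_apply, ← ih]
    rfl

lemma comap_rootSpace (A : Pencil H) (c : ℂ) :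
    (rootSpace A c).comap (sol A).subtype = (solShift A).maxGenEigenspace c := by
  ext v
  rw [Submodule.mem_comap, Submodule.subtype_apply, mem_rootSpace, Module.End.mem_maxGenEigenspace]
  refine ⟨fun h => h.2.imp fun k hk => ?_, fun h => ⟨v.2, h.imp fun k hk => ?_⟩⟩
  · exact Subtype.ext ((coe_solShift_sub_pow c k v).trans hk)
  · exact (coe_solShift_sub_pow c k v).symm.trans (congrArg Subtype.val hk)

lemma iSup_rootSpace [FiniteDimensional ℂ (sol A)] : ⨆ c, rootSpace A c = sol A := by
  refine le_antisymm (iSup_le fun c => rootSpace_le_sol A c) fun u hu => ?_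
  have h1 : (⟨u, hu⟩ : sol A) ∈ ⨆ c, (solShift A).maxGenEigenspace c := by
    rw [(solShift A).iSup_maxGenEigenspace_eq_top]; trivial
  have h2 := Submodule.mem_map_of_mem (f := (sol A).subtype) h1
  rw [Submodule.map_iSup] at h2
  have h3 : ∀ c, ((solShift A).maxGenEigenspace c).map (sol A).subtype ≤ rootSpace A c := by
    intro c
    rw [← comap_rootSpace]
    exact Submodule.map_comap_le _ _
  exact iSup_mono h3 h2

lemma iSupIndep_maxGenEigenspace_shift :
    iSupIndep (Module.End.maxGenEigenspace (shift : Module.End ℂ (ℕ → H))) :=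
  Module.End.independent_maxGenEigenspace _

lemma iSupIndep_rootSpace (A : Pencil H) : iSupIndep (rootSpace A) :=
  iSupIndep_maxGenEigenspace_shift.mono fun _ => inf_le_right

lemma finite_rootSpace_ne_bot [FiniteDimensional ℂ (sol A)] :
    {c | rootSpace A c ≠ ⊥}.Finite := by
  have h : iSupIndep fun c => (rootSpace A c).comap (sol A).subtype := by
    simp_rw [comap_rootSpace]
    exact (solShift A).independent_maxGenEigenspace
  refine (WellFoundedGT.finite_ne_bot_of_iSupIndep h).subset fun c hc hc' => hc ?_
  rw [eq_bot_iff]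
  intro u hu
  have : (⟨u, rootSpace_le_sol A c hu⟩ : sol A) ∈ (rootSpace A c).comap (sol A).subtype := hu
  rw [hc'] at this
  simpa using this

end Solutions

end Pencil
end

/-! ### The pairing between solutions for a pencil and for its adjoint -/

noncomputable section

namespace Pencil

variable {H : Type*} [NormedAddCommGroup H] [InnerProductSpace ℂ H]

/-- The form `∑ (A_{i+k+1} u_i, y_k)`, summed over `i + k < n`. -/
def form (A : Pencil H) (n : ℕ) (u y : ℕ → H) : ℂ :=
  ∑ j ∈ Finset.range n, ∑ i ∈ Finset.range (j + 1), inner ℂ (y (j - i)) (A.coeff (j + 1) (u i))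

section Form

variable (A : Pencil H) (n : ℕ)

/-- `form` as a linear map in its first argument. -/
def formLeft (y : ℕ → H) : (ℕ → H) →ₗ[ℂ] ℂ where
  toFun u := form A n u y
  map_add' u v := by simp only [form, Pi.add_apply, map_add, inner_add_right, Finset.sum_add_distrib]
  map_smul' a u := by
    simp only [form, Pi.smul_apply, map_smul, inner_smul_right, Finset.mul_sum, smul_eq_mul,
      RingHom.id_apply]

/-- `form` as a conjugate linear map in its second argument. -/
def formRight (u : ℕ → H) : (ℕ → H) →ₗ⋆[ℂ] ℂ where
  toFun y := form A n u y
  map_add' y z := by simp only [form, Pi.add_apply, inner_add_left, Finset.sum_add_distrib]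
  map_smul' a y := by
    simp only [form, Pi.smul_apply, inner_smul_left, Finset.mul_sum, smul_eq_mul]

lemma form_add_left (u v y : ℕ → H) : form A n (u + v) y = form A n u y + form A n v y :=
  map_add (formLeft A n y) u v
lemma form_sub_left (u v y : ℕ → H) : form A n (u - v) y = form A n u y - form A n v y :=
  map_sub (formLeft A n y) u v
lemma form_smul_left (a : ℂ) (u y : ℕ → H) : form A n (a • u) y = a * form A n u y :=
  map_smul (formLeft A n y) a u
lemma form_zero_left (y : ℕ → H) : form A n 0 y = 0 := map_zero (formLeft A n y)
lemma form_sum_left {ι : Type*} (s : Finset ι) (u : ι → ℕ → H) (y : ℕ → H) :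
    form A n (∑ k ∈ s, u k) y = ∑ k ∈ s, form A n (u k) y := map_sum (formLeft A n y) u s
lemma form_add_right (u y z : ℕ → H) : form A n u (y + z) = form A n u y + form A n u z :=
  map_add (formRight A n u) y z
lemma form_sub_right (u y z : ℕ → H) : form A n u (y - z) = form A n u y - form A n u z :=
  map_sub (formRight A n u) y z
lemma form_smul_right (a : ℂ) (u y : ℕ → H) :
    form A n u (a • y) = starRingEnd ℂ a * form A n u y :=
  map_smulₛₗ (formRight A n u) a y
lemma form_zero_right (u : ℕ → H) : form A n u 0 = 0 := map_zero (formRight A n u)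
lemma form_sum_right {ι : Type*} (s : Finset ι) (u : ℕ → H) (y : ι → ℕ → H) :
    form A n u (∑ k ∈ s, y k) = ∑ k ∈ s, form A n u (y k) := map_sum (formRight A n u) y s

variable {A n}

lemma form_congr_right {u y z : ℕ → H} (h : ∀ i < n, y i = z i) :
    form A n u y = form A n u z := by
  refine Finset.sum_congr rfl fun j hj => Finset.sum_congr rfl fun i _ => ?_
  rw [h (j - i) (by have := Finset.mem_range.1 hj; omega)]

/-- For each coefficient `A_{j+1}` both forms are parts of one sum over `i + k = j + 1`: the first
lacks the term `i = 0`, the second the term `k = 0`. Only these boundary terms remain; the two terms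
with `A_0` added to complete the sums cancel. -/
lemma form_shift_sub (hA : A.natDegree ≤ n) (u y : ℕ → H) :
    form A n (shift u) y - form A n u (shift y)
      = inner ℂ (y 0) (act A u 0)
        - ∑ j ∈ Finset.range (n + 1), inner ℂ (y j) (A.coeff j (u 0)) := by
  have h1 : ∀ j, ∑ i ∈ Finset.range (j + 1), inner ℂ (y (j - i)) (A.coeff (j + 1) (shift u i))
      - ∑ i ∈ Finset.range (j + 1), inner ℂ (shift y (j - i)) (A.coeff (j + 1) (u i))
      = inner ℂ (y 0) (A.coeff (j + 1) (u (j + 1)))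
        - inner ℂ (y (j + 1)) (A.coeff (j + 1) (u 0)) := by
    intro j
    have h2 := Finset.sum_range_succ
      (fun i => (inner ℂ (y (j + 1 - i)) (A.coeff (j + 1) (u i)) : ℂ)) (j + 1)
    rw [Finset.sum_range_succ'] at h2
    simp only [Nat.add_sub_add_right, Nat.sub_zero, Nat.sub_self] at h2
    have h3 : ∑ i ∈ Finset.range (j + 1), (inner ℂ (shift y (j - i)) (A.coeff (j + 1) (u i)) : ℂ)
        = ∑ i ∈ Finset.range (j + 1), inner ℂ (y (j + 1 - i)) (A.coeff (j + 1) (u i)) := by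
      refine Finset.sum_congr rfl fun i hi => ?_
      have : j + 1 - i = j - i + 1 := by have := Finset.mem_range.1 hi; omega
      rw [shift_apply, this]
    rw [h3]
    simp only [shift_apply]
    linear_combination h2
  rw [form, form, ← Finset.sum_sub_distrib, Finset.sum_congr rfl fun j _ => h1 j,
    Finset.sum_sub_distrib, act_apply hA, inner_sum, Finset.sum_range_succ' _ n,
    Finset.sum_range_succ' _ n]
  simp only [zero_add]
  ring

end Form

section Adjoint

variable [CompleteSpace H] {A : Pencil H} {n : ℕ}

@[simp] lemma adjointPencil_coeff (A : Pencil H) (j : ℕ) :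
    A.adjointPencil.coeff j = ContinuousLinearMap.adjoint (A.coeff j) := by
  rw [adjointPencil, Polynomial.sum, Polynomial.finsetSum_coeff]
  simp only [Polynomial.coeff_monomial]
  rw [Finset.sum_ite_eq']
  split_ifs with h
  · rfl
  · rw [Polynomial.notMem_support_iff.1 h, map_zero]

lemma adjointPencil_adjointPencil (A : Pencil H) : A.adjointPencil.adjointPencil = A := by
  ext1 j
  simp

lemma natDegree_adjointPencil_le (hA : A.natDegree ≤ n) : A.adjointPencil.natDegree ≤ n := by
  rw [Polynomial.natDegree_le_iff_coeff_eq_zero] at *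
  intro j hj
  rw [adjointPencil_coeff, hA j hj, map_zero]

lemma adjointPencil_value (A : Pencil H) (c : ℂ) :
    A.adjointPencil.value (starRingEnd ℂ c) = ContinuousLinearMap.adjoint (A.value c) := by
  rw [value_eq_sum_range (natDegree_adjointPencil_le le_rfl), value_eq_sum_range le_rfl, map_sum]
  refine Finset.sum_congr rfl fun j _ => ?_
  rw [map_smulₛₗ, adjointPencil_coeff, map_pow]

lemma adjointPencil_value_ofReal (A : Pencil H) (t : ℝ) :
    A.adjointPencil.value (t : ℂ) = ContinuousLinearMap.adjoint (A.value (t : ℂ)) := by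
  rw [← adjointPencil_value, Complex.conj_ofReal]

lemma IsNondegenerateOfOrder.adjointPencil [FiniteDimensional ℂ H]
    (hA : A.IsNondegenerateOfOrder n) : A.adjointPencil.IsNondegenerateOfOrder n := by
  refine ⟨natDegree_adjointPencil_le hA.1, ?_⟩
  rw [adjointPencil_coeff, LinearMap.ker_eq_bot']
  intro x hx
  obtain ⟨z, hz⟩ := (coeff_bijective hA).2 x
  have h1 : inner ℂ (ContinuousLinearMap.adjoint (A.coeff n) x) z = (0 : ℂ) := by
    have : ContinuousLinearMap.adjoint (A.coeff n) x = 0 := hx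
    rw [this, inner_zero_left]
  rw [ContinuousLinearMap.adjoint_inner_left, hz, inner_self_eq_zero] at h1
  exact h1

lemma form_adjointPencil (A : Pencil H) (n : ℕ) (u y : ℕ → H) :
    form A.adjointPencil n y u = starRingEnd ℂ (form A n u y) := by
  rw [form, form, map_sum]
  refine Finset.sum_congr rfl fun j _ => ?_
  rw [map_sum, ← Finset.sum_range_reflect]
  refine Finset.sum_congr rfl fun i hi => ?_
  have hi' := Finset.mem_range.1 hi
  rw [inner_conj_symm, adjointPencil_coeff, ContinuousLinearMap.adjoint_inner_right]
  congr 3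
  omega

/-- Of the two boundary sums in `form_shift_sub`, one is the recurrence for `u` and the other is the
adjoint recurrence for `y`, paired with `u 0`. -/
lemma form_shift (hA : A.natDegree ≤ n) {u y : ℕ → H} (hu : u ∈ sol A)
    (hy : y ∈ sol A.adjointPencil) : form A n (shift u) y = form A n u (shift y) := by
  rw [← sub_eq_zero, form_shift_sub hA, mem_sol.1 hu]
  have h := congrFun (mem_sol.1 hy) 0
  rw [act_apply (natDegree_adjointPencil_le hA)] at h
  have h2 := congrArg (fun v : H => (inner ℂ v (u 0) : ℂ)) h
  simp only [sum_inner, zero_add, adjointPencil_coeff, ContinuousLinearMap.adjoint_inner_left,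
    Pi.zero_apply, inner_zero_left] at h2
  rw [h2]
  simp

lemma form_dev (hA : A.natDegree ≤ n) {u y : ℕ → H} (hu : u ∈ sol A)
    (hy : y ∈ sol A.adjointPencil) (c : ℂ) :
    form A n (dev c u) y = form A n u (dev (starRingEnd ℂ c) y) := by
  rw [dev_apply, dev_apply, form_sub_left, form_sub_right, form_shift hA hu hy, form_smul_left,
    form_smul_right, Complex.conj_conj]

lemma form_dev_pow (hA : A.natDegree ≤ n) {u y : ℕ → H} (hu : u ∈ sol A)
    (hy : y ∈ sol A.adjointPencil) (c : ℂ) (j : ℕ) :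
    form A n ((dev c ^ j) u) y = form A n u ((dev (starRingEnd ℂ c) ^ j) y) := by
  induction j generalizing u with
  | zero => rfl
  | succ j ih =>
    rw [pow_succ, Module.End.mul_apply, ih (dev_mem_sol hu c), form_dev hA hu
      (dev_pow_mem_sol hy _ j), pow_succ', Module.End.mul_apply]

/-- Induction on the sum of the nilpotency orders: the terms with `dev` vanish, and adjointness of
the shift leaves `c * form = conj d * form`. -/
lemma form_rootSpace_eq_zero (hA : A.natDegree ≤ n) {c d : ℂ} (hcd : d ≠ starRingEnd ℂ c)
    {u y : ℕ → H} (hu : u ∈ rootSpace A c) (hy : y ∈ rootSpace A.adjointPencil d) :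
    form A n u y = 0 := by
  obtain ⟨a, ha⟩ := (mem_rootSpace.1 hu).2
  obtain ⟨b, hb⟩ := (mem_rootSpace.1 hy).2
  induction hs : a + b using Nat.strong_induction_on generalizing a b u y with
  | _ s ih =>
  rcases a with _ | a
  · rw [pow_zero, Module.End.one_apply] at ha
    rw [ha, form_zero_left]
  rcases b with _ | b
  · rw [pow_zero, Module.End.one_apply] at hb
    rw [hb, form_zero_right]
  have h1 : form A n (dev c u) y = 0 := by
    refine ih (a + (b + 1)) (by omega) (dev_mem_rootSpace hu) hy a ?_ (b + 1) hb rfl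
    rwa [pow_succ, Module.End.mul_apply] at ha
  have h2 : form A n u (dev d y) = 0 := by
    refine ih (a + 1 + b) (by omega) hu (dev_mem_rootSpace hy) (a + 1) ha b ?_ rfl
    rwa [pow_succ, Module.End.mul_apply] at hb
  have h3 := form_shift hA (rootSpace_le_sol A c hu) (rootSpace_le_sol _ d hy)
  rw [shift_eq_dev c u, shift_eq_dev d y, form_add_left, form_add_right, h1, h2, form_smul_left,
    form_smul_right, add_zero, add_zero] at h3
  by_contra hne
  refine hcd ?_
  rw [mul_right_cancel₀ hne h3, Complex.conj_conj]

variable [FiniteDimensional ℂ H]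

/-- The annihilator is shift-invariant, so every member of `y` can be moved to index zero. It is
then tested by a solution whose first `n` members vanish except the last, chosen so that the form
becomes `‖y i‖²`. The case `n = 0`, which has no last member, is separate. -/
lemma eq_zero_of_form_sol (hA : A.IsNondegenerateOfOrder n) {y : ℕ → H}
    (hy : y ∈ sol A.adjointPencil) (h : ∀ u ∈ sol A, form A n u y = 0) : y = 0 := by
  rcases Nat.eq_zero_or_pos n with rfl | hn
  · exact sol_eq_zero_of_init hA.adjointPencil hy (by simp)
  have key : ∀ i : ℕ, ∀ u ∈ sol A, form A n u ((shift ^ i) y) = 0 := by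
    intro i
    induction i generalizing y with
    | zero => exact h
    | succ i ih =>
      rw [pow_succ, Module.End.mul_apply]
      refine ih (shift_mem_sol hy) fun u hu => ?_
      rw [← form_shift hA.1 hu hy]
      exact h _ (shift_mem_sol hu)
  ext i
  obtain ⟨x, hx⟩ := (coeff_bijective hA).2 (y i)
  obtain ⟨u, hu, hux⟩ := exists_sol hA fun r : Fin n => if (r : ℕ) = n - 1 then x else 0
  have hu1 : ∀ r < n, u r = if r = n - 1 then x else 0 := fun r hr => congrFun hux ⟨r, hr⟩
  have h1 := key i u hu
  rw [form, Finset.sum_eq_single (n - 1), Finset.sum_eq_single (n - 1), Nat.sub_self,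
    shift_pow_apply, hu1 _ (by omega), if_pos rfl, Nat.sub_add_cancel hn, hx, zero_add,
    inner_self_eq_zero] at h1
  · exact h1
  · intro r hr hrn
    have := Finset.mem_range.1 hr
    rw [hu1 r (by omega), if_neg hrn, map_zero, inner_zero_right]
  · simp
  · intro j hj hjn
    have := Finset.mem_range.1 hj
    refine Finset.sum_eq_zero fun r hr => ?_
    have := Finset.mem_range.1 hr
    rw [hu1 r (by omega), if_neg (by omega), map_zero, inner_zero_right]
  · intro hn'
    exact absurd (Finset.mem_range.2 (by omega)) hn'

lemma eq_zero_of_form_rootSpace (hA : A.IsNondegenerateOfOrder n) {c : ℂ} {y : ℕ → H}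
    (hy : y ∈ rootSpace A.adjointPencil (starRingEnd ℂ c))
    (h : ∀ u ∈ rootSpace A c, form A n u y = 0) : y = 0 := by
  have := finiteDimensional_sol hA
  refine eq_zero_of_form_sol hA (rootSpace_le_sol _ _ hy) fun u hu => ?_
  have : sol A ≤ LinearMap.ker (formLeft A n y) := by
    rw [← iSup_rootSpace]
    refine iSup_le fun d v hv => ?_
    rcases eq_or_ne d c with rfl | hdc
    · exact h v hv
    · refine form_rootSpace_eq_zero hA.1 (fun h' => hdc ?_) hv hy
      exact ((starRingEnd ℂ).injective h').symm
  exact this hu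

/-- The values of `form` against the members of a Jordan system. -/
lemma form_values_injective (hA : A.IsNondegenerateOfOrder n) {c : ℂ} {ι : Type*} [Fintype ι]
    {p : ι → ℕ} {w : ι → ℕ → H} (hw : IsJordanSystem A c p w) :
    Function.Injective (((LinearMap.pi fun i : Σ k, Fin (p k + 1) =>
      formLeft A.adjointPencil n (chainVec c p w i)).domRestrict
        (rootSpace A.adjointPencil (starRingEnd ℂ c)))) := by
  rw [← LinearMap.ker_eq_bot, LinearMap.ker_eq_bot']
  intro y hy
  refine Subtype.ext (eq_zero_of_form_rootSpace hA y.2 fun u hu => ?_)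
  have : rootSpace A c ≤ LinearMap.ker (formLeft A n (y : ℕ → H)) := by
    rw [← hw.span, Submodule.span_le]
    rintro _ ⟨i, rfl⟩
    have h1 := congrFun hy i
    change form A.adjointPencil n y (chainVec c p w i) = 0 at h1
    rw [form_adjointPencil] at h1
    exact (map_eq_zero _).1 h1
  exact this hu

/-- Pairing with a Jordan basis embeds the root space of the adjoint pencil into coordinate space.
Used for `A` and for `A*`, this gives equal dimensions. -/
lemma finrank_rootSpace_adjoint_le (hA : A.IsNondegenerateOfOrder n) (c : ℂ) :
    Module.finrank ℂ (rootSpace A.adjointPencil (starRingEnd ℂ c))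
      ≤ Module.finrank ℂ (rootSpace A c) := by
  have := finiteDimensional_rootSpace hA c
  obtain ⟨r, p, w, hw⟩ := exists_jordanSystem A c
  refine (LinearMap.finrank_le_finrank_of_injective (form_values_injective hA hw)).trans ?_
  rw [Module.finrank_pi, card_chainIndex, hw.finrank_rootSpace]

lemma finrank_rootSpace_adjoint (hA : A.IsNondegenerateOfOrder n) (c : ℂ) :
    Module.finrank ℂ (rootSpace A.adjointPencil (starRingEnd ℂ c))
      = Module.finrank ℂ (rootSpace A c) := by
  refine le_antisymm (finrank_rootSpace_adjoint_le hA c) ?_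
  have := finrank_rootSpace_adjoint_le hA.adjointPencil (starRingEnd ℂ c)
  rwa [adjointPencil_adjointPencil, Complex.conj_conj] at this

/-- The pairing between the root spaces at `c` and `conj c` is perfect: injectivity and equality of
dimensions give surjectivity. -/
lemma exists_form_values (hA : A.IsNondegenerateOfOrder n) {c : ℂ} {ι : Type*} [Fintype ι]
    {p : ι → ℕ} {w : ι → ℕ → H} (hw : IsJordanSystem A c p w) (a : (Σ k, Fin (p k + 1)) → ℂ) :
    ∃ y ∈ rootSpace A.adjointPencil (starRingEnd ℂ c), ∀ i, form A n (chainVec c p w i) y = a i := by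
  have := finiteDimensional_rootSpace hA.adjointPencil (starRingEnd ℂ c)
  have hs := (LinearMap.injective_iff_surjective_of_finrank_eq_finrank (by
    rw [finrank_rootSpace_adjoint hA, hw.finrank_rootSpace, Module.finrank_pi,
      card_chainIndex])).1 (form_values_injective hA hw)
  obtain ⟨y, hy⟩ := hs fun i => starRingEnd ℂ (a i)
  refine ⟨y, y.2, fun i => ?_⟩
  have h1 := congrFun hy i
  change form A.adjointPencil n y (chainVec c p w i) = starRingEnd ℂ (a i) at h1
  rw [form_adjointPencil] at h1
  exact (starRingEnd ℂ).injective h1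

end Adjoint

end Pencil
end

/-! ### The resolvent of the shift and the values of the pencil -/

noncomputable section

namespace Pencil

variable {H : Type*} [NormedAddCommGroup H] [InnerProductSpace ℂ H]

/-- The resolvent of the shift on sequences annihilated by `dev c ^ S`. -/
def res (c : ℂ) (S : ℕ) (μ : ℂ) : Module.End ℂ (ℕ → H) :=
  ∑ s ∈ Finset.range S, ((μ - c) ^ (s + 1))⁻¹ • dev c ^ s

lemma res_apply (c : ℂ) (S : ℕ) (μ : ℂ) (u : ℕ → H) :
    res c S μ u = ∑ s ∈ Finset.range S, ((μ - c) ^ (s + 1))⁻¹ • (dev c ^ s) u := by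
  simp [res, LinearMap.sum_apply]

lemma res_eq_of_le {c : ℂ} {S S' : ℕ} (h : S ≤ S') {u : ℕ → H} (hu : (dev c ^ S) u = 0) (μ : ℂ) :
    res c S' μ u = res c S μ u := by
  rw [res_apply, res_apply]
  symm
  refine Finset.sum_subset (Finset.range_mono h) fun s _ hs => ?_
  obtain ⟨d, rfl⟩ := Nat.exists_eq_add_of_le (not_lt.1 (fun h => hs (Finset.mem_range.2 h)))
  rw [add_comm S d, pow_add (dev c), Module.End.mul_apply, hu, map_zero, smul_zero]

/-- The finite geometric series in `(μ - c)⁻¹ dev c` telescopes, and its last term is killed by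
nilpotency. -/
lemma smul_res_sub_shift {c μ : ℂ} (hμ : μ ≠ c) {S : ℕ} {u : ℕ → H} (hu : (dev c ^ S) u = 0) :
    μ • res c S μ u - shift (res c S μ u) = u := by
  have hne : μ - c ≠ 0 := sub_ne_zero.2 hμ
  have h1 : ∀ S : ℕ, (μ - c) • res c S μ u - dev c (res c S μ u)
      = u - ((μ - c) ^ S)⁻¹ • (dev c ^ S) u := by
    intro S
    induction S with
    | zero => simp [res_apply]
    | succ S ih =>
      rw [res_apply] at *
      rw [Finset.sum_range_succ, smul_add, map_add, add_sub_add_comm, ih, map_smul, smul_smul,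
        pow_succ' (dev c), Module.End.mul_apply, pow_succ', mul_inv, mul_inv_cancel_left₀ hne]
      abel
  have h2 := h1 S
  rw [hu, smul_zero, sub_zero] at h2
  rw [shift_eq_dev c, ← sub_sub, ← sub_smul, h2]

lemma act_res (A : Pencil H) (c : ℂ) (S : ℕ) (μ : ℂ) (u : ℕ → H) :
    act A (res c S μ u) = res c S μ (act A u) := by
  simp only [res_apply, map_sum, map_smul, act_dev_pow_comm]

lemma res_mem_sol {A : Pencil H} {u : ℕ → H} (hu : u ∈ sol A) (c : ℂ) (S : ℕ) (μ : ℂ) :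
    res c S μ u ∈ sol A := by
  rw [mem_sol, act_res, mem_sol.1 hu, map_zero]

/-- The polynomial part of `A(μ) (U 0)`, where `μ U - shift U = u`. -/
def gPoly (A : Pencil H) (n : ℕ) (u : ℕ → H) (μ : ℂ) : H :=
  ∑ j ∈ Finset.range n, ∑ i ∈ Finset.range (j + 1), μ ^ (j - i) • A.coeff (j + 1) (u i)

/-- The polynomial part of `(A(μ) (U 0), Y 0)`, where `μ U - shift U = u` and
`conj μ Y - shift Y = y`. -/
def remPoly (A : Pencil H) (n : ℕ) (u y : ℕ → H) (μ : ℂ) : ℂ :=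
  ∑ j ∈ Finset.range n, ∑ i ∈ Finset.range (j + 1), ∑ r ∈ Finset.range (j - i),
    μ ^ (j - i - 1 - r) * inner ℂ (y r) (A.coeff (j + 1) (u i))

lemma pow_smul_resolvent {μ : ℂ} {U u : ℕ → H} (hU : μ • U - shift U = u) (j : ℕ) :
    μ ^ j • U 0 = U j + ∑ i ∈ Finset.range j, μ ^ (j - 1 - i) • u i := by
  have hU' : ∀ i, μ • U i = U (i + 1) + u i := fun i => by
    rw [← hU]; simp
  induction j with
  | zero => simp
  | succ j ih =>
    rw [pow_succ', mul_smul, ih, smul_add, hU', Finset.sum_range_succ, Finset.smul_sum, add_assoc,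
      add_comm (u j)]
    simp only [Nat.add_sub_cancel, Nat.sub_self, pow_zero, one_smul]
    congr 2
    refine Finset.sum_congr rfl fun i hi => ?_
    have : j - i = (j - 1 - i) + 1 := by have := Finset.mem_range.1 hi; omega
    rw [this, pow_succ', mul_smul]

/-- Replacing `μ ^ j U_0` by `U_j` plus a polynomial in `μ` turns `A(μ)U_0` into the recurrence. For
a solution all poles of `U_0` at eigenvalues are thus cancelled by `A(μ)`. -/
lemma value_resolvent {A : Pencil H} {n : ℕ} (hA : A.natDegree ≤ n) {μ : ℂ} {U u : ℕ → H}
    (hU : μ • U - shift U = u) : A.value μ (U 0) = act A U 0 + gPoly A n u μ := by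
  rw [value_eq_sum_range hA, act_apply hA, sum_apply]
  have h1 : ∀ j, (μ ^ j • A.coeff j) (U 0) = A.coeff j (U j)
      + ∑ i ∈ Finset.range j, μ ^ (j - 1 - i) • A.coeff j (u i) := fun j => by
    rw [smul_apply, ← map_smul, pow_smul_resolvent hU, map_add, map_sum]
    simp only [map_smul]
  rw [Finset.sum_congr rfl fun j _ => h1 j, Finset.sum_add_distrib]
  congr 1
  · simp only [zero_add]
  · rw [Finset.sum_range_succ', Finset.range_zero, Finset.sum_empty, add_zero, gPoly]
    rfl

/-- The same substitution is made a second time, on the `Y` side: the powers of `μ` in `gPoly` are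
absorbed by `Y_0`. This ties the values of the pencil, where dissipativity lives, to `form`. -/
lemma inner_resolvent {A : Pencil H} {n : ℕ} (hA : A.natDegree ≤ n) {μ : ℂ} {U u Y y : ℕ → H}
    (hU : μ • U - shift U = u) (hU' : U ∈ sol A) (hY : starRingEnd ℂ μ • Y - shift Y = y) :
    inner ℂ (Y 0) (A.value μ (U 0)) = form A n u Y + remPoly A n u y μ := by
  rw [value_resolvent hA hU, mem_sol.1 hU', Pi.zero_apply, zero_add, gPoly, form, remPoly,
    inner_sum, ← Finset.sum_add_distrib]
  refine Finset.sum_congr rfl fun j _ => ?_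
  rw [inner_sum, ← Finset.sum_add_distrib]
  refine Finset.sum_congr rfl fun i _ => ?_
  have h1 : (inner ℂ (Y 0) (μ ^ (j - i) • A.coeff (j + 1) (u i)) : ℂ)
      = inner ℂ (starRingEnd ℂ μ ^ (j - i) • Y 0) (A.coeff (j + 1) (u i)) := by
    rw [inner_smul_left, inner_smul_right, map_pow, Complex.conj_conj]
  rw [h1, pow_smul_resolvent hY, inner_add_left, sum_inner]
  congr 1
  refine Finset.sum_congr rfl fun r _ => ?_
  rw [inner_smul_left, map_pow, Complex.conj_conj]

/-- The remainder involves only `u i`, `y r` with `i + r < 2 * l - 1`, so one of the indices is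
below `l`. This is where the order `n = 2l` enters. -/
lemma remPoly_eq_zero {A : Pencil H} {l : ℕ} {u y : ℕ → H} (hu : ∀ i < l, u i = 0)
    (hy : ∀ i < l, y i = 0) (μ : ℂ) : remPoly A (2 * l) u y μ = 0 := by
  refine Finset.sum_eq_zero fun j hj => Finset.sum_eq_zero fun i hi =>
    Finset.sum_eq_zero fun r hr => ?_
  have h1 := Finset.mem_range.1 hj
  have h2 := Finset.mem_range.1 hi
  have h3 := Finset.mem_range.1 hr
  rcases lt_or_ge i l with h | h
  · rw [hu i h, map_zero, inner_zero_right, mul_zero]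
  · rw [hy r (by omega), inner_zero_left, mul_zero]

lemma form_eq_zero_of_init {A : Pencil H} {l : ℕ} {u y : ℕ → H} (hu : ∀ i < l, u i = 0)
    (hy : ∀ i < l, y i = 0) : form A (2 * l) u y = 0 := by
  refine Finset.sum_eq_zero fun j hj => Finset.sum_eq_zero fun i hi => ?_
  have h1 := Finset.mem_range.1 hj
  have h2 := Finset.mem_range.1 hi
  rcases lt_or_ge i l with h | h
  · rw [hu i h, map_zero, inner_zero_right]
  · rw [hy (j - i) (by omega), inner_zero_left]

lemma form_res_right (A : Pencil H) (n : ℕ) (u y : ℕ → H) (c : ℂ) (S : ℕ) (μ : ℂ) :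
    form A n u (res c S (starRingEnd ℂ μ) y)
      = ∑ s ∈ Finset.range S,
        ((μ - starRingEnd ℂ c) ^ (s + 1))⁻¹ * form A n u ((dev c ^ s) y) := by
  rw [res_apply, form_sum_right]
  refine Finset.sum_congr rfl fun s _ => ?_
  rw [form_smul_right]
  simp

lemma continuous_gPoly (A : Pencil H) (n : ℕ) (u : ℕ → H) : Continuous (gPoly A n u) := by
  unfold gPoly
  fun_prop

lemma continuous_remPoly (A : Pencil H) (n : ℕ) (u y : ℕ → H) : Continuous (remPoly A n u y) := by
  unfold remPoly
  fun_prop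

lemma continuous_value (A : Pencil H) : Continuous A.value := by
  have : A.value = fun c => ∑ j ∈ Finset.range (A.natDegree + 1), c ^ j • A.coeff j :=
    funext (value_eq_sum_range le_rfl)
  rw [this]
  fun_prop

section Singular

open Asymptotics

/-- A bounded singular part vanishes. -/
lemma eq_zero_of_singular_isBigO {E : Type*} [NormedAddCommGroup E] [NormedSpace ℝ E] (c : ℝ)
    (S : ℕ) (a : ℕ → E)
    (h : (fun t : ℝ => ∑ s ∈ Finset.range S, ((t - c) ^ (s + 1))⁻¹ • a s)
      =O[𝓝[≠] c] fun _ => (1 : ℝ)) : ∀ s < S, a s = 0 := by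
  induction S with
  | zero => simp
  | succ S ih =>
    have hcont : Continuous fun t : ℝ => ∑ s ∈ Finset.range (S + 1), (t - c) ^ (S - s) • a s := by
      fun_prop
    have h1 : Filter.Tendsto (fun t : ℝ => ∑ s ∈ Finset.range (S + 1), (t - c) ^ (S - s) • a s)
        (𝓝[≠] c) (𝓝 (a S)) := by
      have := (hcont.tendsto c).mono_left (nhdsWithin_le_nhds (s := {c}ᶜ))
      rw [Finset.sum_range_succ, Finset.sum_eq_zero] at this
      · simpa using this
      · intro s hs
        have := Finset.mem_range.1 hs
        rw [sub_self, zero_pow (by omega), zero_smul]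
    -- Multiplied by `(t - c) ^ (S + 1)`, the bounded sum tends to zero, while term by term it tends
    -- to its top coefficient `a S`.
    have h2 : Filter.Tendsto (fun t : ℝ => (t - c) ^ (S + 1) •
        ∑ s ∈ Finset.range (S + 1), ((t - c) ^ (s + 1))⁻¹ • a s) (𝓝[≠] c) (𝓝 0) := by
      have h3 : Filter.Tendsto (fun t : ℝ => (t - c) ^ (S + 1)) (𝓝[≠] c) (𝓝 0) := by
        have : Continuous fun t : ℝ => (t - c) ^ (S + 1) := by fun_prop
        have := (this.tendsto c).mono_left (nhdsWithin_le_nhds (s := {c}ᶜ))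
        simpa using this
      have h4 := (isBigO_refl (fun t : ℝ => (t - c) ^ (S + 1)) (𝓝[≠] c)).smul h
      refine h4.trans_tendsto ?_
      simpa using h3
    have haS : a S = 0 := by
      refine tendsto_nhds_unique (h1.congr' ?_) h2
      filter_upwards [self_mem_nhdsWithin] with t ht
      have hne : t - c ≠ 0 := sub_ne_zero.2 ht
      rw [Finset.smul_sum]
      refine Finset.sum_congr rfl fun s hs => ?_
      have hs' := Finset.mem_range.1 hs
      rw [smul_smul]
      congr 1
      have : S + 1 = (S - s) + (s + 1) := by omega
      rw [this, pow_add, mul_inv_cancel_right₀ (pow_ne_zero _ hne)]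
    have h5 := ih (by simpa only [Finset.sum_range_succ, haS, smul_zero, add_zero] using h)
    intro s hs
    rcases Nat.lt_succ_iff_lt_or_eq.1 hs with h' | rfl
    · exact h5 s h'
    · exact haS

lemma isBigO_one_of_continuous {E : Type*} [NormedAddCommGroup E] {f : ℝ → E} (hf : Continuous f)
    (c : ℝ) : f =O[𝓝[≠] c] fun _ => (1 : ℝ) :=
  ((hf.tendsto c).mono_left nhdsWithin_le_nhds).isBigO_one ℝ

/-- A real number `a` with `a / (t - c)` bounded above near `c`, on both sides, is zero. -/
lemma eq_zero_of_div_add_nonpos {c a : ℝ} {g : ℝ → ℝ} (hg : Continuous g)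
    (h : ∀ t, t ≠ c → (t - c)⁻¹ * a + g t ≤ 0) : a = 0 := by
  have hcont : Continuous fun t : ℝ => a + (t - c) * g t := by fun_prop
  have hlim : Filter.Tendsto (fun t : ℝ => a + (t - c) * g t) (𝓝 c) (𝓝 a) := by
    have := hcont.tendsto c
    simpa using this
  have key : ∀ t, t ≠ c → a + (t - c) * g t = (t - c) * ((t - c)⁻¹ * a + g t) := by
    intro t ht
    rw [mul_add, mul_inv_cancel_left₀ (sub_ne_zero.2 ht)]
  refine le_antisymm ?_ ?_
  · refine le_of_tendsto (hlim.mono_left (nhdsWithin_le_nhds (s := Set.Ioi c))) ?_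
    filter_upwards [self_mem_nhdsWithin] with t ht
    have ht' : c < t := ht
    rw [key t ht'.ne']
    exact mul_nonpos_of_nonneg_of_nonpos (sub_nonneg.2 ht'.le) (h t ht'.ne')
  · refine ge_of_tendsto (hlim.mono_left (nhdsWithin_le_nhds (s := Set.Iio c))) ?_
    filter_upwards [self_mem_nhdsWithin] with t ht
    have ht' : t < c := ht
    rw [key t ht'.ne]
    exact mul_nonneg_of_nonpos_of_nonpos (sub_nonpos.2 ht'.le) (h t ht'.ne)

end Singular

/-! ### Consequences of dissipativity at a real point -/

section Dissipative

variable [CompleteSpace H]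

/-- The Cauchy-Schwarz inequality for the imaginary part of a dissipative operator. -/
lemma norm_sub_adjoint_sq_le {T : H →L[ℂ] H} (hT : ∀ x, (inner ℂ x (T x)).im ≤ 0) {M : ℝ}
    (hM : 0 < M) (hTM : ‖T‖ ≤ M) (x : H) :
    ‖T x - ContinuousLinearMap.adjoint T x‖ ^ 2 ≤ 4 * M * -(inner ℂ x (T x)).im := by
  set P : H →L[ℂ] H := T - ContinuousLinearMap.adjoint T
  set y := P x with hy
  have hyx : T x - ContinuousLinearMap.adjoint T x = y := rfl
  rw [hyx]
  have hinner : ∀ z, (inner ℂ z (P x) : ℂ)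
      = inner ℂ z (T x) - starRingEnd ℂ (inner ℂ x (T z)) := by
    intro z
    have : P x = T x - ContinuousLinearMap.adjoint T x := rfl
    rw [this, inner_sub_right, ContinuousLinearMap.adjoint_inner_right, inner_conj_symm]
  have h1 := hinner y
  rw [← hy, inner_self_eq_norm_sq_to_K] at h1
  have h1re := congrArg Complex.re h1
  simp only [Complex.sub_re, Complex.conj_re] at h1re
  have h2 : ((‖y‖ : ℂ) ^ 2).re = ‖y‖ ^ 2 := by
    rw [← Complex.ofReal_pow, Complex.ofReal_re]
  have h1re' : ‖y‖ ^ 2 = (inner ℂ y (T x)).re - (inner ℂ x (T y)).re := by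
    rw [← h1re]; exact h2.symm
  -- Dissipativity tested at `x - i t y` gives `(t - t² M)‖y‖² ≤ -Im (Tx, x)`; this `t` maximizes
  -- the factor on the left.
  set t : ℝ := (2 * M)⁻¹
  have h3 := hT (x - ((t : ℂ) * Complex.I) • y)
  have h4 : (inner ℂ (x - ((t : ℂ) * Complex.I) • y) (T (x - ((t : ℂ) * Complex.I) • y))).im
      = (inner ℂ x (T x)).im - t * (inner ℂ x (T y)).re + t * (inner ℂ y (T x)).re
        + t ^ 2 * (inner ℂ y (T y)).im := by
    simp only [map_sub, map_smul, inner_sub_left, inner_sub_right, inner_smul_left,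
      inner_smul_right, Complex.sub_im, Complex.sub_re, Complex.mul_im, Complex.mul_re, map_mul,
      Complex.conj_I, Complex.conj_ofReal, Complex.ofReal_re, Complex.ofReal_im, Complex.I_re,
      Complex.I_im, Complex.neg_re, Complex.neg_im]
    ring
  rw [h4] at h3
  have h5 : |(inner ℂ y (T y)).im| ≤ M * ‖y‖ ^ 2 := by
    refine (Complex.abs_im_le_norm _).trans ((norm_inner_le_norm y (T y)).trans ?_)
    have : ‖T y‖ ≤ M * ‖y‖ := (T.le_opNorm y).trans (by gcongr)
    nlinarith [norm_nonneg y]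
  have h6 := (abs_le.1 h5).1
  have ht : t * (2 * M) = 1 := inv_mul_cancel₀ (by positivity)
  have ht0 : 0 < t := by positivity
  have h7 : t ^ 2 * -(M * ‖y‖ ^ 2) ≤ t ^ 2 * (inner ℂ y (T y)).im := by gcongr
  have h8 : t ^ 2 * (M * ‖y‖ ^ 2) = t / 2 * ‖y‖ ^ 2 := by
    have : t ^ 2 * M = t / 2 := by linear_combination t / 2 * ht
    rw [← mul_assoc, this]
  have h9 : t * ‖y‖ ^ 2 = t * (inner ℂ y (T x)).re - t * (inner ℂ x (T y)).re := by
    rw [h1re']; ring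
  have h10 : t / 2 * ‖y‖ ^ 2 ≤ -(inner ℂ x (T x)).im := by linarith
  calc ‖y‖ ^ 2 = 4 * M * (t / 2 * ‖y‖ ^ 2) := by linear_combination -‖y‖ ^ 2 * ht
    _ ≤ 4 * M * -(inner ℂ x (T x)).im := by gcongr

/-- The parallelogram law for the nonnegative quadratic form `-Im (Tx, x)`, with the term at `x - y`
dropped. -/
lemma im_inner_add_ge {T : H →L[ℂ] H} (hT : ∀ x, (inner ℂ x (T x)).im ≤ 0) (x y : H) :
    -(inner ℂ (x + y) (T (x + y))).im
      ≤ 2 * -(inner ℂ x (T x)).im + 2 * -(inner ℂ y (T y)).im := by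
  have h1 := hT (x - y)
  simp only [map_sub, map_add, inner_sub_left, inner_sub_right, inner_add_left, inner_add_right,
    Complex.sub_im, Complex.add_im] at h1 ⊢
  linarith

open Asymptotics

variable {A : Pencil H} {n : ℕ}

/-- The imaginary part of `(A(t) û(t), û(t))` at real `t`, where `û` is the resolvent of the
shift applied to `u`. -/
def imForm (A : Pencil H) (c : ℝ) (S : ℕ) (u : ℕ → H) (t : ℝ) : ℝ :=
  (inner ℂ (res c S t u 0) (A.value (t : ℂ) (res c S t u 0))).im

lemma ofReal_singular (t c : ℝ) (s : ℕ) (x : H) :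
    (((t : ℂ) - c) ^ (s + 1))⁻¹ • x = ((t - c) ^ (s + 1))⁻¹ • x := by
  rw [← Complex.ofReal_sub, ← Complex.ofReal_pow, ← Complex.ofReal_inv, Complex.coe_smul]

lemma inner_res_eq (hA : A.natDegree ≤ n) {c t : ℝ} (ht : t ≠ c) {S : ℕ} {u y : ℕ → H}
    (hu : u ∈ sol A) (hSu : (dev (c : ℂ) ^ S) u = 0) (hSy : (dev (c : ℂ) ^ S) y = 0) :
    inner ℂ (res c S t y 0) (A.value (t : ℂ) (res c S t u 0))
      = ∑ s ∈ Finset.range S, ((t - c) ^ (s + 1))⁻¹ • form A n u ((dev (c : ℂ) ^ s) y)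
        + remPoly A n u y t := by
  have ht' : (t : ℂ) ≠ c := fun h => ht (Complex.ofReal_injective h)
  have hY : starRingEnd ℂ (t : ℂ) • res c S t y - shift (res c S t y) = y := by
    rw [Complex.conj_ofReal]; exact smul_res_sub_shift ht' hSy
  rw [inner_resolvent hA (smul_res_sub_shift ht' hSu) (res_mem_sol hu _ _ _) hY]
  congr 1
  have := form_res_right A n u y c S t
  rw [Complex.conj_ofReal, Complex.conj_ofReal] at this
  rw [this]
  refine Finset.sum_congr rfl fun s _ => ?_
  rw [← ofReal_singular, smul_eq_mul]

lemma imForm_eq (hA : A.natDegree ≤ n) {c t : ℝ} (ht : t ≠ c) {S : ℕ} {u : ℕ → H}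
    (hu : u ∈ sol A) (hSu : (dev (c : ℂ) ^ S) u = 0) :
    imForm A c S u t
      = ∑ s ∈ Finset.range S, ((t - c) ^ (s + 1))⁻¹ • (form A n u ((dev (c : ℂ) ^ s) u)).im
        + (remPoly A n u u t).im := by
  rw [imForm, inner_res_eq hA ht hu hSu hSu, Complex.add_im, Complex.im_sum]
  simp only [Complex.smul_im]

lemma imForm_nonpos (hdiss : A.IsDissipative) (c : ℝ) (S : ℕ) (u : ℕ → H) (t : ℝ) :
    imForm A c S u t ≤ 0 := hdiss t _

/-- A solution with bounded imaginary part is a solution for the adjoint pencil. -/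
lemma mem_sol_adjoint_of_imForm (hdiss : A.IsDissipative) {c : ℝ} {S : ℕ} {u : ℕ → H}
    (hu : u ∈ sol A) (hSu : (dev (c : ℂ) ^ S) u = 0)
    (hb : imForm A c S u =O[𝓝[≠] c] fun _ => (1 : ℝ)) : u ∈ sol A.adjointPencil := by
  set n := A.natDegree
  have hA : A.natDegree ≤ n := le_rfl
  have hval : ∀ t : ℝ, t ≠ c → A.value (t : ℂ) (res c S t u 0) = gPoly A n u t := by
    intro t ht
    have ht' : (t : ℂ) ≠ c := fun h => ht (Complex.ofReal_injective h)
    rw [value_resolvent hA (smul_res_sub_shift ht' hSu), mem_sol.1 (res_mem_sol hu _ _ _),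
      Pi.zero_apply, zero_add]
  -- For the adjoint pencil the recurrence does not yet vanish: its defect is exactly the singular
  -- part at `c`.
  have hval' : ∀ t : ℝ, t ≠ c → A.adjointPencil.value (t : ℂ) (res c S t u 0)
      = ∑ s ∈ Finset.range S, ((t - c) ^ (s + 1))⁻¹ •
          (dev (c : ℂ) ^ s) (act A.adjointPencil u) 0 + gPoly A.adjointPencil n u t := by
    intro t ht
    have ht' : (t : ℂ) ≠ c := fun h => ht (Complex.ofReal_injective h)
    rw [value_resolvent (natDegree_adjointPencil_le hA) (smul_res_sub_shift ht' hSu), act_res,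
      res_apply, Finset.sum_apply]
    simp only [Pi.smul_apply, ofReal_singular]
  obtain ⟨M, hM0, hM⟩ : ∃ M : ℝ, 0 < M ∧ ∀ᶠ t : ℝ in 𝓝[≠] c, ‖A.value (t : ℂ)‖ ≤ M := by
    have hc : Continuous fun t : ℝ => ‖A.value (t : ℂ)‖ :=
      ((continuous_value A).comp Complex.continuous_ofReal).norm
    refine ⟨‖A.value (c : ℂ)‖ + 1, by positivity, ?_⟩
    exact nhdsWithin_le_nhds ((hc.tendsto c).eventually_le_const (lt_add_one _))
  obtain ⟨C, hC⟩ := hb.bound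
  -- Cauchy-Schwarz bounds `A(t)U_0 - A(t)*U_0` by the imaginary form. As `A(t)U_0` is polynomial,
  -- `A(t)*U_0` is bounded and its singular part must vanish.
  have hdiff : (fun t : ℝ => A.value (t : ℂ) (res c S t u 0)
      - A.adjointPencil.value (t : ℂ) (res c S t u 0)) =O[𝓝[≠] c] fun _ => (1 : ℝ) := by
    refine IsBigO.of_bound (4 * M * C + 1) ?_
    filter_upwards [hM, hC] with t h1 h2
    rw [adjointPencil_value_ofReal]
    have h3 := norm_sub_adjoint_sq_le (hdiss t) hM0 h1 (res c S t u 0)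
    have h4 : -imForm A c S u t ≤ C := by
      rw [norm_one, mul_one, Real.norm_eq_abs] at h2
      exact (neg_le_abs _).trans h2
    have h5 : 4 * M * -imForm A c S u t ≤ 4 * M * C := by gcongr
    have h6 := h3.trans h5
    rw [norm_one, mul_one]
    nlinarith [norm_nonneg (A.value (t : ℂ) (res c S t u 0)
      - ContinuousLinearMap.adjoint (A.value (t : ℂ)) (res c S t u 0))]
  have hg : (fun t : ℝ => gPoly A n u (t : ℂ)) =O[𝓝[≠] c] fun _ => (1 : ℝ) :=
    isBigO_one_of_continuous ((continuous_gPoly A n u).comp Complex.continuous_ofReal) c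
  have hg' : (fun t : ℝ => gPoly A.adjointPencil n u (t : ℂ)) =O[𝓝[≠] c] fun _ => (1 : ℝ) :=
    isBigO_one_of_continuous
      ((continuous_gPoly A.adjointPencil n u).comp Complex.continuous_ofReal) c
  have hsing := eq_zero_of_singular_isBigO c S
    (fun s => (dev (c : ℂ) ^ s) (act A.adjointPencil u) 0) (by
      refine ((hg.sub hdiff).sub hg').congr' ?_ Filter.EventuallyEq.rfl
      filter_upwards [self_mem_nhdsWithin] with t ht
      rw [hval t ht, hval' t ht]
      abel)
  refine mem_sol.2 (eq_zero_of_dev_pow_apply_zero (c : ℂ) fun j => ?_)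
  rcases lt_or_ge j S with h | h
  · exact hsing j h
  · obtain ⟨d, rfl⟩ := Nat.exists_eq_add_of_le h
    rw [← act_dev_pow_comm, add_comm, pow_add, Module.End.mul_apply, hSu, map_zero, map_zero]
    rfl

/-- The first half of a chain of a dissipative pencil at a real point. -/
theorem half_chain (hA : A.natDegree ≤ n) (hdiss : A.IsDissipative) (c : ℝ) {p : ℕ} {w : ℕ → H}
    (hw : kd c w p ∈ sol A) {h : ℕ} (hh : 2 * h ≤ p) :
    kd c w h ∈ sol A.adjointPencil ∧
      imForm A c (h + 1) (kd c w h) =O[𝓝[≠] c] fun _ => (1 : ℝ) := by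
  induction h using Nat.strong_induction_on with
  | _ h ih =>
  have hu : kd c w h ∈ sol A := kd_mem_sol_of_le hw (by omega)
  have hS : (dev (c : ℂ) ^ (h + 1)) (kd c w h) = 0 := dev_pow_kd_of_lt (by omega) _ _
  have hz : ∀ s, s ≠ 0 → s < h + 1 → form A n (kd c w h) ((dev (c : ℂ) ^ s) (kd c w h)) = 0 := by
    intro s hs0 hs
    rw [dev_pow_kd_of_le (by omega)]
    have h1 := (ih (h - s) (by omega) (by omega)).1
    -- The member `h - s` already belongs to `sol A*` by induction, so the power `p - h` can be
    -- moved to it. It kills that member, since `h - s < p - h` for `s ≥ 1`.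
    have h2 : kd c w h = (dev (c : ℂ) ^ (p - h)) (kd c w p) := by
      rw [dev_pow_kd_of_le (by omega)]; congr 1; omega
    rw [h2, form_dev_pow hA hw h1, Complex.conj_ofReal, dev_pow_kd_of_lt (by omega),
      form_zero_right]
  have hf : ∀ t : ℝ, t ≠ c → imForm A c (h + 1) (kd c w h) t
      = (t - c)⁻¹ * (form A n (kd c w h) (kd c w h)).im
        + (remPoly A n (kd c w h) (kd c w h) t).im := by
    intro t ht
    rw [imForm_eq hA ht hu hS, Finset.sum_eq_single 0]
    · simp
    · intro s hs hs0
      rw [hz s hs0 (Finset.mem_range.1 hs), Complex.zero_im, smul_zero]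
    · simp
  have hcont : Continuous fun t : ℝ => (remPoly A n (kd c w h) (kd c w h) t).im :=
    Complex.continuous_im.comp ((continuous_remPoly A n _ _).comp Complex.continuous_ofReal)
  -- What remains is at most a simple pole, which would take both signs near `c`; the sign condition
  -- removes it. When `2 * h = p` only the imaginary part of this form is forced to vanish.
  have h0 : (form A n (kd c w h) (kd c w h)).im = 0 :=
    eq_zero_of_div_add_nonpos hcont fun t ht => by
      rw [← hf t ht]; exact imForm_nonpos hdiss _ _ _ _
  have hb : imForm A c (h + 1) (kd c w h) =O[𝓝[≠] c] fun _ => (1 : ℝ) := by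
    refine (isBigO_one_of_continuous hcont c).congr' ?_ Filter.EventuallyEq.rfl
    filter_upwards [self_mem_nhdsWithin] with t ht
    rw [hf t ht, h0, mul_zero, zero_add]
  exact ⟨mem_sol_adjoint_of_imForm hdiss hu hS hb, hb⟩

/-- The span of the first halves of all chains at `c`. -/
def halfSpace (A : Pencil H) (c : ℂ) : Submodule ℂ (ℕ → H) :=
  Submodule.span ℂ {u | ∃ (p h : ℕ) (w : ℕ → H), kd c w p ∈ sol A ∧ 2 * h ≤ p ∧ u = kd c w h}

lemma kd_mem_halfSpace {c : ℂ} {p h : ℕ} {w : ℕ → H} (hw : kd c w p ∈ sol A) (hh : 2 * h ≤ p) :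
    kd c w h ∈ halfSpace A c := Submodule.subset_span ⟨p, h, w, hw, hh, rfl⟩

lemma halfSpace_le_rootSpace (c : ℂ) : halfSpace A c ≤ rootSpace A c := by
  refine Submodule.span_le.2 ?_
  rintro _ ⟨p, h, w, hw, hh, rfl⟩
  exact kd_mem_rootSpace hw (by omega)

/-- Boundedness passes from generators to sums by the parallelogram inequality. The threshold `S₀`
lets two summands be treated with a common number of resolvent terms. -/
lemma halfSpace_imForm (hA : A.natDegree ≤ n) (hdiss : A.IsDissipative) (c : ℝ) {u : ℕ → H}
    (hu : u ∈ halfSpace A c) : ∃ S₀ : ℕ, ∀ S, S₀ ≤ S → (dev (c : ℂ) ^ S) u = 0 ∧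
      imForm A c S u =O[𝓝[≠] c] fun _ => (1 : ℝ) := by
  induction hu using Submodule.span_induction with
  | mem u hu =>
    obtain ⟨p, h, w, hw, hh, rfl⟩ := hu
    refine ⟨h + 1, fun S hS => ⟨dev_pow_kd_of_lt (by omega) _ _, ?_⟩⟩
    refine (half_chain hA hdiss c hw hh).2.congr_left fun t => ?_
    rw [imForm, imForm, res_eq_of_le hS (dev_pow_kd_of_lt (by omega) _ _)]
  | zero =>
    refine ⟨0, fun S _ => ⟨map_zero _, (isBigO_zero (fun _ => (1 : ℝ)) _).congr_left fun t => ?_⟩⟩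
    simp [imForm]
  | add u v _ _ hu hv =>
    obtain ⟨S₁, h1⟩ := hu
    obtain ⟨S₂, h2⟩ := hv
    refine ⟨max S₁ S₂, fun S hS => ?_⟩
    obtain ⟨h1, h1'⟩ := h1 S ((le_max_left _ _).trans hS)
    obtain ⟨h2, h2'⟩ := h2 S ((le_max_right _ _).trans hS)
    refine ⟨by rw [map_add, h1, h2, add_zero], ?_⟩
    refine IsBigO.trans (IsBigO.of_bound 1 (Filter.Eventually.of_forall fun t => ?_))
      ((h1'.norm_left.const_mul_left 2).add (h2'.norm_left.const_mul_left 2))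
    have h3 := im_inner_add_ge (hdiss t) (res c S t u 0) (res c S t v 0)
    have h4 : imForm A c S (u + v) t = (inner ℂ (res c S t u 0 + res c S t v 0)
      (A.value (t : ℂ) (res c S t u 0 + res c S t v 0))).im := by
      rw [imForm, map_add]; rfl
    rw [one_mul, Real.norm_of_nonpos (imForm_nonpos hdiss _ _ _ _), h4,
      Real.norm_of_nonpos (imForm_nonpos hdiss _ _ u _),
      Real.norm_of_nonpos (imForm_nonpos hdiss _ _ v _)]
    exact h3.trans (le_abs_self _)
  | smul a u _ hu =>
    obtain ⟨S₀, h0⟩ := hu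
    refine ⟨S₀, fun S hS => ⟨by rw [map_smul, (h0 S hS).1, smul_zero], ?_⟩⟩
    refine ((h0 S hS).2.const_mul_left (‖a‖ ^ 2)).congr_left fun t => ?_
    have h4 : imForm A c S (a • u) t = (inner ℂ (a • res c S t u 0)
      (A.value (t : ℂ) (a • res c S t u 0))).im := by
      rw [imForm, map_smul]; rfl
    rw [h4, map_smul, inner_smul_left, inner_smul_right, ← mul_assoc, Complex.conj_mul', imForm,
      ← Complex.ofReal_pow, Complex.im_ofReal_mul]

lemma halfSpace_le_sol_adjoint (hdiss : A.IsDissipative) (c : ℝ) :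
    halfSpace A c ≤ sol A.adjointPencil := by
  refine Submodule.span_le.2 ?_
  rintro _ ⟨p, h, w, hw, hh, rfl⟩
  exact (half_chain le_rfl hdiss c hw hh).1

lemma halfSpace_le_rootSpace_adjoint (hdiss : A.IsDissipative) (c : ℝ) :
    halfSpace A c ≤ rootSpace A.adjointPencil c :=
  le_inf (halfSpace_le_sol_adjoint hdiss c) ((halfSpace_le_rootSpace (c : ℂ)).trans inf_le_right)

/-- The imaginary form has singular coefficients `Im form u ((dev c ^ s) u)`. Boundedness makes all
of them zero; the one at `s = 0` is wanted. -/
lemma form_self_im_eq_zero (hA : A.natDegree ≤ n) (hdiss : A.IsDissipative) (c : ℝ) {u : ℕ → H}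
    (hu : u ∈ halfSpace A c) : (form A n u u).im = 0 := by
  obtain ⟨S₀, h⟩ := halfSpace_imForm hA hdiss c hu
  obtain ⟨hS, hb⟩ := h (S₀ + 1) (by omega)
  have husol := rootSpace_le_sol A c (halfSpace_le_rootSpace (c : ℂ) hu)
  have hcont : Continuous fun t : ℝ => (remPoly A n u u t).im :=
    Complex.continuous_im.comp ((continuous_remPoly A n _ _).comp Complex.continuous_ofReal)
  have := eq_zero_of_singular_isBigO c (S₀ + 1)
    (fun s => (form A n u ((dev (c : ℂ) ^ s) u)).im) (by
      refine (hb.sub (isBigO_one_of_continuous hcont c)).congr' ?_ Filter.EventuallyEq.rfl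
      filter_upwards [self_mem_nhdsWithin] with t ht
      rw [imForm_eq hA ht husol hS, add_sub_cancel_right])
  exact this 0 (by omega)

/-- `form` is Hermitian on the half space. -/
lemma form_conj (hA : A.natDegree ≤ n) (hdiss : A.IsDissipative) (c : ℝ) {u y : ℕ → H}
    (hu : u ∈ halfSpace A c) (hy : y ∈ halfSpace A c) :
    form A n y u = starRingEnd ℂ (form A n u y) := by
  have h1 := form_self_im_eq_zero hA hdiss c (add_mem hu hy)
  have h2 := form_self_im_eq_zero hA hdiss c (add_mem hu (Submodule.smul_mem _ Complex.I hy))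
  have hu0 := form_self_im_eq_zero hA hdiss c hu
  have hy0 := form_self_im_eq_zero hA hdiss c hy
  simp only [form_add_left, form_add_right, form_smul_left, form_smul_right, Complex.conj_I,
    Complex.add_im, Complex.add_re, Complex.mul_im, Complex.mul_re, Complex.neg_re, Complex.neg_im, Complex.I_re,
    Complex.I_im, hu0, hy0] at h1 h2
  apply Complex.ext
  · rw [Complex.conj_re]; linarith
  · rw [Complex.conj_im]; linarith

/-- Orthogonality of the first halves of chains. -/
lemma form_half_eq_zero (hA : A.natDegree ≤ n) (hdiss : A.IsDissipative) (c : ℝ) {p p' h h' : ℕ}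
    {w w' : ℕ → H} (hw : kd c w p ∈ sol A) (hw' : kd c w' p' ∈ sol A) (hh : 2 * h ≤ p)
    (hh' : 2 * h' ≤ p') (hlt : h + h' < max p p') :
    form A n (kd c w h) (kd c w' h') = 0 := by
  have key : ∀ {p p' h h' : ℕ} {w w' : ℕ → H}, kd c w p ∈ sol A → kd c w' p' ∈ sol A →
      2 * h ≤ p → 2 * h' ≤ p' → h + h' < p → form A n (kd c w h) (kd c w' h') = 0 := by
    intro p p' h h' w w' hw hw' hh hh' hlt
    have h2 : kd c w h = (dev (c : ℂ) ^ (p - h)) (kd c w p) := by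
      rw [dev_pow_kd_of_le (by omega)]; congr 1; omega
    rw [h2, form_dev_pow hA hw (half_chain hA hdiss c hw' hh').1, Complex.conj_ofReal,
      dev_pow_kd_of_lt (by omega), form_zero_right]
  rcases lt_max_iff.1 hlt with h1 | h1
  · exact key hw hw' hh hh' h1
  · rw [form_conj hA hdiss c (kd_mem_halfSpace hw' hh') (kd_mem_halfSpace hw hh),
      key hw' hw hh' hh (by omega), map_zero]

end Dissipative

end Pencil
end

/-! ### Adjoint systems and biorthogonality of derived chains -/

noncomputable section

namespace Pencil

variable {H : Type*} [NormedAddCommGroup H] [InnerProductSpace ℂ H]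

lemma res_kd (c : ℂ) {S q : ℕ} (h : q < S) (μ : ℂ) (y : ℕ → H) :
    res c S μ (kd c y q) 0 = ∑ s ∈ Finset.range (q + 1), ((μ - c) ^ (s + 1))⁻¹ • y (q - s) := by
  rw [res_eq_of_le h (dev_pow_kd_of_lt (Nat.lt_succ_self q) c y), res_apply, Finset.sum_apply]
  refine Finset.sum_congr rfl fun s hs => ?_
  rw [dev_pow_kd_of_le (by have := Finset.mem_range.1 hs; omega), Pi.smul_apply, kd_apply_zero]

/-- Collecting the coefficient of `w k j` leaves the pairing with the resolvent of the member `p k -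
j` of the derived chain of `z`, taken at the conjugate point. -/
lemma principalPart_apply {ι : Type} [Fintype ι] (c : ℂ) (p : ι → ℕ) (w z : ι → ℕ → H) {S : ℕ}
    (hS : ∀ k, p k < S) (μ : ℂ) (x : H) :
    principalPart c p w z μ x = ∑ k, ∑ j ∈ Finset.range (p k + 1),
      (inner ℂ (res (starRingEnd ℂ c) S (starRingEnd ℂ μ)
        (kd (starRingEnd ℂ c) (z k) (p k - j)) 0) x : ℂ) • w k j := by
  rw [principalPart, sum_apply]
  refine Finset.sum_congr rfl fun k _ => ?_
  rw [sum_apply, ← Finset.sum_range_reflect]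
  have h1 : ∀ s ∈ Finset.range (p k + 1), (((μ - c) ^ (p k + 1 - (p k + 1 - 1 - s)))⁻¹ •
      ∑ j ∈ Finset.range (p k + 1 - 1 - s + 1),
        InnerProductSpace.rankOne ℂ (w k j) (z k (p k + 1 - 1 - s - j))) x
      = ∑ j ∈ Finset.range (p k - s + 1),
        (((μ - c) ^ (s + 1))⁻¹ * inner ℂ (z k (p k - j - s)) x) • w k j := by
    intro s hs
    have hs' := Finset.mem_range.1 hs
    rw [smul_apply, sum_apply, Finset.smul_sum]
    refine Finset.sum_congr (by congr 1) fun j _ => ?_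
    rw [InnerProductSpace.rankOne_apply, smul_smul]
    have e1 : p k + 1 - (p k + 1 - 1 - s) = s + 1 := by omega
    have e2 : p k + 1 - 1 - s - j = p k - j - s := by omega
    rw [e1, e2]
  rw [Finset.sum_congr rfl h1]
  rw [Finset.sum_comm' (t' := Finset.range (p k + 1))
    (s' := fun j => Finset.range (p k - j + 1)) (by
      intro s j; simp only [Finset.mem_range]; omega)]
  refine Finset.sum_congr rfl fun j _ => ?_
  rw [res_kd _ (lt_of_le_of_lt (Nat.sub_le _ _) (hS k)), sum_inner, Finset.sum_smul]
  refine Finset.sum_congr rfl fun s _ => ?_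
  rw [inner_smul_left]
  simp

/-- Reindexing that transfers `dev c ^ s` from the `z` chain to the `w` chain in an expansion
pairing the positions `p - j` and `j`. -/
lemma sum_shifted_smul {E : Type*} [AddCommGroup E] [Module ℂ E] (p s : ℕ) (α : ℕ → ℂ)
    (β : ℕ → E) :
    ∑ j ∈ Finset.range (p + 1), (if s ≤ p - j then α (p - j - s) else 0) • β j
      = ∑ j ∈ Finset.range (p + 1), α (p - j) • (if s ≤ j then β (j - s) else 0) := by
  rcases lt_or_ge p s with h | h
  · rw [Finset.sum_eq_zero, Finset.sum_eq_zero]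
    · intro j hj
      have := Finset.mem_range.1 hj
      rw [if_neg (by omega), smul_zero]
    · intro j _
      rw [if_neg (by omega), zero_smul]
  · obtain ⟨d, rfl⟩ := Nat.exists_eq_add_of_le h
    have h1 : ∑ j ∈ Finset.range (s + d + 1), (if s ≤ s + d - j then α (s + d - j - s) else 0) • β j
        = ∑ j ∈ Finset.range (d + 1), α (d - j) • β j := by
      symm
      refine (Finset.sum_congr rfl fun j hj => ?_).trans
        (Finset.sum_subset (Finset.range_mono (by omega : d + 1 ≤ s + d + 1)) fun j hj0 hj => ?_)
      · have := Finset.mem_range.1 hj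
        rw [if_pos (by omega), show s + d - j - s = d - j by omega]
      · rw [Finset.mem_range] at hj hj0
        rw [if_neg (by omega), zero_smul]
    have h2 : ∑ j ∈ Finset.range (s + d + 1), α (s + d - j) • (if s ≤ j then β (j - s) else 0)
        = ∑ j ∈ Finset.range (d + 1), α (d - j) • β j := by
      rw [show s + d + 1 = s + (d + 1) by omega, Finset.sum_range_add, Finset.sum_eq_zero, zero_add]
      · refine Finset.sum_congr rfl fun j hj => ?_
        rw [if_pos (by omega), show s + d - (s + j) = d - j by omega, Nat.add_sub_cancel_left]
      · intro j hj
        have := Finset.mem_range.1 hj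
        rw [if_neg (by omega), smul_zero]
    rw [h1, h2]

variable [CompleteSpace H] {A : Pencil H} {n : ℕ}

/-- Biorthogonality of the derived chains of `w` and `z`. -/
def IsDualSystem {ι : Type*} [DecidableEq ι] (A : Pencil H) (n : ℕ) (c : ℂ) (p : ι → ℕ)
    (w z : ι → ℕ → H) : Prop :=
  ∀ k k' h h', h ≤ p k → h' ≤ p k' →
    form A n (kd c (w k) h) (kd (starRingEnd ℂ c) (z k') h')
      = if k = k' ∧ h + h' = p k then 1 else 0

section

variable {ι : Type} [Fintype ι] [DecidableEq ι] {c : ℂ} {p : ι → ℕ} {w z : ι → ℕ → H}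

lemma IsDualSystem.linearIndependent (hd : IsDualSystem A n c p w z) :
    LinearIndependent ℂ fun k => z k 0 := by
  rw [Fintype.linearIndependent_iff]
  intro a ha k
  have h1 : ∑ k', a k' • kd (starRingEnd ℂ c) (z k') 0 = 0 := by
    ext r
    have := congrArg (fun x => ((r.choose 0 : ℂ) * starRingEnd ℂ c ^ (r - 0)) • x) ha
    simp only [Finset.smul_sum, smul_zero] at this
    rw [Finset.sum_apply, Pi.zero_apply, ← this]
    refine Finset.sum_congr rfl fun k' _ => ?_
    simp [kd, smul_smul, mul_comm]
  have h2 := congrArg (form A n (kd c (w k) (p k))) h1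
  rw [form_zero_right, form_sum_right, Finset.sum_eq_single k] at h2
  · rw [form_smul_right, hd k k _ _ le_rfl (Nat.zero_le _), if_pos ⟨rfl, rfl⟩, mul_one] at h2
    exact (map_eq_zero _).1 h2
  · intro k' _ hk'
    rw [form_smul_right, hd k k' _ _ le_rfl (Nat.zero_le _), if_neg (fun h => hk' h.1.symm),
      mul_zero]
  · simp

variable [FiniteDimensional ℂ H]

/-- The top of the `k`-th dual chain represents the functional with value one at the `k`-th
eigenvector and zero at all other chain members. Adjointness of `dev` gives the remaining
biorthogonality relations. -/
lemma exists_dualSystem (hA : A.IsNondegenerateOfOrder n) (hw : IsJordanSystem A c p w) :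
    ∃ z : ι → ℕ → H, IsJordanSystem A.adjointPencil (starRingEnd ℂ c) p z ∧
      IsDualSystem A n c p w z := by
  have h1 : ∀ k : ι, ∃ y ∈ rootSpace A.adjointPencil (starRingEnd ℂ c),
      ∀ i, form A n (chainVec c p w i) y = if i.1 = k ∧ (i.2 : ℕ) = 0 then 1 else 0 :=
    fun k => exists_form_values hA hw _
  choose Y hY hform using h1
  have hform' : ∀ k k' h, h ≤ p k' →
      form A n (kd c (w k') h) (Y k) = if k' = k ∧ h = 0 then 1 else 0 := fun k k' h hh =>
    hform k ⟨k', ⟨h, Nat.lt_succ_iff.2 hh⟩⟩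
  have hdevY : ∀ k j, (dev (starRingEnd ℂ c) ^ j) (Y k)
      ∈ rootSpace A.adjointPencil (starRingEnd ℂ c) := fun k j => dev_pow_mem_rootSpace (hY k) j
  have hval : ∀ k k' h j, h ≤ p k' →
      form A n (kd c (w k') h) ((dev (starRingEnd ℂ c) ^ j) (Y k))
        = if k' = k ∧ h = j then 1 else 0 := by
    intro k k' h j hh
    rw [← form_dev_pow hA.1 (kd_mem_sol_of_le (hw.mem k') hh) (rootSpace_le_sol _ _ (hY k)),
      dev_pow_kd]
    split_ifs with h1 h2 h2
    · rw [hform' _ _ _ (by omega), if_pos ⟨h2.1, by omega⟩]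
    · rw [hform' _ _ _ (by omega), if_neg (fun h3 => h2 ⟨h3.1, by omega⟩)]
    · omega
    · rw [form_zero_left]
  -- It pairs to zero with the whole root space, because the `k`-th chain has no member at position
  -- `p k + 1`; hence `Y k` is the top of a chain of the right length.
  have htop : ∀ k, (dev (starRingEnd ℂ c) ^ (p k + 1)) (Y k) = 0 := by
    intro k
    refine eq_zero_of_form_rootSpace hA (hdevY k _) fun u hu => ?_
    rw [← hw.span] at hu
    obtain ⟨a, rfl⟩ := exists_sum_kd hu
    rw [form_sum_left]
    refine Finset.sum_eq_zero fun k' _ => ?_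
    rw [form_sum_left]
    refine Finset.sum_eq_zero fun h hh => ?_
    have hh' := Nat.lt_succ_iff.1 (Finset.mem_range.1 hh)
    rw [form_smul_left, hval _ _ _ _ hh', if_neg, mul_zero]
    rintro ⟨rfl, h2⟩
    omega
  have hkd := fun k => eq_kd (htop k)
  set z : ι → ℕ → H := fun k j => (dev (starRingEnd ℂ c) ^ (p k - j)) (Y k) 0 with hz
  have hkd' : ∀ k, Y k = kd (starRingEnd ℂ c) (z k) (p k) := hkd
  have hdual : IsDualSystem A n c p w z := by
    intro k k' h h' hh hh'
    have : kd (starRingEnd ℂ c) (z k') h' = (dev (starRingEnd ℂ c) ^ (p k' - h')) (Y k') := by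
      rw [hkd' k', dev_pow_kd_of_le (by omega)]
      congr 1
      omega
    rw [this, hval _ _ _ _ hh]
    refine if_congr (and_congr_right ?_) rfl rfl
    rintro rfl
    omega
  have hmem : ∀ k, kd (starRingEnd ℂ c) (z k) (p k) ∈ sol A.adjointPencil := fun k =>
    hkd' k ▸ rootSpace_le_sol _ _ (hY k)
  refine ⟨z, ⟨hmem, hdual.linearIndependent, ?_⟩, hdual⟩
  have := finiteDimensional_rootSpace hA.adjointPencil (starRingEnd ℂ c)
  refine Submodule.eq_of_le_of_finrank_le (span_chainVec_le hmem) ?_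
  rw [finrank_span_eq_card (chainVec_linearIndependent _ p z hdual.linearIndependent),
    card_chainIndex, finrank_rootSpace_adjoint hA, hw.finrank_rootSpace]

lemma IsDualSystem.expand (hd : IsDualSystem A n c p w z) (hw : IsJordanSystem A c p w)
    {u : ℕ → H} (hu : u ∈ rootSpace A c) :
    u = ∑ k, ∑ j ∈ Finset.range (p k + 1),
      form A n u (kd (starRingEnd ℂ c) (z k) (p k - j)) • kd c (w k) j := by
  rw [← hw.span] at hu
  obtain ⟨a, ha⟩ := exists_sum_kd hu
  have h1 : ∀ k, ∀ j ∈ Finset.range (p k + 1),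
      form A n u (kd (starRingEnd ℂ c) (z k) (p k - j)) = a k j := by
    intro k j hj
    have hj' := Nat.lt_succ_iff.1 (Finset.mem_range.1 hj)
    rw [ha, form_sum_left, Finset.sum_eq_single k]
    · rw [form_sum_left, Finset.sum_eq_single j]
      · rw [form_smul_left, hd k k j _ hj' (Nat.sub_le _ _), if_pos ⟨rfl, by omega⟩, mul_one]
      · intro i hi hij
        have hi' := Nat.lt_succ_iff.1 (Finset.mem_range.1 hi)
        rw [form_smul_left, hd k k i _ hi' (Nat.sub_le _ _), if_neg, mul_zero]
        rintro ⟨-, h⟩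
        omega
      · exact fun h => absurd hj h
    · intro k' _ hk'
      rw [form_sum_left]
      refine Finset.sum_eq_zero fun i hi => ?_
      have hi' := Nat.lt_succ_iff.1 (Finset.mem_range.1 hi)
      rw [form_smul_left, hd k' k i _ hi' (Nat.sub_le _ _), if_neg (fun h => hk' h.1), mul_zero]
    · simp
  conv_lhs => rw [ha]
  exact Finset.sum_congr rfl fun k _ => Finset.sum_congr rfl fun j hj => by rw [h1 k j hj]

open Asymptotics in
/-- An adjoint system at a real point is biorthogonal to the given system. -/
lemma IsAdjointSystem.isDualSystem {c : ℝ} (hA : A.IsNondegenerateOfOrder n)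
    (hw : IsJordanSystem A c p w) (hz : A.IsAdjointSystem c p w z) :
    IsDualSystem A n c p w z := by
  obtain ⟨hzcan, R, hR, hRev⟩ := hz
  have hzsol : ∀ k, kd (c : ℂ) (z k) (p k) ∈ sol A.adjointPencil := by
    intro k
    have := hzcan.1.mem k
    rwa [Complex.conj_ofReal] at this
  -- Biorthogonality will be read off from this expansion, applied to the chain members themselves
  -- and compared with their trivial expansion.
  have key : ∀ u ∈ rootSpace A c, u = ∑ k, ∑ j ∈ Finset.range (p k + 1),
      form A n u (kd c (z k) (p k - j)) • kd c (w k) j := by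
    intro u hu
    obtain ⟨S₁, hS₁⟩ := (mem_rootSpace.1 hu).2
    have husol := rootSpace_le_sol A c hu
    set S₀ := S₁ + Finset.univ.sup p + 1
    have hpS : ∀ k, p k < S₀ := fun k => by
      have := Finset.le_sup (f := p) (Finset.mem_univ k); omega
    have hSu : ∀ S, S₀ ≤ S → (dev (c : ℂ) ^ S) u = 0 := by
      intro S hS
      obtain ⟨d, rfl⟩ := Nat.exists_eq_add_of_le hS
      rw [show S₀ + d = (Finset.univ.sup p + 1 + d) + S₁ by omega, pow_add, Module.End.mul_apply,
        hS₁, map_zero]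
    have hcoef : ∀ s, (dev (c : ℂ) ^ s) u 0 = ∑ k, ∑ j ∈ Finset.range (p k + 1),
        form A n u ((dev (c : ℂ) ^ s) (kd c (z k) (p k - j))) • w k j := by
      intro s
      set S := S₀ + s + 1
      have hSu' := hSu S (by omega)
      have hpS' : ∀ k, p k < S := fun k => (hpS k).trans (by omega)
      have htend : Filter.Tendsto (fun t : ℝ => (t : ℂ)) (𝓝[≠] c) (𝓝[≠] (c : ℂ)) := by
        refine tendsto_nhdsWithin_of_tendsto_nhds_of_eventually_within _
          ((Complex.continuous_ofReal.tendsto c).mono_left nhdsWithin_le_nhds) ?_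
        filter_upwards [self_mem_nhdsWithin] with t ht h
        exact ht (Complex.ofReal_injective h)
      have hRb : (fun t : ℝ => R t (gPoly A n u t)) =O[𝓝[≠] c] fun _ => (1 : ℝ) := by
        have hc : ContinuousAt (fun t : ℝ => R t (gPoly A n u t)) c := by
          have h1 : ContinuousAt (fun t : ℝ => R t) c :=
            ContinuousAt.comp (f := fun t : ℝ => (t : ℂ)) hR.continuousAt
              Complex.continuous_ofReal.continuousAt
          exact h1.clm_apply
            ((continuous_gPoly A n u).comp Complex.continuous_ofReal).continuousAt
        exact (hc.tendsto.mono_left nhdsWithin_le_nhds).isBigO_one ℝ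
      have hrem : (fun t : ℝ => ∑ k, ∑ j ∈ Finset.range (p k + 1),
          remPoly A n u (kd c (z k) (p k - j)) t • w k j) =O[𝓝[≠] c] fun _ => (1 : ℝ) := by
        refine isBigO_one_of_continuous ?_ c
        refine continuous_finsetSum _ fun k _ => continuous_finsetSum _ fun j _ => ?_
        exact ((continuous_remPoly A n u _).comp Complex.continuous_ofReal).smul continuous_const
      -- Here `A(t)U_0` is a polynomial, and inverting `A(t)` by the principal part plus `R` gives a
      -- second expression for `U_0`. Their singular coefficients at `c` must agree.
      have hsing := eq_zero_of_singular_isBigO c S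
        (fun s => (dev (c : ℂ) ^ s) u 0 - ∑ k, ∑ j ∈ Finset.range (p k + 1),
          form A n u ((dev (c : ℂ) ^ s) (kd c (z k) (p k - j))) • w k j) (by
        refine (hRb.add hrem).congr' ?_ Filter.EventuallyEq.rfl
        filter_upwards [self_mem_nhdsWithin, htend.eventually hRev] with t ht hRt
        have ht' : (t : ℂ) ≠ c := fun h => ht (Complex.ofReal_injective h)
        have hAU : A.value (t : ℂ) (res c S t u 0) = gPoly A n u t := by
          rw [value_resolvent hA.1 (smul_res_sub_shift ht' hSu'),
            mem_sol.1 (res_mem_sol husol _ _ _), Pi.zero_apply, zero_add]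
        have hU : res c S t u 0 = principalPart c p w z t (gPoly A n u t)
            + R t (gPoly A n u t) := by
          rw [← add_apply, ← hRt.2, ← hAU]
          exact (congrArg (fun T : H →L[ℂ] H => T (res c S t u 0))
            (Ring.inverse_mul_cancel _ hRt.1)).symm
        rw [principalPart_apply c p w z hpS'] at hU
        simp only [Complex.conj_ofReal] at hU
        have hin : ∀ k j, inner ℂ (res c S t (kd c (z k) (p k - j)) 0)
            (A.value (t : ℂ) (res c S t u 0)) = ∑ s ∈ Finset.range S, ((t - c) ^ (s + 1))⁻¹ •
              form A n u ((dev (c : ℂ) ^ s) (kd c (z k) (p k - j)))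
              + remPoly A n u (kd c (z k) (p k - j)) t := fun k j =>
          inner_res_eq hA.1 ht husol hSu'
            (dev_pow_kd_of_lt (lt_of_le_of_lt (Nat.sub_le _ _) (hpS' k)) _ _)
        simp only [hAU] at hin
        simp only [hin, add_smul, Finset.sum_add_distrib] at hU
        have hU' : res c S t u 0
            = ∑ s ∈ Finset.range S, ((t - c) ^ (s + 1))⁻¹ • (dev (c : ℂ) ^ s) u 0 := by
          rw [res_apply, Finset.sum_apply]
          exact Finset.sum_congr rfl fun s _ => ofReal_singular _ _ _ _
        have hsw : ∑ k, ∑ j ∈ Finset.range (p k + 1), (∑ s ∈ Finset.range S,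
            ((t - c) ^ (s + 1))⁻¹ • form A n u ((dev (c : ℂ) ^ s) (kd c (z k) (p k - j)))) • w k j
            = ∑ s ∈ Finset.range S, ((t - c) ^ (s + 1))⁻¹ • ∑ k, ∑ j ∈ Finset.range (p k + 1),
              form A n u ((dev (c : ℂ) ^ s) (kd c (z k) (p k - j))) • w k j := by
          simp only [Finset.sum_smul, Finset.smul_sum, smul_assoc]
          rw [Finset.sum_comm]
          exact Finset.sum_congr rfl fun k _ => Finset.sum_comm
        rw [hsw, hU'] at hU
        simp only [smul_sub, Finset.sum_sub_distrib]
        rw [hU]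
        abel)
      exact sub_eq_zero.1 (hsing s (by omega))
    rw [← sub_eq_zero]
    refine eq_zero_of_dev_pow_apply_zero (c : ℂ) fun s => ?_
    rw [map_sub, Pi.sub_apply, hcoef s, sub_eq_zero, map_sum, Finset.sum_apply]
    refine Finset.sum_congr rfl fun k _ => ?_
    rw [map_sum, Finset.sum_apply]
    have h1 := sum_shifted_smul (p k) s (fun i => form A n u (kd c (z k) i)) (w k)
    refine Eq.trans (Finset.sum_congr rfl fun j _ => ?_)
      (h1.trans (Finset.sum_congr rfl fun j _ => ?_))
    · rw [dev_pow_kd]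
      split_ifs
      · rfl
      · rw [form_zero_right]
    · rw [map_smul, Pi.smul_apply, dev_pow_kd]
      split_ifs
      · rw [kd_apply_zero]
      · rfl
  intro k k' h h' hh hh'
  have hk := key _ (kd_mem_rootSpace (hw.mem k) hh)
  have h0 : ∑ i, ∑ j ∈ Finset.range (p i + 1),
      (form A n (kd c (w k) h) (kd c (z i) (p i - j)) - if i = k ∧ j = h then 1 else 0)
        • kd c (w i) j = 0 := by
    simp only [sub_smul, Finset.sum_sub_distrib]
    rw [← hk, sub_eq_zero, Finset.sum_eq_single k, Finset.sum_eq_single h]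
    · simp
    · intro j _ hj
      rw [if_neg (fun h => hj h.2), zero_smul]
    · intro h1
      exact absurd (Finset.mem_range.2 (Nat.lt_succ_iff.2 hh)) h1
    · intro i _ hi
      exact Finset.sum_eq_zero fun j _ => by rw [if_neg (fun h => hi h.1), zero_smul]
    · simp
  have h1 := coeff_eq_zero_of_sum_kd (a := fun i j =>
    form A n (kd c (w k) h) (kd c (z i) (p i - j)) - if i = k ∧ j = h then 1 else 0) hw.li h0 k'
    (Nat.sub_le (p k') h')
  rw [sub_eq_zero, Nat.sub_sub_self hh'] at h1
  rw [Complex.conj_ofReal, h1]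
  refine if_congr ⟨?_, ?_⟩ rfl rfl
  · rintro ⟨rfl, h2⟩
    exact ⟨rfl, by omega⟩
  · rintro ⟨rfl, h2⟩
    exact ⟨rfl, by omega⟩

/-- The value of a pencil away from its eigenvalues is invertible. -/
lemma isUnit_value {d : ℂ} (hd : rootSpace A d = ⊥) : IsUnit (A.value d) := by
  have hinj : Function.Injective (A.value d : H →ₗ[ℂ] H) := by
    rw [← LinearMap.ker_eq_bot, LinearMap.ker_eq_bot']
    intro x hx
    have h1 := kd_mem_rootSpace (mem_ker_value_iff.1 (LinearMap.mem_ker.2 hx)) le_rfl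
    rw [hd, Submodule.mem_bot] at h1
    have := congrFun h1 0
    rwa [kd_apply_zero] at this
  rw [ContinuousLinearMap.isUnit_iff_bijective]
  exact ⟨hinj, LinearMap.injective_iff_surjective.1 hinj⟩

lemma eventually_isUnit_value (hA : A.IsNondegenerateOfOrder n) (c : ℂ) :
    ∀ᶠ μ in 𝓝[≠] c, IsUnit (A.value μ) := by
  have := finiteDimensional_sol hA
  have h1 : ({d | rootSpace A d ≠ ⊥} \ {c})ᶜ ∈ 𝓝 c :=
    (((finite_rootSpace_ne_bot (A := A)).subset Set.sdiff_subset).isClosed.isOpen_compl).mem_nhds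
      (by simp)
  filter_upwards [nhdsWithin_le_nhds h1, self_mem_nhdsWithin] with μ h2 h3
  refine isUnit_value ?_
  by_contra h4
  exact h2 ⟨h4, h3⟩

/-- Decomposition of a solution along the root spaces. -/
lemma exists_decomposition (hA : A.IsNondegenerateOfOrder n) {u : ℕ → H} (hu : u ∈ sol A)
    (c : ℂ) (S₀ : ℕ) : ∃ (F : Finset ℂ) (f : ℂ → ℕ → H) (S : ℕ), c ∈ F ∧ S₀ ≤ S ∧
      (∀ d, f d ∈ rootSpace A d) ∧ (∀ d, (dev d ^ S) (f d) = 0) ∧ u = ∑ d ∈ F, f d := by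
  have := finiteDimensional_sol hA
  rw [← iSup_rootSpace, Submodule.mem_iSup_iff_exists_finsupp] at hu
  obtain ⟨f, hf, rfl⟩ := hu
  choose s hs using fun d => (mem_rootSpace.1 (hf d)).2
  refine ⟨insert c f.support, f, S₀ + f.support.sup s, Finset.mem_insert_self _ _,
    Nat.le_add_right _ _, hf, fun d => ?_, ?_⟩
  · by_cases hd : d ∈ f.support
    · obtain ⟨e, he⟩ := Nat.exists_eq_add_of_le (Finset.le_sup (f := s) hd)
      rw [he, ← add_assoc, add_right_comm, pow_add, Module.End.mul_apply, hs, map_zero]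
    · rw [Finsupp.notMem_support_iff.1 hd, map_zero]
  · exact Finset.sum_subset (Finset.subset_insert _ _) fun d _ hd =>
      Finsupp.notMem_support_iff.1 hd

lemma analyticAt_res {c d : ℂ} (h : c ≠ d) (S : ℕ) (u : ℕ → H) :
    AnalyticAt ℂ (fun μ => res d S μ u 0) c := by
  simp only [res_apply, Finset.sum_apply, Pi.smul_apply]
  refine Finset.analyticAt_fun_sum _ fun s _ => ?_
  refine AnalyticAt.smul (AnalyticAt.inv (by fun_prop) ?_) analyticAt_const
  exact pow_ne_zero _ (sub_ne_zero.2 h)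

/-- The system dual to a Jordan system is its adjoint system. -/
lemma IsDualSystem.isAdjointSystem (hA : A.IsNondegenerateOfOrder n)
    (hw : IsJordanSystem A c p w) (hz : IsJordanSystem A.adjointPencil (starRingEnd ℂ c) p z)
    (hd : IsDualSystem A n c p w z) : A.IsAdjointSystem c p w z := by
  refine ⟨hz.isCanonicalSystem, ?_⟩
  -- For `n = 0` the pencil is an invertible constant and there are no chains. Otherwise index `n -
  -- 1` is meaningful below.
  rcases Nat.eq_zero_or_pos n with rfl | hn
  · have hbot : ∀ d, rootSpace A d = ⊥ := fun d => by
      rw [eq_bot_iff]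
      intro u hu
      exact sol_eq_zero_of_init hA (rootSpace_le_sol A d hu) (by simp)
    have hempty : IsEmpty ι := ⟨fun k => by
      have h1 := kd_mem_rootSpace (hw.mem k) (Nat.zero_le _)
      rw [hbot, Submodule.mem_bot] at h1
      have := congrFun h1 0
      rw [kd_apply_zero] at this
      exact hw.li.ne_zero k this⟩
    refine ⟨fun _ => Ring.inverse (A.value 0), analyticAt_const,
      Filter.Eventually.of_forall fun μ => ⟨isUnit_value (hbot μ), ?_⟩⟩
    rw [principalPart, Finset.univ_eq_empty, Finset.sum_empty, zero_add,
      value_eq_sum_range hA.1, value_eq_sum_range hA.1]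
    simp
  -- With such initial data the polynomial `gPoly` is the constant `v`, so `A(μ)⁻¹ v` is the zeroth
  -- member of the resolvent of `u`. Its component at `c` will be the principal part and the other
  -- components are analytic at `c`.
  have hu : ∀ v : H, ∃ u ∈ sol A, (∀ i < n - 1, u i = 0) ∧ A.coeff n (u (n - 1)) = v := by
    intro v
    obtain ⟨x, hx⟩ := (coeff_bijective hA).2 v
    obtain ⟨u, hu, hux⟩ := exists_sol hA fun r : Fin n => if (r : ℕ) = n - 1 then x else 0
    refine ⟨u, hu, fun i hi => ?_, ?_⟩
    · have := congrFun hux ⟨i, by omega⟩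
      simpa [hi.ne] using this
    · have := congrFun hux ⟨n - 1, by omega⟩
      simp only [restr_apply, if_true] at this
      rw [this, hx]
  choose u husol hu0 hun using hu
  have hdec := fun v => exists_decomposition hA (husol v) c (Finset.univ.sup p + 1)
  choose F f S hcF hS hf hSf hsum using hdec
  let b := stdOrthonormalBasis ℂ H
  have hpS : ∀ v k, p k < S v := fun v k =>
    lt_of_lt_of_le (Nat.lt_succ_iff.2 (Finset.le_sup (f := p) (Finset.mem_univ k))) (hS v)
  refine ⟨fun μ => ∑ i, InnerProductSpace.rankOne ℂ
    (∑ d ∈ (F (b i)).erase c, res d (S (b i)) μ (f (b i) d) 0) (b i), ?_, ?_⟩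
  · refine Finset.analyticAt_fun_sum _ fun i _ => ?_
    have h1 : AnalyticAt ℂ (fun μ => ∑ d ∈ (F (b i)).erase c, res d (S (b i)) μ (f (b i) d) 0) c :=
      Finset.analyticAt_fun_sum _ fun d hd => analyticAt_res (Finset.ne_of_mem_erase hd).symm _ _
    let L : H →L[ℂ] (H →L[ℂ] H) := (InnerProductSpace.rankOne ℂ).flip (b i)
    exact (L.analyticAt _).comp h1
  · have hne : ∀ᶠ μ in 𝓝[≠] c, ∀ i, μ ∉ F (b i) := by
      rw [Filter.eventually_all]
      intro i
      have h1 : (((F (b i)).erase c : Finset ℂ) : Set ℂ)ᶜ ∈ 𝓝 c :=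
        ((Finset.finite_toSet _).isClosed.isOpen_compl).mem_nhds (by simp)
      filter_upwards [nhdsWithin_le_nhds h1, self_mem_nhdsWithin] with μ h2 h3 h4
      exact h2 (Finset.mem_coe.2 (Finset.mem_erase.2 ⟨h3, h4⟩))
    filter_upwards [eventually_isUnit_value hA c, hne] with μ hμ hμF
    refine ⟨hμ, ?_⟩
    refine ContinuousLinearMap.coe_injective (b.toBasis.ext fun i => ?_)
    rw [OrthonormalBasis.coe_toBasis]
    set v := b i with hv
    have hR : (∑ i, InnerProductSpace.rankOne ℂ
        (∑ d ∈ (F (b i)).erase c, res d (S (b i)) μ (f (b i) d) 0) (b i)) v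
        = ∑ d ∈ (F v).erase c, res d (S v) μ (f v d) 0 := by
      rw [sum_apply, Finset.sum_eq_single i]
      · rw [InnerProductSpace.rankOne_apply, hv, b.inner_eq_one, one_smul]
      · intro i' _ hi'
        rw [InnerProductSpace.rankOne_apply, hv, b.inner_eq_zero hi', zero_smul]
      · simp
    set U := ∑ d ∈ F v, res d (S v) μ (f v d) with hUdef
    have hU : μ • U - shift U = u v := by
      rw [hUdef, Finset.smul_sum, map_sum, ← Finset.sum_sub_distrib, hsum v]
      refine Finset.sum_congr rfl fun d hd => smul_res_sub_shift ?_ (hSf v d)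
      rintro rfl
      exact hμF i hd
    have hUsol : U ∈ sol A :=
      Submodule.sum_mem _ fun d _ => res_mem_sol (rootSpace_le_sol A d (hf v d)) _ _ _
    have hAU : A.value μ (U 0) = v := by
      rw [value_resolvent hA.1 hU, mem_sol.1 hUsol, Pi.zero_apply, zero_add, gPoly,
        Finset.sum_eq_single (n - 1), Finset.sum_eq_single (n - 1), Nat.sub_self, pow_zero,
        one_smul, Nat.sub_add_cancel hn, hun]
      · intro r hr hrn
        have := Finset.mem_range.1 hr
        rw [hu0 v r (by omega), map_zero, smul_zero]
      · simp
      · intro j hj hjn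
        have := Finset.mem_range.1 hj
        refine Finset.sum_eq_zero fun r hr => ?_
        have := Finset.mem_range.1 hr
        rw [hu0 v r (by omega), map_zero, smul_zero]
      · intro hn'
        exact absurd (Finset.mem_range.2 (by omega)) hn'
    have hinv : Ring.inverse (A.value μ) v = U 0 := by
      conv_lhs => rw [← hAU]
      exact congrArg (fun T : H →L[ℂ] H => T (U 0)) (Ring.inverse_mul_cancel _ hμ)
    have hrem : ∀ y, remPoly A n (u v) y μ = 0 := by
      intro y
      refine Finset.sum_eq_zero fun j hj => Finset.sum_eq_zero fun r hr => ?_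
      have h1 := Finset.mem_range.1 hj
      have h2 := Finset.mem_range.1 hr
      rcases lt_or_ge r (n - 1) with h | h
      · refine Finset.sum_eq_zero fun r' _ => ?_
        rw [hu0 v r h, map_zero, inner_zero_right, mul_zero]
      · rw [show j - r = 0 by omega, Finset.range_zero, Finset.sum_empty]
    have hμc : starRingEnd ℂ μ ≠ starRingEnd ℂ c := fun h =>
      hμF i ((starRingEnd ℂ).injective h ▸ hcF (b i))
    have hformc : ∀ y ∈ rootSpace A.adjointPencil (starRingEnd ℂ c),
        form A n (u v) y = form A n (f v c) y := by
      intro y hy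
      rw [hsum v, form_sum_left, Finset.sum_eq_single c]
      · intro d _ hdc
        exact form_rootSpace_eq_zero hA.1 (fun h => hdc ((starRingEnd ℂ).injective h).symm)
          (hf v d) hy
      · exact fun h => absurd (hcF v) h
    have hzq : ∀ k q, q ≤ p k → kd (starRingEnd ℂ c) (z k) q
        ∈ rootSpace A.adjointPencil (starRingEnd ℂ c) := fun k q hq =>
      kd_mem_rootSpace (hz.mem k) hq
    have hPP : principalPart c p w z μ v = res c (S v) μ (f v c) 0 := by
      rw [principalPart_apply c p w z (hpS v)]
      have h1 : ∀ k j, (inner ℂ (res (starRingEnd ℂ c) (S v) (starRingEnd ℂ μ)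
          (kd (starRingEnd ℂ c) (z k) (p k - j)) 0) v : ℂ)
          = ∑ s ∈ Finset.range (S v), ((μ - c) ^ (s + 1))⁻¹ * form A n ((dev c ^ s) (f v c))
            (kd (starRingEnd ℂ c) (z k) (p k - j)) := by
        intro k j
        have h2 := inner_resolvent hA.1 hU hUsol (smul_res_sub_shift hμc
          (dev_pow_kd_of_lt (lt_of_le_of_lt (Nat.sub_le _ j) (hpS v k)) (starRingEnd ℂ c) (z k)))
        rw [hAU, hrem, add_zero, form_res_right, Complex.conj_conj] at h2
        rw [h2]
        refine Finset.sum_congr rfl fun s _ => ?_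
        rw [form_dev_pow hA.1 (rootSpace_le_sol A c (hf v c))
          (rootSpace_le_sol _ _ (hzq k _ (Nat.sub_le _ _))),
          hformc _ (dev_pow_mem_rootSpace (hzq k _ (Nat.sub_le _ _)) s)]
      rw [res_apply, Finset.sum_apply]
      have h3 : ∀ s, (dev c ^ s) (f v c) 0 = ∑ k, ∑ j ∈ Finset.range (p k + 1),
          form A n ((dev c ^ s) (f v c)) (kd (starRingEnd ℂ c) (z k) (p k - j)) • w k j := by
        intro s
        conv_lhs => rw [hd.expand hw (dev_pow_mem_rootSpace (hf v c) s)]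
        rw [Finset.sum_apply]
        refine Finset.sum_congr rfl fun k _ => ?_
        rw [Finset.sum_apply]
        exact Finset.sum_congr rfl fun j _ => by rw [Pi.smul_apply, kd_apply_zero]
      simp only [h1, Pi.smul_apply, h3, Finset.smul_sum, Finset.sum_smul, smul_smul]
      symm
      rw [Finset.sum_comm]
      exact Finset.sum_congr rfl fun k _ => Finset.sum_comm
    change Ring.inverse (A.value μ) v = principalPart c p w z μ v + _
    rw [hinv, hPP]
    refine Eq.trans ?_ (congrArg _ hR.symm)
    rw [hUdef, Finset.sum_apply]
    exact (Finset.add_sum_erase (F v) (fun d => res d (S v) μ (f v d) 0) (hcF v)).symm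

end

end Pencil
end

/-! ### Existence of regular systems -/

noncomputable section

namespace Pencil

variable {H : Type*} [NormedAddCommGroup H] [InnerProductSpace ℂ H]

/-- The span of the chain members in the strict first halves. -/
def strictHalf {ι : Type*} (c : ℂ) (p : ι → ℕ) (w : ι → ℕ → H) : Submodule ℂ (ℕ → H) :=
  Submodule.span ℂ {v | ∃ (j : ι) (h : ℕ), 2 * h + 1 ≤ p j ∧ v = kd c (w j) h}

lemma finrank_strictHalf {ι : Type*} [Fintype ι] {c : ℂ} {p : ι → ℕ} {w : ι → ℕ → H}
    (hli : LinearIndependent ℂ fun k => w k 0) :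
    Module.finrank ℂ (strictHalf c p w)
      = Fintype.card {i : Σ k, Fin (p k + 1) // 2 * (i.2 : ℕ) + 1 ≤ p i.1} := by
  have h1 : strictHalf c p w = Submodule.span ℂ (Set.range
      fun i : {i : Σ k, Fin (p k + 1) // 2 * (i.2 : ℕ) + 1 ≤ p i.1} => chainVec c p w i) := by
    rw [strictHalf]
    congr 1
    ext v
    constructor
    · rintro ⟨j, h, hh, rfl⟩
      exact ⟨⟨⟨j, ⟨h, by omega⟩⟩, hh⟩, rfl⟩
    · rintro ⟨⟨⟨j, h⟩, hh⟩, rfl⟩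
      exact ⟨j, h, hh, rfl⟩
  rw [h1]
  exact finrank_span_eq_card
    ((chainVec_linearIndependent c p w hli).comp _ Subtype.val_injective)

variable [CompleteSpace H] [FiniteDimensional ℂ H] {A : Pencil H} {n : ℕ}
variable {ι : Type} [Fintype ι] [DecidableEq ι] {c : ℝ} {p : ι → ℕ} {w z : ι → ℕ → H}

/-- The coefficient of a `z` member at position `h` is read off by pairing with the `w` member at `p
k - h`. For `p k ≤ 2 * h` the latter lies in the first half, so the coefficient vanishes. -/
lemma mem_strictHalf_dual
    (hz : IsJordanSystem A.adjointPencil c p z) (hd : IsDualSystem A n c p w z) {d : ℕ → H}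
    (hdm : d ∈ rootSpace A.adjointPencil c)
    (h0 : ∀ k h, 2 * h ≤ p k → form A n (kd c (w k) h) d = 0) : d ∈ strictHalf (c : ℂ) p z := by
  rw [← hz.span] at hdm
  obtain ⟨a, ha⟩ := exists_sum_kd hdm
  have hco : ∀ k h, h ≤ p k → p k ≤ 2 * h → a k h = 0 := by
    intro k h hh hp
    have h1 := h0 k (p k - h) (by omega)
    rw [ha, form_sum_right, Finset.sum_eq_single k, form_sum_right, Finset.sum_eq_single h,
      form_smul_right] at h1
    · have h2 := hd k k (p k - h) h (by omega) hh
      rw [Complex.conj_ofReal, if_pos ⟨rfl, by omega⟩] at h2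
      rw [h2, mul_one] at h1
      exact (map_eq_zero _).1 h1
    · intro j hj hjh
      have hj' := Nat.lt_succ_iff.1 (Finset.mem_range.1 hj)
      have h2 := hd k k (p k - h) j (by omega) hj'
      rw [Complex.conj_ofReal, if_neg (by rintro ⟨-, h3⟩; omega)] at h2
      rw [form_smul_right, h2, mul_zero]
    · intro h2
      exact absurd (Finset.mem_range.2 (by omega)) h2
    · intro k' _ hk'
      rw [form_sum_right]
      refine Finset.sum_eq_zero fun j hj => ?_
      have hj' := Nat.lt_succ_iff.1 (Finset.mem_range.1 hj)
      have h2 := hd k k' (p k - h) j (by omega) hj'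
      rw [Complex.conj_ofReal, if_neg (fun h3 => hk' h3.1.symm)] at h2
      rw [form_smul_right, h2, mul_zero]
    · simp
  rw [ha]
  refine Submodule.sum_mem _ fun k _ => Submodule.sum_mem _ fun h hh => ?_
  have hh' := Nat.lt_succ_iff.1 (Finset.mem_range.1 hh)
  by_cases h1 : 2 * h + 1 ≤ p k
  · exact Submodule.smul_mem _ _ (Submodule.subset_span ⟨k, h, h1, rfl⟩)
  · rw [hco k h hh' (by omega), zero_smul]
    exact zero_mem _

/-- Elements orthogonal to the first halves lie in the span of the strict first halves. -/
lemma mem_strictHalf (hA : A.IsNondegenerateOfOrder n) (hdiss : A.IsDissipative)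
    (hw : IsJordanSystem A c p w)
    (hz : IsJordanSystem A.adjointPencil c p z) (hd : IsDualSystem A n c p w z) {d : ℕ → H}
    (hdm : d ∈ rootSpace A.adjointPencil c)
    (h0 : ∀ k h, 2 * h ≤ p k → form A n (kd c (w k) h) d = 0) : d ∈ strictHalf (c : ℂ) p w := by
  -- Isotropy of the first halves places the strict half of `w` in that of `z`; equal numbers of
  -- independent generators make the two spans coincide.
  have hle : strictHalf (c : ℂ) p w ≤ strictHalf (c : ℂ) p z := by
    refine Submodule.span_le.2 ?_
    rintro _ ⟨j, h, hh, rfl⟩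
    refine mem_strictHalf_dual hz hd (halfSpace_le_rootSpace_adjoint hdiss c
      (kd_mem_halfSpace (hw.mem j) (by omega))) fun k h' hh' => ?_
    exact form_half_eq_zero hA.1 hdiss c (hw.mem k) (hw.mem j) hh' (by omega) (by omega)
  have hfd := finiteDimensional_rootSpace hA.adjointPencil (c : ℂ)
  have hzle : strictHalf (c : ℂ) p z ≤ rootSpace A.adjointPencil c := by
    refine Submodule.span_le.2 ?_
    rintro _ ⟨j, h, hh, rfl⟩
    exact kd_mem_rootSpace (hz.mem j) (by omega)
  have := Submodule.finiteDimensional_of_le hzle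
  have heq := Submodule.eq_of_le_of_finrank_eq hle (by
    rw [finrank_strictHalf hw.li, finrank_strictHalf hz.li])
  rw [heq]
  exact mem_strictHalf_dual hz hd hdm h0

lemma exists_dualSystem_real (hA : A.IsNondegenerateOfOrder n) (hw : IsJordanSystem A c p w) :
    ∃ z : ι → ℕ → H, IsJordanSystem A.adjointPencil c p z ∧ IsDualSystem A n c p w z := by
  have := exists_dualSystem hA hw
  rwa [Complex.conj_ofReal] at this

/-- The Gram matrix of the middle members of the chains of length `2 * m + 1`. -/
def middleGram (A : Pencil H) (n : ℕ) (c : ℝ) (p : ι → ℕ) (w : ι → ℕ → H) (q : ℕ) :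
    Matrix {k // p k = q} {k // p k = q} ℂ :=
  Matrix.of fun a b => form A n (kd c (w a) (q / 2)) (kd c (w b) (q / 2))

lemma middleGram_isHermitian (hA : A.IsNondegenerateOfOrder n) (hdiss : A.IsDissipative)
    (hw : IsJordanSystem A c p w) (q : ℕ) : (middleGram A n c p w q).IsHermitian := by
  ext a b
  rw [Matrix.conjTranspose_apply]
  have ha : 2 * (q / 2) ≤ p a := by rw [a.2]; omega
  have hb : 2 * (q / 2) ≤ p b := by rw [b.2]; omega
  exact (form_conj hA.1 hdiss c (kd_mem_halfSpace (hw.mem b) hb)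
    (kd_mem_halfSpace (hw.mem a) ha)).symm

/-- A kernel vector gives a combination of middle members orthogonal to all first halves, hence
lying in the strict half. Pairing with the middle members of the dual system kills its coefficients.
-/
lemma middleGram_det_ne_zero (hA : A.IsNondegenerateOfOrder n) (hdiss : A.IsDissipative)
    (hw : IsJordanSystem A c p w) (m : ℕ) : (middleGram A n c p w (2 * m)).det ≠ 0 := by
  obtain ⟨z, hz, hd⟩ := exists_dualSystem_real hA hw
  intro hdet
  obtain ⟨x, hx0, hx⟩ := Matrix.exists_mulVec_eq_zero_iff.2 hdet
  refine hx0 (funext fun b => ?_)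
  set y : ℕ → H := ∑ b : {k // p k = 2 * m}, starRingEnd ℂ (x b) • kd c (w b) m with hy
  have hym : y ∈ halfSpace A c :=
    Submodule.sum_mem _ fun b _ => Submodule.smul_mem _ _
      (kd_mem_halfSpace (hw.mem b) (by rw [b.2]))
  have hyW : y ∈ strictHalf (c : ℂ) p w := by
    refine mem_strictHalf hA hdiss hw hz hd (halfSpace_le_rootSpace_adjoint hdiss c hym) ?_
    intro k h hh
    by_cases hk : p k = 2 * m ∧ h = m
    · obtain ⟨hk, rfl⟩ := hk
      have h1 := congrFun hx ⟨k, hk⟩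
      rw [Matrix.mulVec, dotProduct] at h1
      rw [Pi.zero_apply] at h1
      rw [hy, form_sum_right, ← h1]
      refine Finset.sum_congr rfl fun b _ => ?_
      rw [form_smul_right, Complex.conj_conj, middleGram, Matrix.of_apply, mul_comm,
        Nat.mul_div_cancel_left _ two_pos]
    · rw [hy, form_sum_right]
      refine Finset.sum_eq_zero fun b _ => ?_
      have hb := b.2
      rw [form_smul_right, form_half_eq_zero hA.1 hdiss c (hw.mem k) (hw.mem b) hh
        (by omega) (by omega), mul_zero]
  have hzero : form A n y (kd c (z b) m) = 0 := by
    have : strictHalf (c : ℂ) p w ≤ LinearMap.ker (formLeft A n (kd c (z b) m)) := by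
      refine Submodule.span_le.2 ?_
      rintro _ ⟨j, h, hh, rfl⟩
      have h2 := hd j b h m (by omega) (by have := b.2; omega)
      rw [Complex.conj_ofReal, if_neg (by
        rintro ⟨rfl, h3⟩
        have := b.2
        omega)] at h2
      exact h2
    exact this hyW
  rw [hy, form_sum_left, Finset.sum_eq_single b] at hzero
  · have h2 := hd b b m m (by have := b.2; omega) (by have := b.2; omega)
    rw [Complex.conj_ofReal, if_pos ⟨rfl, by have := b.2; omega⟩] at h2
    rw [form_smul_left, h2, mul_one] at hzero
    exact (map_eq_zero _).1 hzero
  · intro b' _ hb'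
    have h2 := hd b' b m m (by have := b'.2; omega) (by have := b.2; omega)
    rw [Complex.conj_ofReal, if_neg (fun h => hb' (Subtype.ext h.1))] at h2
    rw [form_smul_left, h2, mul_zero]
  · simp

/-- Congruence of an invertible Hermitian matrix to a diagonal matrix of signs. -/
lemma exists_sign_congruence {κ : Type*} [Fintype κ] [DecidableEq κ] {M : Matrix κ κ ℂ}
    (hM : M.IsHermitian) (hdet : M.det ≠ 0) :
    ∃ (U V : Matrix κ κ ℂ) (ε : κ → ℤ), V * U = 1 ∧ (∀ k, ε k = 1 ∨ ε k = -1) ∧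
      U * M * U.conjTranspose = Matrix.diagonal fun k => (ε k : ℂ) := by
  set Q : Matrix κ κ ℂ := (hM.eigenvectorUnitary : Matrix κ κ ℂ) with hQ
  have hQQ : star Q * Q = 1 := Unitary.coe_star_mul_self hM.eigenvectorUnitary
  have hQQ' : Q * star Q = 1 := Unitary.coe_mul_star_self hM.eigenvectorUnitary
  have hdiag : star Q * M * Q = Matrix.diagonal fun k => (hM.eigenvalues k : ℂ) := by
    have := hM.conjStarAlgAut_star_eigenvectorUnitary
    rw [Unitary.conjStarAlgAut_star_apply] at this
    exact this
  have hne : ∀ k, hM.eigenvalues k ≠ 0 := by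
    intro k hk
    rw [hM.det_eq_prod_eigenvalues] at hdet
    exact hdet (Finset.prod_eq_zero (Finset.mem_univ k) (by rw [hk]; simp))
  -- Unitary diagonalization followed by rescaling each eigenvalue to modulus one; only the signs
  -- remain.
  set r : κ → ℝ := fun k => (Real.sqrt |hM.eigenvalues k|)⁻¹ with hr
  have hrpos : ∀ k, 0 < r k := fun k => inv_pos.2 (Real.sqrt_pos.2 (abs_pos.2 (hne k)))
  have hrr : ∀ k, r k * r k * |hM.eigenvalues k| = 1 := by
    intro k
    rw [← mul_inv, Real.mul_self_sqrt (abs_nonneg _)]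
    exact inv_mul_cancel₀ (abs_ne_zero.2 (hne k))
  refine ⟨Matrix.diagonal (fun k => (r k : ℂ)) * star Q,
    Q * Matrix.diagonal (fun k => ((r k)⁻¹ : ℂ)), fun k => if 0 < hM.eigenvalues k then 1 else -1,
    ?_, ?_, ?_⟩
  · have : Matrix.diagonal (fun k => ((r k)⁻¹ : ℂ)) * Matrix.diagonal (fun k => (r k : ℂ)) = 1 := by
      rw [Matrix.diagonal_mul_diagonal, ← Matrix.diagonal_one]
      congr 1
      ext k
      exact inv_mul_cancel₀ (by exact_mod_cast (hrpos k).ne')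
    rw [Matrix.mul_assoc, ← Matrix.mul_assoc (Matrix.diagonal _), this, Matrix.one_mul, hQQ']
  · intro k
    dsimp only
    split_ifs <;> simp
  · have h1 : (Matrix.diagonal (fun k => (r k : ℂ)) * star Q).conjTranspose
        = Q * Matrix.diagonal (fun k => (r k : ℂ)) := by
      rw [Matrix.conjTranspose_mul, Matrix.diagonal_conjTranspose, ← Matrix.star_eq_conjTranspose,
        star_star]
      congr 2
      ext k
      simp
    rw [h1]
    have h2 : Matrix.diagonal (fun k => (r k : ℂ)) * star Q * M
        * (Q * Matrix.diagonal (fun k => (r k : ℂ)))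
        = Matrix.diagonal (fun k => (r k : ℂ)) * (star Q * M * Q)
          * Matrix.diagonal (fun k => (r k : ℂ)) := by
      simp only [Matrix.mul_assoc]
    rw [h2, hdiag, Matrix.diagonal_mul_diagonal, Matrix.diagonal_mul_diagonal]
    congr 1
    ext k
    have h3 := hrr k
    dsimp only
    split_ifs with h
    · rw [abs_of_pos h] at h3
      have : r k * hM.eigenvalues k * r k = 1 := by linarith
      exact_mod_cast this
    · rw [abs_of_nonpos (not_lt.1 h)] at h3
      have : r k * hM.eigenvalues k * r k = -1 := by linarith
      exact_mod_cast this

/-- Replacing each chain by a combination of chains of the same length. -/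
def mixChains (p : ι → ℕ) (U : ∀ q, Matrix {k // p k = q} {k // p k = q} ℂ) (w : ι → ℕ → H) :
    ι → ℕ → H := fun k => ∑ b : {b // p b = p k}, U (p k) ⟨k, rfl⟩ b • w b

lemma mixChains_apply (U : ∀ q, Matrix {k // p k = q} {k // p k = q} ℂ) {q : ℕ}
    (a : {k // p k = q}) : mixChains p U w a = ∑ b : {b // p b = q}, U q a b • w b := by
  obtain ⟨k, rfl⟩ := a
  rfl

lemma mixChains_mixChains {U V : ∀ q, Matrix {k // p k = q} {k // p k = q} ℂ}
    (hVU : ∀ q, V q * U q = 1) : mixChains p V (mixChains p U w) = w := by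
  ext1 k
  rw [mixChains]
  simp only [mixChains_apply, Finset.smul_sum, smul_smul]
  rw [Finset.sum_comm]
  simp only [← Finset.sum_smul]
  have h1 : ∀ b, ∑ a, V (p k) ⟨k, rfl⟩ a * U (p k) a b = if ⟨k, rfl⟩ = b then 1 else 0 := by
    intro b
    rw [← Matrix.mul_apply, hVU, Matrix.one_apply]
  simp only [h1, ite_smul, one_smul, zero_smul]
  rw [Finset.sum_ite_eq]
  simp

lemma kd_mixChains (c : ℂ) (U : ∀ q, Matrix {k // p k = q} {k // p k = q} ℂ) {q : ℕ}
    (a : {k // p k = q}) (h : ℕ) :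
    kd c (mixChains p U w a) h = ∑ b : {b // p b = q}, U q a b • kd c (w b) h := by
  rw [mixChains_apply, ← kdL_apply, map_sum]
  simp only [map_smul, kdL_apply]

lemma span_mixChains_zero_le (U : ∀ q, Matrix {k // p k = q} {k // p k = q} ℂ)
    (w : ι → ℕ → H) : Submodule.span ℂ (Set.range fun k => mixChains p U w k 0)
      ≤ Submodule.span ℂ (Set.range fun k => w k 0) := by
  refine Submodule.span_le.2 ?_
  rintro _ ⟨k, rfl⟩
  simp only [mixChains, Finset.sum_apply, Pi.smul_apply]
  exact Submodule.sum_mem _ fun b _ => Submodule.smul_mem _ _ (Submodule.subset_span ⟨b, rfl⟩)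

lemma span_chainVec_mixChains_le (c : ℂ) (U : ∀ q, Matrix {k // p k = q} {k // p k = q} ℂ)
    (w : ι → ℕ → H) : Submodule.span ℂ (Set.range (chainVec c p (mixChains p U w)))
      ≤ Submodule.span ℂ (Set.range (chainVec c p w)) := by
  refine Submodule.span_le.2 ?_
  rintro _ ⟨⟨k, h⟩, rfl⟩
  have := kd_mixChains (w := w) c U (⟨k, rfl⟩ : {b // p b = p k}) h
  rw [chainVec]
  dsimp only at this ⊢
  rw [this]
  refine Submodule.sum_mem _ fun b _ => Submodule.smul_mem _ _ (kd_mem_span_chainVec b.1 ?_)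
  rw [b.2]
  exact Nat.lt_succ_iff.1 h.2

lemma IsJordanSystem.mixChains {c : ℂ} (hw : IsJordanSystem A c p w)
    {U V : ∀ q, Matrix {k // p k = q} {k // p k = q} ℂ} (hVU : ∀ q, V q * U q = 1) :
    IsJordanSystem A c p (mixChains p U w) := by
  refine ⟨fun k => ?_, ?_, ?_⟩
  · have := kd_mixChains (w := w) c U (⟨k, rfl⟩ : {b // p b = p k}) (p k)
    dsimp only at this
    rw [this]
    refine Submodule.sum_mem _ fun b _ => Submodule.smul_mem _ _ ?_
    have := hw.mem b
    rwa [b.2] at this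
  · rw [linearIndependent_iff_card_le_finrank_span, Set.finrank]
    have h1 := span_mixChains_zero_le V (Pencil.mixChains p U w)
    rw [mixChains_mixChains hVU] at h1
    rw [← finrank_span_eq_card hw.li]
    exact Submodule.finrank_mono h1
  · rw [← hw.span]
    refine le_antisymm (span_chainVec_mixChains_le c U w) ?_
    have h1 := span_chainVec_mixChains_le c V (Pencil.mixChains p U w)
    rwa [mixChains_mixChains hVU] at h1

/-- A Jordan system whose middle members are orthonormal up to signs. -/
lemma exists_normalized (hA : A.IsNondegenerateOfOrder n) (hdiss : A.IsDissipative)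
    (hw : IsJordanSystem A c p w) :
    ∃ (w' : ι → ℕ → H) (ε : ι → ℤ), IsJordanSystem A c p w' ∧ (∀ k, Odd (p k) → ε k = 0) ∧
      ∀ m k, p k = 2 * m → (ε k = 1 ∨ ε k = -1) ∧ ∀ k', p k' = 2 * m →
        form A n (kd c (w' k) m) (kd c (w' k') m) = if k = k' then (ε k : ℂ) else 0 := by
  have hex : ∀ q, ∃ (U V : Matrix {k // p k = q} {k // p k = q} ℂ) (ε : {k // p k = q} → ℤ),
      V * U = 1 ∧ (Odd q → ∀ k, ε k = 0) ∧ (Even q → (∀ k, ε k = 1 ∨ ε k = -1) ∧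
        U * middleGram A n c p w q * U.conjTranspose = Matrix.diagonal fun k => (ε k : ℂ)) := by
    intro q
    rcases Nat.even_or_odd q with h | h
    · obtain ⟨m, rfl⟩ := h.two_dvd
      obtain ⟨U, V, ε, h1, h2, h3⟩ := exists_sign_congruence
        (middleGram_isHermitian hA hdiss hw (2 * m)) (middleGram_det_ne_zero hA hdiss hw m)
      exact ⟨U, V, ε, h1, fun h' => absurd h' (Nat.not_odd_iff_even.2 h), fun _ => ⟨h2, h3⟩⟩
    -- Chains of even length have no middle member and are left alone, with sign zero.
    · exact ⟨1, 1, fun _ => 0, one_mul _, fun _ _ => rfl,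
        fun h' => absurd h' (Nat.not_even_iff_odd.2 h)⟩
  choose U V ε hVU hodd heven using hex
  refine ⟨mixChains p U w, fun k => ε (p k) ⟨k, rfl⟩, hw.mixChains hVU,
    fun k hk => hodd _ hk _, fun m k hk => ?_⟩
  have hε : ∀ q (a : {k // p k = q}), ε (p a) ⟨a, rfl⟩ = ε q a := by
    rintro q ⟨a, rfl⟩; rfl
  have h1 := hε _ ⟨k, hk⟩
  dsimp only at h1
  obtain ⟨h2, h3⟩ := heven (2 * m) (even_two_mul m)
  dsimp only
  rw [h1]
  refine ⟨h2 _, fun k' hk' => ?_⟩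
  have h4 := congrFun (congrFun h3 ⟨k, hk⟩) ⟨k', hk'⟩
  have h5 := kd_mixChains (w := w) (c : ℂ) U (⟨k, hk⟩ : {b // p b = 2 * m}) m
  have h6 := kd_mixChains (w := w) (c : ℂ) U (⟨k', hk'⟩ : {b // p b = 2 * m}) m
  dsimp only at h5 h6
  rw [h5, h6, form_sum_left]
  rw [Matrix.diagonal_apply, Matrix.mul_apply] at h4
  simp only [Subtype.mk.injEq] at h4
  rw [← h4]
  simp only [Matrix.mul_apply, Matrix.conjTranspose_apply, Finset.sum_mul, form_sum_right,
    form_smul_left, form_smul_right, middleGram, Matrix.of_apply,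
    Nat.mul_div_cancel_left m two_pos]
  rw [Finset.sum_comm]
  refine Finset.sum_congr rfl fun a _ => Finset.sum_congr rfl fun b _ => ?_
  rw [starRingEnd_apply]
  ring

/-- Existence of regular canonical systems. -/
lemma exists_regularSystem (hA : A.IsNondegenerateOfOrder n) (hdiss : A.IsDissipative)
    (hw : IsJordanSystem A c p w) :
    ∃ (w' : ι → ℕ → H) (ε : ι → ℤ), A.IsRegularSystem n c p w' ε := by
  obtain ⟨w', ε, hw', hodd, heven⟩ := exists_normalized hA hdiss hw
  obtain ⟨z, hz, hd⟩ := exists_dualSystem_real hA hw'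
  refine ⟨w', ε, hw'.isCanonicalSystem, z, hd.isAdjointSystem hA hw' (by
    rwa [Complex.conj_ofReal]), fun k => ⟨hodd k, fun m hm => ?_⟩⟩
  obtain ⟨hε, hform⟩ := heven m k hm
  refine ⟨hε, ?_⟩
  -- By normalization both terms pair equally with every first-half member, because `ε k * ε k = 1`.
  -- So the difference is orthogonal to the first halves.
  have hmem : kd (c : ℂ) (z k) m - (ε k : ℂ) • kd (c : ℂ) (w' k) m ∈ strictHalf (c : ℂ) p w' := by
    refine mem_strictHalf hA hdiss hw' hz hd ?_ fun k' h hh => ?_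
    · exact sub_mem (kd_mem_rootSpace (hz.mem k) (by omega)) (Submodule.smul_mem _ _
        (halfSpace_le_rootSpace_adjoint hdiss c (kd_mem_halfSpace (hw'.mem k) (by omega))))
    · have h1 := hd k' k h m (by omega) (by omega)
      rw [Complex.conj_ofReal] at h1
      rw [form_sub_right, form_smul_right, h1, map_intCast]
      by_cases hk : p k' = 2 * m ∧ h = m
      · obtain ⟨hk, rfl⟩ := hk
        rw [(heven h k' hk).2 k hm]
        by_cases hkk : k' = k
        · subst hkk
          rw [if_pos ⟨rfl, by omega⟩, if_pos rfl]
          rcases hε with h | h <;> rw [h] <;> simp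
        · rw [if_neg (fun h => hkk h.1), if_neg hkk, mul_zero, sub_zero]
      · rw [form_half_eq_zero hA.1 hdiss c (hw'.mem k') (hw'.mem k) hh (by omega) (by omega),
          mul_zero, sub_zero, if_neg]
        rintro ⟨rfl, h2⟩
        omega
  have h2 := Submodule.mem_map_of_mem (f := restr n) hmem
  rw [strictHalf, Submodule.map_span] at h2
  refine Submodule.span_mono ?_ h2
  rintro _ ⟨_, ⟨j, h, hh, rfl⟩, rfl⟩
  exact ⟨j, h, hh, rfl⟩

lemma exists_regularFamily (hA : A.IsNondegenerateOfOrder n) (hdiss : A.IsDissipative) :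
    ∃ E : ChainFamily H, A.IsRegularFamily n E := by
  -- Regularity is quantified over real `t` with `(t : ℂ) = c`, so that one choice over complex
  -- points serves both requirements.
  have hex : ∀ c : ℂ, ∃ (N : ℕ) (p : Fin N → ℕ) (w : Fin N → ℕ → H) (ε : Fin N → ℤ),
      A.IsCanonicalSystem c p w ∧ ∀ t : ℝ, (t : ℂ) = c → A.IsRegularSystem n t p w ε := by
    intro c
    have := finiteDimensional_rootSpace hA c
    obtain ⟨N, p, w, hw⟩ := exists_jordanSystem A c
    by_cases hc : ∃ t : ℝ, (t : ℂ) = c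
    · obtain ⟨t, rfl⟩ := hc
      obtain ⟨w', ε, h⟩ := exists_regularSystem hA hdiss hw
      refine ⟨N, p, w', ε, h.1, fun t' ht' => ?_⟩
      rw [Complex.ofReal_injective ht']
      exact h
    · exact ⟨N, p, w, fun _ => 0, hw.isCanonicalSystem, fun t ht => absurd ⟨t, ht⟩ hc⟩
  choose N p w ε h1 h2 using hex
  exact ⟨⟨N, p, w, ε⟩, h1, fun c => h2 c c rfl⟩

end Pencil
end

/-! ### Function theory: vanishing of a rational function with a sign condition -/

noncomputable section

namespace Pencil

open Complex in
/-- A function with nonpositive imaginary part on the real line which is holomorphic and bounded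
in the upper half-plane and vanishes at `I` is zero. -/
lemma eq_zero_of_im_nonpos_of_bounded {h : ℂ → ℂ} (hd : DiffContOnCl ℂ h {z | 0 < z.im})
    (hb : h =O[Filter.principal {z | 0 < z.im}] fun _ => (1 : ℝ))
    (him : ∀ t : ℝ, (h t).im ≤ 0) :
    (h I).im ≤ 0 ∧ (h I = 0 → ∀ z : ℂ, 0 ≤ z.im → h z = 0) := by
  have hle : ∀ z : ℂ, 0 ≤ z.im → (h z).im ≤ 0 := by
    intro z hz
    -- The rotation moves the upper half-plane to the right one, and the modulus of `g` is the
    -- exponential of `Im h`. Phragmén-Lindelöf then carries the bound by one inward from the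
    -- boundary.
    set g : ℂ → ℂ := fun z => exp (-I * h (I * z)) with hg
    have hnorm : ∀ z, ‖g z‖ = Real.exp (h (I * z)).im := by
      intro z
      rw [hg]
      dsimp only
      rw [norm_exp]
      simp
    obtain ⟨M, hM⟩ := hb.bound
    have hM' : ∀ z : ℂ, 0 < z.im → ‖h z‖ ≤ M := by
      intro z hz
      have := Filter.eventually_principal.1 hM z hz
      simpa using this
    have hgM : ∀ z : ℂ, 0 < z.re → ‖g z‖ ≤ Real.exp M := by
      intro z hz
      rw [hnorm]
      refine Real.exp_le_exp.2 ?_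
      refine (le_abs_self _).trans ((abs_im_le_norm _).trans (hM' _ ?_))
      simpa using hz
    have hmaps : Set.MapsTo (fun z : ℂ => I * z) {z | 0 < z.re} {z | 0 < z.im} := by
      intro z hz
      simpa using hz
    have hdg : DiffContOnCl ℂ g {z | 0 < z.re} := by
      have h1 : DiffContOnCl ℂ (fun z => h (I * z)) {z | 0 < z.re} :=
        hd.comp (g := fun z : ℂ => I * z) (Differentiable.diffContOnCl (by fun_prop)) hmaps
      exact (Complex.differentiable_exp).comp_diffContOnCl (h1.const_smul (-I))
    have hfin := PhragmenLindelof.right_half_plane_of_bounded_on_real (f := g) (C := 1)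
      (z := -I * z) hdg ⟨1, one_lt_two, 0, ?_⟩ ?_ ?_ (by simpa using hz)
    · rw [hnorm] at hfin
      have h2 : I * (-I * z) = z := by rw [← mul_assoc]; simp
      rw [h2] at hfin
      exact Real.exp_le_one_iff.1 hfin
    · refine Asymptotics.IsBigO.of_bound (Real.exp M) ?_
      refine Filter.Eventually.filter_mono inf_le_right (Filter.eventually_principal.2 ?_)
      intro z hz
      simpa using hgM z hz
    · refine ⟨Real.exp M, ?_⟩
      rw [Filter.eventually_map]
      filter_upwards [Filter.eventually_gt_atTop 0] with x hx
      exact hgM x (by simpa using hx)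
    · intro x
      rw [hnorm, Real.exp_le_one_iff]
      have h2 : I * ((x : ℂ) * I) = ((-x : ℝ) : ℂ) := by
        push_cast
        linear_combination (x : ℂ) * I_mul_I
      rw [h2]
      exact him _
  refine ⟨hle I (by simp), fun h0 => ?_⟩
  have hopen : IsOpen {z : ℂ | 0 < z.im} := isOpen_lt continuous_const continuous_im
  have hconn : IsPreconnected {z : ℂ | 0 < z.im} :=
    (convex_halfSpace_im_gt 0).isPreconnected
  have hge : ∀ z : ℂ, 0 ≤ z.im → 1 ≤ ‖h z - I‖ := by
    intro z hz
    have h1 := abs_im_le_norm (h z - I)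
    rw [sub_im, I_im, abs_of_neg (by linarith [hle z hz])] at h1
    linarith [hle z hz]
  have hne : ∀ z : ℂ, 0 ≤ z.im → h z - I ≠ 0 := by
    intro z hz h1
    have := hge z hz
    rw [h1, norm_zero] at this
    linarith
  have hUHP : ∀ z : ℂ, 0 < z.im → h z = 0 := by
    -- The Cayley-type function `(h - i)⁻¹` has modulus at most one because `Im h ≤ 0`, and attains
    -- one at `I` when `h I = 0`. The maximum principle makes it constant.
    have hdk : DifferentiableOn ℂ (fun z => (h z - I)⁻¹) {z : ℂ | 0 < z.im} :=
      (hd.differentiableOn.sub_const I).inv fun z hz => hne z (le_of_lt hz)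
    have hmax : IsMaxOn (norm ∘ fun z => (h z - I)⁻¹) {z : ℂ | 0 < z.im} I := by
      intro z hz
      simp only [Function.comp_apply, Set.mem_ofPred_eq, h0, zero_sub, norm_inv, norm_neg, norm_I,
        inv_one]
      exact inv_le_one_of_one_le₀ (hge z (le_of_lt hz))
    have heq := Complex.eqOn_of_isPreconnected_of_isMaxOn_norm hconn hopen hdk
      (by simp : I ∈ {z : ℂ | 0 < z.im}) hmax
    intro z hz
    have h1 := heq hz
    simp only [Function.const_apply, h0] at h1
    have h2 := inv_injective h1
    linear_combination h2
  intro z hz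
  have hcl : z ∈ closure {z : ℂ | 0 < z.im} := by
    rw [closure_setOfPred_lt_im]
    exact hz
  have : Set.EqOn h (fun _ => 0) (closure {z : ℂ | 0 < z.im}) :=
    Set.EqOn.of_subset_closure (fun z hz => hUHP z hz) hd.continuousOn continuousOn_const
      subset_closure subset_rfl
  exact this hcl

/-- The part of `(μ² + 1) (μ - e)⁻ˢ⁻¹` bounded at infinity, in terms of `w = (μ - e)⁻¹`. -/
def boundedPart (e : ℂ) (w : ℂ) : ℕ → ℂ
  | 0 => e + (e ^ 2 + 1) * w
  | s + 1 => w ^ s * (1 + 2 * e * w + (e ^ 2 + 1) * w ^ 2)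

lemma boundedPart_eq {e μ : ℂ} (h : μ ≠ e) (s : ℕ) :
    (μ ^ 2 + 1) * ((μ - e) ^ (s + 1))⁻¹
      = boundedPart e (μ - e)⁻¹ s + if s = 0 then μ else 0 := by
  obtain ⟨w, hw⟩ : ∃ w, w = (μ - e)⁻¹ := ⟨_, rfl⟩
  have hne : μ - e ≠ 0 := sub_ne_zero.2 h
  have hwe : μ * w = 1 + e * w := by
    have : (μ - e) * w = 1 := by rw [hw, mul_inv_cancel₀ hne]
    linear_combination this
  rw [← inv_pow, ← hw]
  cases s with
  | zero =>
    simp only [boundedPart, if_true]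
    linear_combination (μ + e) * hwe
  | succ s =>
    simp only [boundedPart, Nat.succ_ne_zero, if_false]
    have h2 : (μ * w) ^ 2 = (1 + e * w) ^ 2 := by rw [hwe]
    linear_combination w ^ s * h2

/-- A rational function, vanishing of second order at infinity, with nonpositive imaginary part on
the real line, whose poles lie in the closed lower half-plane, the real ones being simple
with nonnegative residues, is zero. -/
lemma rational_eq_zero {κ : Type*} (F : Finset κ) (e : κ → ℂ) (S : ℕ) (β : κ → ℕ → ℂ)
    (hup : ∀ k ∈ F, 0 < (e k).im → ∀ s, β k s = 0)
    (hreal : ∀ k ∈ F, (e k).im = 0 →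
      (∀ s, β k (s + 1) = 0) ∧ 0 ≤ (β k 0).re ∧ (β k 0).im = 0)
    (hsum : ∑ k ∈ F, β k 0 = 0)
    (him : ∀ t : ℝ, (∀ k ∈ F, (t : ℂ) ≠ e k) →
      (∑ k ∈ F, ∑ s ∈ Finset.range (S + 1), (((t : ℂ) - e k) ^ (s + 1))⁻¹ * β k s).im ≤ 0)
    (t : ℝ) (ht : ∀ k ∈ F, (t : ℂ) ≠ e k) :
    ∑ k ∈ F, ∑ s ∈ Finset.range (S + 1), (((t : ℂ) - e k) ^ (s + 1))⁻¹ * β k s = 0 := by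
  classical
  set f : ℂ → ℂ := fun μ =>
    ∑ k ∈ F, ∑ s ∈ Finset.range (S + 1), ((μ - e k) ^ (s + 1))⁻¹ * β k s with hf
  -- After multiplication by `μ² + 1` the function splits into `h`, bounded in the upper half-plane,
  -- the real poles `r`, and a term linear in `μ`, which cancels because the residues sum to zero.
  set γ : κ → ℂ → ℂ := fun k μ => if (e k).im < 0 then
    ∑ s ∈ Finset.range (S + 1), boundedPart (e k) (μ - e k)⁻¹ s * β k s else β k 0 * e k with hγ
  set r : κ → ℂ → ℂ := fun k μ => if (e k).im = 0 then
    β k 0 * (((e k) ^ 2 + 1) * (μ - e k)⁻¹) else 0 with hr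
  set h : ℂ → ℂ := fun μ => ∑ k ∈ F, γ k μ with hh
  have hterm : ∀ k ∈ F, ∀ μ, ((e k).im ≤ 0 → μ ≠ e k) →
      (μ ^ 2 + 1) * ∑ s ∈ Finset.range (S + 1), ((μ - e k) ^ (s + 1))⁻¹ * β k s
        = γ k μ + r k μ + β k 0 * μ := by
    intro k hk μ hμ'
    rcases lt_or_ge 0 (e k).im with h3 | h3
    · have h4 := hup k hk h3
      simp only [hγ, hr, if_neg h3.ne', if_neg h3.not_gt, h4, mul_zero, zero_mul, add_zero,
        Finset.sum_const_zero]
    have hμ := hμ' h3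
    have h1 : (μ ^ 2 + 1) * ∑ s ∈ Finset.range (S + 1), ((μ - e k) ^ (s + 1))⁻¹ * β k s
        = ∑ s ∈ Finset.range (S + 1), boundedPart (e k) (μ - e k)⁻¹ s * β k s + β k 0 * μ := by
      rw [Finset.mul_sum]
      have h2 : ∀ s ∈ Finset.range (S + 1), (μ ^ 2 + 1) * (((μ - e k) ^ (s + 1))⁻¹ * β k s)
          = boundedPart (e k) (μ - e k)⁻¹ s * β k s + if s = 0 then β k 0 * μ else 0 := by
        intro s _
        rw [← mul_assoc, boundedPart_eq hμ]
        split_ifs with h0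
        · subst h0; ring
        · ring
      rw [Finset.sum_congr rfl h2, Finset.sum_add_distrib, Finset.sum_ite_eq',
        if_pos (Finset.mem_range.2 (Nat.succ_pos S))]
    rw [h1]
    rcases h3.lt_or_eq with h3 | h3
    · simp only [hγ, hr, if_pos h3, if_neg h3.ne, add_zero]
    · obtain ⟨h4, -⟩ := hreal k hk h3
      simp only [hγ, hr, if_pos h3, if_neg h3.not_lt]
      rw [Finset.sum_eq_single 0]
      · simp only [boundedPart]; ring
      · intro s _ hs
        obtain ⟨s, rfl⟩ := Nat.exists_eq_succ_of_ne_zero hs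
        rw [h4, mul_zero]
      · intro h5
        exact absurd (Finset.mem_range.2 (Nat.succ_pos S)) h5
  have hrel : ∀ μ, (∀ k ∈ F, (e k).im ≤ 0 → μ ≠ e k) → (μ ^ 2 + 1) * f μ = h μ + ∑ k ∈ F, r k μ := by
    intro μ hμ
    simp only [hf, hh]
    rw [Finset.mul_sum, Finset.sum_congr rfl fun k hk => hterm k hk μ (hμ k hk),
      Finset.sum_add_distrib, Finset.sum_add_distrib, ← Finset.sum_mul, hsum, zero_mul, add_zero]
  have hwb : ∀ k, (e k).im < 0 →
      (fun μ : ℂ => (μ - e k)⁻¹) =O[Filter.principal {z | 0 < z.im}] fun _ => (1 : ℝ) := by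
    intro k hk
    refine Asymptotics.IsBigO.of_bound (-(e k).im)⁻¹ (Filter.eventually_principal.2 ?_)
    intro z hz
    have hz' : 0 < z.im := hz
    rw [norm_inv, norm_one, mul_one]
    refine inv_anti₀ (by linarith) ?_
    have h1 := Complex.abs_im_le_norm (z - e k)
    rw [Complex.sub_im, abs_of_pos (by linarith)] at h1
    linarith
  have hone : ∀ (c : ℂ), (fun _ : ℂ => c) =O[Filter.principal {z : ℂ | 0 < z.im}]
      fun _ => (1 : ℝ) := fun c => Asymptotics.isBigO_const_const _ one_ne_zero _
  have hmul : ∀ {u v : ℂ → ℂ}, u =O[Filter.principal {z : ℂ | 0 < z.im}] (fun _ => (1 : ℝ)) →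
      v =O[Filter.principal {z : ℂ | 0 < z.im}] (fun _ => (1 : ℝ)) →
      (fun z => u z * v z) =O[Filter.principal {z : ℂ | 0 < z.im}] (fun _ => (1 : ℝ)) := by
    intro u v hu hv
    simpa using hu.mul hv
  have hpow : ∀ {u : ℂ → ℂ}, u =O[Filter.principal {z : ℂ | 0 < z.im}] (fun _ => (1 : ℝ)) →
      ∀ m : ℕ, (fun z => u z ^ m) =O[Filter.principal {z : ℂ | 0 < z.im}] (fun _ => (1 : ℝ)) := by
    intro u hu m
    simpa using hu.pow m
  have hb : h =O[Filter.principal {z | 0 < z.im}] fun _ => (1 : ℝ) := by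
    refine Asymptotics.IsBigO.fun_sum fun k _ => ?_
    by_cases hk : (e k).im < 0
    · simp only [hγ, if_pos hk]
      refine Asymptotics.IsBigO.fun_sum fun s _ => hmul ?_ (hone _)
      have hw := hwb k hk
      cases s with
      | zero =>
        simp only [boundedPart]
        exact (hone _).add (hmul (hone _) hw)
      | succ s =>
        simp only [boundedPart]
        exact hmul (hpow hw s) (((hone _).add (hmul (hone _) hw)).add (hmul (hone _) (hpow hw 2)))
    · simp only [hγ, if_neg hk]
      exact hone _
  have hdiff : ∀ z : ℂ, 0 ≤ z.im → DifferentiableAt ℂ h z := by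
    intro z hz
    refine DifferentiableAt.fun_sum fun k _ => ?_
    by_cases hk : (e k).im < 0
    · simp only [hγ, if_pos hk]
      have hne : z - e k ≠ 0 := by
        intro h0
        have := congrArg Complex.im h0
        rw [Complex.sub_im, Complex.zero_im] at this
        linarith
      have hw : DifferentiableAt ℂ (fun μ : ℂ => (μ - e k)⁻¹) z := by
        exact DifferentiableAt.inv (by fun_prop) hne
      refine DifferentiableAt.fun_sum fun s _ => DifferentiableAt.mul_const ?_ _
      cases s with
      | zero =>
        simp only [boundedPart]
        fun_prop
      | succ s =>
        simp only [boundedPart]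
        fun_prop
    · simp only [hγ, if_neg hk]
      fun_prop
  have hd : DiffContOnCl ℂ h {z | 0 < z.im} := by
    refine ⟨fun z hz => (hdiff z (le_of_lt hz)).differentiableWithinAt, fun z hz => ?_⟩
    rw [Complex.closure_setOfPred_lt_im] at hz
    exact (hdiff z hz).continuousAt.continuousWithinAt
  have hr_im : ∀ k ∈ F, ∀ t : ℝ, (r k t).im = 0 := by
    intro k hk t
    simp only [hr]
    split_ifs with h1
    · obtain ⟨-, -, h2⟩ := hreal k hk h1
      have h3 : e k = ((e k).re : ℂ) := Complex.ext rfl (by simpa using h1)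
      have h4 : β k 0 = ((β k 0).re : ℂ) := Complex.ext rfl (by simpa using h2)
      rw [h3, h4]
      norm_cast
    · simp
  -- On the real line `r` is real, so `Im h` is `t² + 1` times the given imaginary part off the
  -- poles; density and continuity cover the poles.
  have himh : ∀ t : ℝ, (h t).im ≤ 0 := by
    have hcont : Continuous fun t : ℝ => (h t).im := by
      refine continuous_iff_continuousAt.2 fun t => ?_
      exact Complex.continuous_im.continuousAt.comp
        ((hdiff t (by simp)).continuousAt.comp (f := fun t : ℝ => (t : ℂ))
          Complex.continuous_ofReal.continuousAt)
    have hcl : IsClosed {t : ℝ | (h t).im ≤ 0} := isClosed_le hcont continuous_const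
    have hfin : (F.image fun k => (e k).re : Set ℝ).Finite := Finset.finite_toSet _
    have hdense : Dense ((F.image fun k => (e k).re : Set ℝ)ᶜ) := hfin.countable.dense_compl ℝ
    have hsub : ((F.image fun k => (e k).re : Set ℝ)ᶜ) ⊆ {t : ℝ | (h t).im ≤ 0} := by
      intro t ht
      have hne : ∀ k ∈ F, (t : ℂ) ≠ e k := by
        intro k hk h1
        refine ht ?_
        rw [Finset.mem_coe]
        exact Finset.mem_image.2 ⟨k, hk, by rw [← h1, Complex.ofReal_re]⟩
      have h1 := congrArg Complex.im (hrel t fun k hk _ => hne k hk)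
      rw [Complex.add_im, Complex.im_sum F fun k => r k t,
        Finset.sum_eq_zero fun k hk => hr_im k hk t, add_zero] at h1
      have h2 : ((t : ℂ) ^ 2 + 1) = ((t ^ 2 + 1 : ℝ) : ℂ) := by push_cast; ring
      rw [h2, Complex.im_ofReal_mul] at h1
      rw [Set.mem_ofPred_eq, ← h1]
      exact mul_nonpos_of_nonneg_of_nonpos (by positivity) (him t hne)
    intro t
    exact hcl.closure_subset_iff.2 hsub (hdense t)
  obtain ⟨hI, hzero⟩ := eq_zero_of_im_nonpos_of_bounded hd hb himh
  have hrI : ∀ k ∈ F, r k Complex.I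
      = if (e k).im = 0 then β k 0 * (-(e k) - Complex.I) else 0 := by
    intro k hk
    simp only [hr]
    split_ifs with h1
    · congr 1
      have hne : Complex.I - e k ≠ 0 := by
        intro h0
        have := congrArg Complex.im h0
        rw [Complex.sub_im, h1] at this
        simp at this
      field_simp
      linear_combination Complex.I_sq
    · rfl
  -- At `I` the factor `μ² + 1` vanishes, so `h I` is determined by the real residues: `Im h I` is
  -- their sum. Being both nonnegative and nonpositive, it forces all real residues to be zero, and
  -- then `h I = 0`.
  have hrelI := hrel Complex.I (fun k _ hk h1 => by
    rw [← h1, Complex.I_im] at hk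
    linarith)
  rw [Complex.I_sq, neg_add_cancel, zero_mul, Finset.sum_congr rfl hrI] at hrelI
  set a : κ → ℝ := fun k => if (e k).im = 0 then (β k 0).re else 0 with ha
  have ha0 : ∀ k ∈ F, 0 ≤ a k := by
    intro k hk
    simp only [ha]
    split_ifs with h1
    · exact (hreal k hk h1).2.1
    · exact le_rfl
  have hIim : (h Complex.I).im = ∑ k ∈ F, a k := by
    have h1 := congrArg Complex.im hrelI
    rw [Complex.zero_im, Complex.add_im, Complex.im_sum F fun k =>
      if (e k).im = 0 then β k 0 * (-(e k) - Complex.I) else 0] at h1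
    have h2 : ∀ k ∈ F, (if (e k).im = 0 then β k 0 * (-(e k) - Complex.I) else 0).im = -a k := by
      intro k hk
      simp only [ha]
      split_ifs with h3
      · obtain ⟨-, -, h4⟩ := hreal k hk h3
        simp [h3, h4]
      · simp
    rw [Finset.sum_congr rfl h2, Finset.sum_neg_distrib] at h1
    linarith
  have haz : ∀ k ∈ F, a k = 0 := (Finset.sum_eq_zero_iff_of_nonneg ha0).1
    (le_antisymm (hIim ▸ hI) (Finset.sum_nonneg ha0))
  have hβ0 : ∀ k ∈ F, (e k).im = 0 → β k 0 = 0 := by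
    intro k hk h1
    have h2 := haz k hk
    simp only [ha, if_pos h1] at h2
    exact Complex.ext h2 (hreal k hk h1).2.2
  have hr0 : ∀ μ, ∑ k ∈ F, r k μ = 0 := fun μ => Finset.sum_eq_zero fun k hk => by
    simp only [hr]
    split_ifs with h1
    · rw [hβ0 k hk h1, zero_mul]
    · rfl
  have hhI : h Complex.I = 0 := by
    rw [← Finset.sum_congr rfl hrI, hr0, add_zero] at hrelI
    exact hrelI.symm
  have hfin := hrel t fun k hk _ => ht k hk
  rw [hr0, hzero hhI t (by simp), add_zero] at hfin
  refine (mul_eq_zero.1 hfin).resolve_left ?_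
  have h2 : ((t : ℂ) ^ 2 + 1) = ((t ^ 2 + 1 : ℝ) : ℂ) := by push_cast; ring
  rw [h2]
  exact Complex.ofReal_ne_zero.2 (by positivity)

end Pencil
end

/-! ### Half families: the first half of the members determines the sequence -/

noncomputable section

namespace Pencil

/-- Two-sided form of `rational_eq_zero`: the nonreal poles lie on one side of the real line. -/
lemma rational_eq_zero_of_side {κ : Type*} (F : Finset κ) (c : κ → ℂ) (S : ℕ) (β : κ → ℕ → ℂ)
    {η : ℝ} (hη : η = 1 ∨ η = -1) (hside : ∀ k ∈ F, η * (c k).im < 0 → ∀ s, β k s = 0)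
    (hreal : ∀ k ∈ F, (c k).im = 0 →
      (∀ s, β k (s + 1) = 0) ∧ 0 ≤ η * (β k 0).re ∧ (β k 0).im = 0)
    (hsum : ∑ k ∈ F, β k 0 = 0)
    (him : ∀ t : ℝ, (∀ k ∈ F, (t : ℂ) ≠ c k) →
      (∑ k ∈ F, ∑ s ∈ Finset.range (S + 1),
        (((t : ℂ) - starRingEnd ℂ (c k)) ^ (s + 1))⁻¹ * β k s).im ≤ 0)
    (t : ℝ) (ht : ∀ k ∈ F, (t : ℂ) ≠ c k) :
    ∑ k ∈ F, ∑ s ∈ Finset.range (S + 1),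
      (((t : ℂ) - starRingEnd ℂ (c k)) ^ (s + 1))⁻¹ * β k s = 0 := by
  have hconj : ∀ (t : ℝ) k, (t : ℂ) ≠ starRingEnd ℂ (c k) ↔ (t : ℂ) ≠ c k := fun t k => by
    rw [← Complex.conj_ofReal t]
    exact (starRingEnd ℂ).injective.ne_iff.trans (by rw [Complex.conj_ofReal])
  rcases hη with rfl | rfl
  · refine rational_eq_zero F (fun k => starRingEnd ℂ (c k)) S β ?_ ?_ hsum ?_ t ?_
    · intro k hk h
      refine hside k hk ?_
      rw [Complex.conj_im] at h
      linarith
    · intro k hk h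
      have := hreal k hk (by simpa using h)
      rwa [one_mul] at this
    · exact fun t ht => him t fun k hk => (hconj t k).1 (ht k hk)
    · exact fun k hk => (hconj t k).2 (ht k hk)
  -- The case `η = -1` is reflected by `f ↦ -conj f(conj μ)`, which preserves the imaginary part on
  -- the real line, conjugates the poles and changes the sign of real residues.
  · have hval : ∀ t : ℝ, ∑ k ∈ F, ∑ s ∈ Finset.range (S + 1),
        (((t : ℂ) - c k) ^ (s + 1))⁻¹ * -starRingEnd ℂ (β k s)
        = -starRingEnd ℂ (∑ k ∈ F, ∑ s ∈ Finset.range (S + 1),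
          (((t : ℂ) - starRingEnd ℂ (c k)) ^ (s + 1))⁻¹ * β k s) := by
      intro t
      simp [map_sum]
    have h1 := rational_eq_zero F c S (fun k s => -starRingEnd ℂ (β k s)) ?_ ?_ ?_ ?_ t ht
    · rw [hval, neg_eq_zero] at h1
      exact (map_eq_zero _).1 h1
    · intro k hk h s
      rw [hside k hk (by linarith) s, map_zero, neg_zero]
    · intro k hk h
      obtain ⟨h1, h2, h3⟩ := hreal k hk h
      refine ⟨fun s => by rw [h1, map_zero, neg_zero], ?_, ?_⟩
      · rw [Complex.neg_re, Complex.conj_re]; linarith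
      · rw [Complex.neg_im, Complex.conj_im, h3]; simp
    · rw [Finset.sum_neg_distrib, ← map_sum, hsum, map_zero, neg_zero]
    · intro t ht
      rw [hval, Complex.neg_im, Complex.conj_im, neg_neg]
      exact him t ht

variable {H : Type*} [NormedAddCommGroup H] [InnerProductSpace ℂ H] [CompleteSpace H]
variable {A : Pencil H} {n l : ℕ} {η : ℝ} {T : ℂ → Submodule ℂ (ℕ → H)}

/-- Subspaces of the root spaces, vanishing on one side of the real line and, at real points,
neutral up to a part of the sign `η`. -/
structure IsHalfFamily (A : Pencil H) (n : ℕ) (η : ℝ) (T : ℂ → Submodule ℂ (ℕ → H)) : Prop where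
  le : ∀ c, T c ≤ rootSpace A c
  dev_mem : ∀ c, ∀ u ∈ T c, dev c u ∈ T c
  eq_zero : ∀ c, ∀ u ∈ T c, η * c.im < 0 → u = 0
  le_adjoint : ∀ c : ℝ, T c ≤ rootSpace A.adjointPencil c
  form_dev : ∀ c : ℝ, ∀ u ∈ T c, ∀ s, form A n u ((dev (c : ℂ) ^ (s + 1)) u) = 0
  form_self : ∀ c : ℝ, ∀ u ∈ T c, 0 ≤ η * (form A n u u).re ∧ (form A n u u).im = 0

/-- Were a root vector nonzero, its last nonzero image under powers of `dev c` would give an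
eigenvector. -/
lemma rootSpace_eq_bot {c : ℂ} (h : ∀ x, A.value c x = 0 → x = 0) : rootSpace A c = ⊥ := by
  rw [eq_bot_iff]
  intro u hu
  obtain ⟨k, hk⟩ := (mem_rootSpace.1 hu).2
  induction k generalizing u with
  | zero => exact hk
  | succ k ih =>
    refine ih hu ?_
    set v := (dev c ^ k) u with hv
    have hv1 : (dev c ^ (0 + 1)) v = 0 := by
      rw [hv, ← Module.End.mul_apply, ← pow_add, zero_add, add_comm, hk]
    have hvs : v ∈ sol A := rootSpace_le_sol A c (dev_pow_mem_rootSpace hu k)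
    have h2 := eq_kd hv1
    have h3 : (fun j => (dev c ^ (0 - j)) v 0) = fun _ => v 0 := by
      ext j; simp
    rw [h3] at h2
    have h4 := h (v 0) (mem_ker_value_iff.2 (h2 ▸ hvs))
    rw [h2, h4]
    ext r
    simp [kd]

lemma eq_zero_of_inner_value_eq_zero {t : ℝ} (h : (0 : ℂ) ∉ numericalRange (A.value (t : ℂ)))
    {x : H} (hx : inner ℂ x (A.value (t : ℂ) x) = 0) : x = 0 := by
  by_contra h0
  refine h ⟨((‖x‖ : ℂ)⁻¹) • x, ?_, ?_⟩
  · rw [norm_smul, norm_inv, Complex.norm_real, norm_norm, inv_mul_cancel₀ (norm_ne_zero_iff.2 h0)]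
  · rw [map_smul, inner_smul_left, inner_smul_right, hx, mul_zero, mul_zero]

namespace IsHalfFamily

variable (hT : IsHalfFamily A n η T)
include hT

lemma iSup_le_sol : ⨆ c, T c ≤ sol A := iSup_le fun c => (hT.le c).trans (rootSpace_le_sol A c)

lemma shift_mem {u : ℕ → H} (hu : u ∈ ⨆ c, T c) : shift u ∈ ⨆ c, T c := by
  have : ⨆ c, T c ≤ (⨆ c, T c).comap shift := by
    refine iSup_le fun c v hv => ?_
    rw [Submodule.mem_comap, shift_eq_dev c]
    exact add_mem (Submodule.smul_mem _ _ (Submodule.mem_iSup_of_mem c hv))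
      (Submodule.mem_iSup_of_mem c (hT.dev_mem c v hv))
  exact this hu

lemma dev_pow_mem (c : ℂ) {u : ℕ → H} (hu : u ∈ T c) (s : ℕ) : (dev c ^ s) u ∈ T c := by
  induction s with
  | zero => exact hu
  | succ s ih =>
    rw [pow_succ', Module.End.mul_apply]
    exact hT.dev_mem c _ ih

/-- The resolvent of the shift on the span of a half family. -/
lemma exists_resolvent {t₀ : ℂ} (ht₀ : rootSpace A t₀ = ⊥) {u : ℕ → H} (hu : u ∈ ⨆ c, T c) :
    ∃ (F : Finset ℂ) (f : ℂ → ℕ → H) (S : ℕ), t₀ ∉ F ∧ (∀ d, f d ∈ T d) ∧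
      u = ∑ d ∈ F, f d ∧ ∀ t ∉ F,
        (∑ d ∈ F, res d (S + 1) t (f d) ∈ ⨆ c, T c) ∧
        t • (∑ d ∈ F, res d (S + 1) t (f d)) - shift (∑ d ∈ F, res d (S + 1) t (f d)) = u := by
  rw [Submodule.mem_iSup_iff_exists_finsupp] at hu
  obtain ⟨f, hf, rfl⟩ := hu
  choose s hs using fun d => (mem_rootSpace.1 (hT.le d (hf d))).2
  have hS : ∀ d ∈ f.support, (dev d ^ (f.support.sup s + 1)) (f d) = 0 := by
    intro d hd
    obtain ⟨e, he⟩ := Nat.exists_eq_add_of_le (Finset.le_sup (f := s) hd)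
    rw [he, add_assoc, add_comm, pow_add, Module.End.mul_apply, hs, map_zero]
  refine ⟨f.support, f, f.support.sup s, ?_, hf, rfl, fun t ht => ⟨?_, ?_⟩⟩
  · intro h
    have h1 := hT.le _ (hf t₀)
    rw [ht₀, Submodule.mem_bot] at h1
    exact Finsupp.mem_support_iff.1 h h1
  · refine Submodule.sum_mem _ fun d _ => Submodule.mem_iSup_of_mem d ?_
    rw [res_apply]
    exact Submodule.sum_mem _ fun s _ => Submodule.smul_mem _ _ (hT.dev_pow_mem d (hf d) s)
  · rw [Finset.smul_sum, map_sum, ← Finset.sum_sub_distrib]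
    refine Finset.sum_congr rfl fun d hd => smul_res_sub_shift ?_ (hS d hd)
    rintro rfl
    exact ht hd

/-- At a real point `f c` also lies in a root space of `A*`, so components at other points pair to
zero with it. The pole at `c` thus involves only `f c`. -/
lemma form_sum_dev (hA : A.natDegree ≤ n) {F : Finset ℂ} {f : ℂ → ℕ → H} (hf : ∀ d, f d ∈ T d)
    {c : ℂ} (hc : c ∈ F) (hreal : c.im = 0) (s : ℕ) :
    form A n (∑ d ∈ F, f d) ((dev c ^ s) (f c)) = form A n (f c) ((dev c ^ s) (f c)) := by
  have hcc : c = (c.re : ℂ) := Complex.ext rfl (by simpa using hreal)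
  have hmem : (dev c ^ s) (f c) ∈ rootSpace A.adjointPencil c := by
    refine dev_pow_mem_rootSpace ?_ s
    have := hT.le_adjoint c.re
    rw [← hcc] at this
    exact this (hf c)
  rw [form_sum_left, Finset.sum_eq_single c]
  · intro d _ hd
    refine form_rootSpace_eq_zero hA ?_ (hT.le d (hf d)) hmem
    intro h
    refine hd ?_
    rw [← starRingEnd_self_apply (R := ℂ) d, ← h, hcc, Complex.conj_ofReal]
  · exact fun h => absurd hc h

/-- The analytic core: an element with vanishing initial half has a resolvent vanishing at the
first place. -/
lemma resolvent_apply_zero (hη : η = 1 ∨ η = -1) (hn : n = 2 * l) (hA : A.natDegree ≤ n)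
    (hdiss : A.IsDissipative) {t₀ : ℝ}
    (hnum : (0 : ℂ) ∉ numericalRange (A.value (t₀ : ℂ))) {u : ℕ → H} (hu : u ∈ ⨆ c, T c)
    (h0 : ∀ i < l, u i = 0) :
    ∃ U ∈ ⨆ c, T c, (t₀ : ℂ) • U - shift U = u ∧ U 0 = 0 := by
  have hroot : rootSpace A t₀ = ⊥ := rootSpace_eq_bot fun x hx =>
    eq_zero_of_inner_value_eq_zero hnum (by rw [hx, inner_zero_right])
  obtain ⟨F, f, S, ht₀, hf, hsum, hres⟩ := hT.exists_resolvent hroot hu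
  -- The resolvent is paired with itself. The polynomial remainder vanishes because the first `l`
  -- members of `u` do, leaving a rational function with poles at the conjugates of the points of
  -- `F`.
  have hval : ∀ t : ℝ, (t : ℂ) ∉ F →
      inner ℂ ((∑ d ∈ F, res d (S + 1) t (f d)) 0)
        (A.value (t : ℂ) ((∑ d ∈ F, res d (S + 1) t (f d)) 0))
      = ∑ d ∈ F, ∑ s ∈ Finset.range (S + 1), (((t : ℂ) - starRingEnd ℂ d) ^ (s + 1))⁻¹
          * form A n u ((dev d ^ s) (f d)) := by
    intro t ht
    obtain ⟨h1, h2⟩ := hres t ht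
    have h3 : starRingEnd ℂ (t : ℂ) • (∑ d ∈ F, res d (S + 1) t (f d))
        - shift (∑ d ∈ F, res d (S + 1) t (f d)) = u := by rw [Complex.conj_ofReal]; exact h2
    rw [inner_resolvent hA h2 (hT.iSup_le_sol h1) h3, hn,
      remPoly_eq_zero h0 h0, add_zero, form_sum_right]
    refine Finset.sum_congr rfl fun d _ => ?_
    have := form_res_right A (2 * l) u (f d) d (S + 1) t
    rwa [Complex.conj_ofReal] at this
  have hne : ∀ t : ℝ, (∀ k ∈ F, (t : ℂ) ≠ k) ↔ (t : ℂ) ∉ F :=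
    fun t => ⟨fun h h' => h _ h' rfl, fun h k hk h' => h (h' ▸ hk)⟩
  have hzero := rational_eq_zero_of_side F id S (fun d s => form A n u ((dev d ^ s) (f d))) hη
    ?_ ?_ ?_ ?_ t₀ ((hne t₀).2 ht₀)
  · obtain ⟨h1, h2⟩ := hres t₀ ht₀
    refine ⟨_, h1, h2, eq_zero_of_inner_value_eq_zero hnum ?_⟩
    rw [hval t₀ ht₀]
    exact hzero
  · intro d _ hd s
    rw [hT.eq_zero d _ (hf d) hd, map_zero, form_zero_right]
  · intro d hd him
    have hdd : d = (d.re : ℂ) := Complex.ext rfl (by simpa using him)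
    have hfd : f d ∈ T (d.re : ℂ) := by rw [← hdd]; exact hf d
    refine ⟨fun s => ?_, ?_⟩
    · rw [hsum, hT.form_sum_dev hA hf hd him]
      have := hT.form_dev d.re _ hfd s
      rwa [← hdd] at this
    · rw [hsum, hT.form_sum_dev hA hf hd him, pow_zero, Module.End.one_apply]
      exact hT.form_self d.re _ hfd
  -- The sum of the residues is `form u u`; its vanishing gives second order decay at infinity.
  · have h1 : form A n u u = 0 := by rw [hn]; exact form_eq_zero_of_init h0 h0
    conv_lhs at h1 => arg 4; rw [hsum]
    rw [form_sum_right] at h1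
    simpa using h1
  · intro t ht
    have h1 := hdiss t ((∑ d ∈ F, res d (S + 1) t (f d)) 0)
    rw [hval t ((hne t).1 ht)] at h1
    exact h1

/-- Elements of the span of a half family are determined by their initial half. -/
theorem eq_zero_of_init [FiniteDimensional ℂ H] (hη : η = 1 ∨ η = -1) (hn : n = 2 * l)
    (hA : A.IsNondegenerateOfOrder n) (hdiss : A.IsDissipative) {t₀ : ℝ}
    (hnum : (0 : ℂ) ∉ numericalRange (A.value (t₀ : ℂ))) {u : ℕ → H} (hu : u ∈ ⨆ c, T c)
    (h0 : ∀ i < l, u i = 0) : u = 0 := by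
  have := finiteDimensional_sol hA
  set V : ℕ → Submodule ℂ (ℕ → H) := fun m => (⨆ c, T c) ⊓ LinearMap.ker (restr m) with hV
  have hmem : ∀ m v, v ∈ V m ↔ v ∈ ⨆ c, T c ∧ ∀ i < m, v i = 0 := by
    intro m v
    simp only [hV, Submodule.mem_inf, LinearMap.mem_ker]
    refine and_congr_right fun _ => ⟨fun h i hi => congrFun h ⟨i, hi⟩, fun h => ?_⟩
    ext r
    exact h r r.2
  have hle : V (l + 1) ≤ V l := by
    intro v hv
    rw [hmem] at *
    exact ⟨hv.1, fun i hi => hv.2 i (by omega)⟩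
  have hfin : ∀ m, FiniteDimensional ℂ (V m) := fun m =>
    Submodule.finiteDimensional_of_le (inf_le_left.trans hT.iSup_le_sol)
  -- From `U 0 = 0` and `U (i + 1) = t₀ U i - u i` the preimage `U` gains one extra zero member.
  have hmap : V l ≤ (V (l + 1)).map ((t₀ : ℂ) • 1 - shift) := by
    intro v hv
    rw [hmem] at hv
    obtain ⟨U, hU, hUv, hU0⟩ := hT.resolvent_apply_zero hη hn hA.1 hdiss hnum hv.1 hv.2
    refine ⟨U, (hmem _ _).2 ⟨hU, fun i hi => ?_⟩, ?_⟩
    · induction i with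
      | zero => exact hU0
      | succ i ih =>
        have h1 := congrFun hUv i
        rw [Pi.sub_apply, Pi.smul_apply, ih (by omega), hv.2 i (by omega), shift_apply, smul_zero,
          zero_sub, neg_eq_zero] at h1
        exact h1
    · rw [LinearMap.sub_apply, LinearMap.smul_apply, Module.End.one_apply]
      exact hUv
  -- The map cannot raise dimension, so the two spaces agree. Elements of `V l` then have `v 0 = 0`
  -- even when `l = 0`, and `V l` is shift-invariant, whence all members vanish.
  have heq : V (l + 1) = V l := Submodule.eq_of_le_of_finrank_le hle
    ((Submodule.finrank_mono hmap).trans (Submodule.finrank_map_le _ _))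
  have hshift : ∀ v ∈ V l, shift v ∈ V l := by
    intro v hv
    rw [← heq] at hv
    rw [hmem] at *
    exact ⟨hT.shift_mem hv.1, fun i hi => hv.2 (i + 1) (by omega)⟩
  have hzero : ∀ i, ∀ v ∈ V l, v i = 0 := by
    intro i
    induction i with
    | zero =>
      intro v hv
      rw [← heq, hmem] at hv
      exact hv.2 0 (Nat.succ_pos l)
    | succ i ih => exact fun v hv => ih _ (hshift v hv)
  exact funext fun i => hzero i u ((hmem _ _).2 ⟨hu, h0⟩)

end IsHalfFamily

end Pencil
end

/-! ### Truncated chains of a regular family form half families -/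

noncomputable section

namespace Pencil

variable {H : Type*} [NormedAddCommGroup H] [InnerProductSpace ℂ H]
variable {A : Pencil H} {n : ℕ}

/-- The span of the members `h ≤ b k` of the chains of a family. -/
def truncSpan {ι : Type*} (c : ℂ) (w : ι → ℕ → H) (b : ι → ℤ) : Submodule ℂ (ℕ → H) :=
  Submodule.span ℂ {v | ∃ (k : ι) (h : ℕ), (h : ℤ) ≤ b k ∧ v = kd c (w k) h}

lemma dev_mem_truncSpan {ι : Type*} {c : ℂ} {w : ι → ℕ → H} {b : ι → ℤ} {u : ℕ → H}
    (hu : u ∈ truncSpan c w b) : dev c u ∈ truncSpan c w b := by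
  have : truncSpan c w b ≤ (truncSpan c w b).comap (dev c) := by
    refine Submodule.span_le.2 ?_
    rintro _ ⟨k, h, hh, rfl⟩
    change dev c (kd c (w k) h) ∈ truncSpan c w b
    rw [dev_kd]
    split_ifs with h1
    · exact Submodule.subset_span ⟨k, h - 1, by omega, rfl⟩
    · exact zero_mem _
  exact this hu

lemma truncSpan_le_rootSpace {ι : Type*} {c : ℂ} {p : ι → ℕ} {w : ι → ℕ → H} {b : ι → ℤ}
    (hw : ∀ k, kd c (w k) (p k) ∈ sol A) (hb : ∀ k, b k ≤ p k) :
    truncSpan c w b ≤ rootSpace A c := by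
  refine Submodule.span_le.2 ?_
  rintro _ ⟨k, h, hh, rfl⟩
  exact kd_mem_rootSpace (hw k) (by have := hb k; omega)

section Real

variable [CompleteSpace H] [FiniteDimensional ℂ H]
variable {ι : Type} [Fintype ι] [DecidableEq ι] {c : ℝ} {p : ι → ℕ} {w : ι → ℕ → H} {ε : ι → ℤ}

lemma strictHalf_le_halfSpace (hw : ∀ k, kd (c : ℂ) (w k) (p k) ∈ sol A) :
    strictHalf (c : ℂ) p w ≤ halfSpace A c := by
  refine Submodule.span_le.2 ?_
  rintro _ ⟨k, h, hh, rfl⟩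
  exact kd_mem_halfSpace (hw k) (by omega)

/-- For generators, `2 * h + 1 ≤ p` and `2 * h' ≤ p'` give `h + h' < max p p'`, the range of
orthogonality. The two orders of arguments are exchanged by Hermitian symmetry. -/
lemma form_strictHalf_eq_zero (hA : A.natDegree ≤ n) (hdiss : A.IsDissipative)
    (hw : ∀ k, kd (c : ℂ) (w k) (p k) ∈ sol A) {u v : ℕ → H} (hu : u ∈ halfSpace A c)
    (hv : v ∈ strictHalf (c : ℂ) p w) : form A n u v = 0 ∧ form A n v u = 0 := by
  have h1 : form A n v u = 0 := by
    have h2 : strictHalf (c : ℂ) p w ≤ LinearMap.ker (formLeft A n u) := by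
      refine Submodule.span_le.2 ?_
      rintro _ ⟨k, h, hh, rfl⟩
      change form A n _ _ = 0
      have h3 : halfSpace A c ≤ LinearMap.ker (formLeft A n (kd (c : ℂ) (w k) h)) := by
        refine Submodule.span_le.2 ?_
        rintro _ ⟨p', h', w', hw', hh', rfl⟩
        exact form_half_eq_zero hA hdiss c hw' (hw k) hh' (by omega) (by omega)
      rw [form_conj hA hdiss c hu (kd_mem_halfSpace (hw k) (by omega))]
      rw [show form A n u (kd (c : ℂ) (w k) h) = 0 from h3 hu, map_zero]
    exact h2 hv
  refine ⟨?_, h1⟩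
  rw [form_conj hA hdiss c (strictHalf_le_halfSpace hw hv) hu, h1, map_zero]

/-- The sign characteristics are the norms of the middle members. -/
lemma IsRegularSystem.form_middle (hA : A.IsNondegenerateOfOrder n) (hdiss : A.IsDissipative)
    (hreg : A.IsRegularSystem n c p w ε) {k k' : ι} {m : ℕ} (hk : p k = 2 * m)
    (hk' : p k' = 2 * m) :
    form A n (kd c (w k') m) (kd c (w k) m) = if k' = k then (ε k : ℂ) else 0 := by
  obtain ⟨hcan, z, hz, hsign⟩ := hreg
  have := finiteDimensional_rootSpace hA (c : ℂ)
  have hw := hcan.isJordanSystem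
  have hd := IsAdjointSystem.isDualSystem hA hw hz
  obtain ⟨hε, hmem⟩ := (hsign k).2 m hk
  have hspan : Submodule.span ℂ {v | ∃ (j : ι) (h : ℕ), 2 * h + 1 ≤ p j ∧
      v = keldysh (c : ℂ) n (w j) h} = (strictHalf (c : ℂ) p w).map (restr n) := by
    rw [strictHalf, Submodule.map_span]
    congr 1
    ext v
    constructor
    · rintro ⟨j, h, hh, rfl⟩
      exact ⟨_, ⟨j, h, hh, rfl⟩, rfl⟩
    · rintro ⟨_, ⟨j, h, hh, rfl⟩, rfl⟩
      exact ⟨j, h, hh, rfl⟩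
  rw [hspan] at hmem
  obtain ⟨v, hv, hvr⟩ := hmem
  have h1 := (form_strictHalf_eq_zero hA.1 hdiss hw.mem
    (kd_mem_halfSpace (hw.mem k') (h := m) (by omega)) hv).1
  -- The sign condition is an identity in `H^n` only, but `form` sees no more than the first `n`
  -- members. Pairing it with a middle member kills the strict-half term, and `ε² = 1` isolates the
  -- Gram entry.
  have h2 : form A n (kd (c : ℂ) (w k') m) v = form A n (kd (c : ℂ) (w k') m)
      (kd (c : ℂ) (z k) m - (ε k : ℂ) • kd (c : ℂ) (w k) m) :=
    form_congr_right fun i hi => congrFun hvr ⟨i, hi⟩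
  have h3 := hd k' k m m (by omega) (by omega)
  rw [Complex.conj_ofReal] at h3
  rw [h1, form_sub_right, form_smul_right, h3, map_intCast] at h2
  have h4 : (ε k : ℂ) * ε k = 1 := by
    rcases hε with h | h <;> rw [h] <;> norm_num
  have h5 : (if k' = k ∧ m + m = p k' then (1 : ℂ) else 0) = if k' = k then 1 else 0 :=
    if_congr (and_iff_left (by omega)) rfl rfl
  rw [h5] at h2
  have h6 : (ε k : ℂ) * (if k' = k then 1 else 0) = if k' = k then (ε k : ℂ) else 0 := by
    split_ifs <;> ring
  linear_combination (ε k : ℂ) * h2 - form A n (kd c (w k') m) (kd c (w k) m) * h4 + h6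

variable {η : ℝ} {b : ι → ℤ}

/-- Truncation of the chains at a real point in the middle, according to the signs. -/
def IsMiddleIndex (η : ℝ) (p : ι → ℕ) (ε : ι → ℤ) (b : ι → ℤ) : Prop :=
  ∀ k (h : ℕ), (h : ℤ) ≤ b k → 2 * h + 1 ≤ p k ∨ p k = 2 * h ∧ (ε k : ℝ) = η

lemma truncSpan_le_halfSpace (hw : ∀ k, kd (c : ℂ) (w k) (p k) ∈ sol A)
    (hb : IsMiddleIndex η p ε b) : truncSpan (c : ℂ) w b ≤ halfSpace A c := by
  refine Submodule.span_le.2 ?_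
  rintro _ ⟨k, h, hh, rfl⟩
  refine kd_mem_halfSpace (hw k) ?_
  rcases hb k h hh with h1 | h1 <;> omega

lemma dev_pow_succ_mem_strictHalf (hb : IsMiddleIndex η p ε b) {u : ℕ → H}
    (hu : u ∈ truncSpan (c : ℂ) w b) (s : ℕ) :
    (dev (c : ℂ) ^ (s + 1)) u ∈ strictHalf (c : ℂ) p w := by
  have : truncSpan (c : ℂ) w b
      ≤ (strictHalf (c : ℂ) p w).comap (dev (c : ℂ) ^ (s + 1)) := by
    refine Submodule.span_le.2 ?_
    rintro _ ⟨k, h, hh, rfl⟩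
    change (dev (c : ℂ) ^ (s + 1)) (kd c (w k) h) ∈ strictHalf (c : ℂ) p w
    rw [dev_pow_kd]
    split_ifs with h1
    · refine Submodule.subset_span ⟨k, h - (s + 1), ?_, rfl⟩
      rcases hb k h hh with h2 | h2 <;> omega
    · exact zero_mem _
  exact this hu

lemma exists_middle_decomposition (hb : IsMiddleIndex η p ε b) {u : ℕ → H}
    (hu : u ∈ truncSpan (c : ℂ) w b) : ∃ v ∈ strictHalf (c : ℂ) p w, ∃ α : ι → ℂ,
      u = v + ∑ k ∈ Finset.univ.filter (fun k => Even (p k) ∧ (ε k : ℝ) = η),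
        α k • kd (c : ℂ) (w k) (p k / 2) := by
  induction hu using Submodule.span_induction with
  | mem u hu =>
    obtain ⟨k, h, hh, rfl⟩ := hu
    rcases hb k h hh with h1 | ⟨h1, h2⟩
    · exact ⟨_, Submodule.subset_span ⟨k, h, h1, rfl⟩, 0, by simp⟩
    · refine ⟨0, zero_mem _, Pi.single k 1, ?_⟩
      rw [zero_add, Finset.sum_eq_single k]
      · rw [Pi.single_eq_same, one_smul, h1, Nat.mul_div_cancel_left _ two_pos]
      · intro j _ hj
        rw [Pi.single_eq_of_ne hj, zero_smul]
      · intro h3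
        exact absurd (Finset.mem_filter.2 ⟨Finset.mem_univ _, h1 ▸ even_two_mul h, h2⟩) h3
  | zero => exact ⟨0, zero_mem _, 0, by simp⟩
  | add u u' _ _ hu hu' =>
    obtain ⟨v, hv, α, rfl⟩ := hu
    obtain ⟨v', hv', α', rfl⟩ := hu'
    refine ⟨v + v', add_mem hv hv', α + α', ?_⟩
    simp only [Pi.add_apply, add_smul, Finset.sum_add_distrib]
    abel
  | smul a u _ hu =>
    obtain ⟨v, hv, α, rfl⟩ := hu
    refine ⟨a • v, Submodule.smul_mem _ _ hv, a • α, ?_⟩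
    simp only [Pi.smul_apply, smul_eq_mul, mul_smul, smul_add, Finset.smul_sum]

/-- The strict-half component is isotropic and the selected middle members are orthogonal of norm
`η`, so the form equals `η` times a sum of squares `‖α k‖²`. -/
lemma IsRegularSystem.form_self (hA : A.IsNondegenerateOfOrder n) (hdiss : A.IsDissipative)
    (hreg : A.IsRegularSystem n c p w ε) (hb : IsMiddleIndex η p ε b) {u : ℕ → H}
    (hu : u ∈ truncSpan (c : ℂ) w b) :
    0 ≤ η * (form A n u u).re ∧ (form A n u u).im = 0 := by
  have hw : ∀ k, kd (c : ℂ) (w k) (p k) ∈ sol A := hreg.1.1.mem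
  obtain ⟨v, hv, α, hα⟩ := exists_middle_decomposition hb hu
  set M := Finset.univ.filter (fun k => Even (p k) ∧ (ε k : ℝ) = η) with hM
  set y := ∑ k ∈ M, α k • kd (c : ℂ) (w k) (p k / 2) with hy
  have hyH : y ∈ halfSpace A c := Submodule.sum_mem _ fun k hk => Submodule.smul_mem _ _
    (kd_mem_halfSpace (hw k) (by omega))
  have hvH : v ∈ halfSpace A c := strictHalf_le_halfSpace hw hv
  have h1 : form A n u u = form A n y y := by
    rw [hα, form_add_left, form_add_right, form_add_right,
      (form_strictHalf_eq_zero hA.1 hdiss hw hvH hv).1,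
      (form_strictHalf_eq_zero hA.1 hdiss hw hyH hv).1,
      (form_strictHalf_eq_zero hA.1 hdiss hw hyH hv).2]
    ring
  have h2 : form A n y y = ((∑ k ∈ M, ‖α k‖ ^ 2 * η : ℝ) : ℂ) := by
    rw [hy, form_sum_left]
    push_cast
    refine Finset.sum_congr rfl fun k hk => ?_
    obtain ⟨-, hke, hkη⟩ := Finset.mem_filter.1 hk
    rw [form_smul_left, form_sum_right, Finset.sum_eq_single k]
    · obtain ⟨m, hm⟩ := hke.two_dvd
      have h3 := hreg.form_middle hA hdiss hm hm
      rw [if_pos rfl] at h3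
      rw [form_smul_right, hm, Nat.mul_div_cancel_left _ two_pos, h3, ← mul_assoc,
        Complex.mul_conj', ← hkη]
      push_cast
      rfl
    · intro k' hk' hkk
      obtain ⟨-, hke', -⟩ := Finset.mem_filter.1 hk'
      obtain ⟨m, hm⟩ := hke.two_dvd
      obtain ⟨m', hm'⟩ := hke'.two_dvd
      rw [form_smul_right, hm, hm', Nat.mul_div_cancel_left _ two_pos,
        Nat.mul_div_cancel_left _ two_pos]
      by_cases hmm : m = m'
      · subst hmm
        rw [hreg.form_middle hA hdiss hm' hm, if_neg (Ne.symm hkk), mul_zero]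
      · rw [form_half_eq_zero hA.1 hdiss c (hw k) (hw k') (by omega) (by omega) (by omega),
          mul_zero]
    · exact fun h => absurd hk h
  rw [h1, h2]
  refine ⟨?_, Complex.ofReal_im _⟩
  rw [Complex.ofReal_re, Finset.mul_sum]
  refine Finset.sum_nonneg fun k _ => ?_
  have : η * (‖α k‖ ^ 2 * η) = (‖α k‖ * η) ^ 2 := by ring
  rw [this]
  positivity

end Real

variable [CompleteSpace H] [FiniteDimensional ℂ H] {E : ChainFamily H} {η : ℝ}
variable {b : (c : ℂ) → Fin (E.N c) → ℤ}

/-- Truncation indices of a family of chains that select a half on the side `η`. -/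
structure IsHalfIndex (E : ChainFamily H) (η : ℝ) (b : (c : ℂ) → Fin (E.N c) → ℤ) : Prop where
  le : ∀ c k, b c k ≤ E.p c k
  side : ∀ c k, η * c.im < 0 → b c k < 0
  middle : ∀ c : ℝ, IsMiddleIndex η (E.p c) (E.ε c) (b c)

lemma IsRegularFamily.isHalfFamily (hA : A.IsNondegenerateOfOrder n) (hdiss : A.IsDissipative)
    (hE : A.IsRegularFamily n E) (hb : IsHalfIndex E η b) :
    IsHalfFamily A n η fun c => truncSpan c (E.w c) (b c) where
  le c := truncSpan_le_rootSpace (hE.1 c).1.mem (hb.le c)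
  dev_mem _ _ hu := dev_mem_truncSpan hu
  eq_zero c u hu hc := by
    have : truncSpan c (E.w c) (b c) = ⊥ := by
      rw [truncSpan, Submodule.span_eq_bot]
      rintro _ ⟨k, h, hh, rfl⟩
      have := hb.side c k hc
      omega
    rw [this] at hu
    exact hu
  le_adjoint c := (truncSpan_le_halfSpace (hE.1 c).1.mem (hb.middle c)).trans
    (halfSpace_le_rootSpace_adjoint hdiss c)
  form_dev c u hu s := (form_strictHalf_eq_zero hA.1 hdiss (hE.1 c).1.mem
    (truncSpan_le_halfSpace (hE.1 c).1.mem (hb.middle c) hu)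
    (dev_pow_succ_mem_strictHalf (hb.middle c) hu s)).1
  form_self c _ hu := (hE.2 c).form_self hA hdiss (hb.middle c) hu

lemma IsRegularFamily.sign (hE : A.IsRegularFamily n E) (c : ℝ) (k : Fin (E.N c)) :
    (E.ε c k = 0 ∧ Odd (E.p c k)) ∨ ((E.ε c k = 1 ∨ E.ε c k = -1) ∧ Even (E.p c k)) := by
  obtain ⟨-, z, -, hz⟩ := hE.2 c
  rcases Nat.even_or_odd (E.p c k) with h | h
  · obtain ⟨m, hm⟩ := h.two_dvd
    exact Or.inr ⟨((hz k).2 m hm).1, h⟩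
  · exact Or.inl ⟨(hz k).1 h, h⟩

/-- At a real point the floor gives the last index `m` for `p = 2m + 1` and for `p = 2m`, `ε = 1`,
but `m - 1` for `p = 2m`, `ε = -1`. So a middle member is taken exactly when its sign agrees with
`η`. -/
lemma IsRegularFamily.isHalfIndex_plus (hE : A.IsRegularFamily n E) :
    IsHalfIndex E 1 E.plusIndex := by
  have hreal : ∀ c : ℝ, ∀ k, E.plusIndex c k = ((E.p c k : ℤ) + E.ε c k) / 2 := fun c k => by
    simp [ChainFamily.plusIndex]
  refine ⟨fun c k => ?_, fun c k hc => ?_, fun c k h hh => ?_⟩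
  · rcases lt_trichotomy 0 c.im with h | h | h
    · rw [ChainFamily.plusIndex, if_pos h]
    · obtain ⟨t, rfl⟩ : ∃ t : ℝ, (t : ℂ) = c := ⟨c.re, Complex.ext rfl (by simpa using h)⟩
      rw [hreal]
      rcases hE.sign t k with ⟨h1, m, hm⟩ | ⟨h1 | h1, m, hm⟩ <;> rw [h1] <;> omega
    · rw [ChainFamily.plusIndex, if_neg h.not_gt, if_neg h.ne]
      omega
  · rw [one_mul] at hc
    rw [ChainFamily.plusIndex, if_neg hc.not_gt, if_neg hc.ne]
    omega
  · rw [hreal] at hh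
    rcases hE.sign c k with ⟨h1, m, hm⟩ | ⟨h1 | h1, m, hm⟩ <;> rw [h1] at hh ⊢
    · left; omega
    · by_cases h2 : h = m
      · right
        exact ⟨by omega, by norm_num⟩
      · left; omega
    · left; omega

lemma IsRegularFamily.isHalfIndex_minus (hE : A.IsRegularFamily n E) :
    IsHalfIndex E (-1) E.minusIndex := by
  have hreal : ∀ c : ℝ, ∀ k, E.minusIndex c k = ((E.p c k : ℤ) - E.ε c k) / 2 := fun c k => by
    simp [ChainFamily.minusIndex]
  refine ⟨fun c k => ?_, fun c k hc => ?_, fun c k h hh => ?_⟩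
  · rcases lt_trichotomy c.im 0 with h | h | h
    · rw [ChainFamily.minusIndex, if_pos h]
    · obtain ⟨t, rfl⟩ : ∃ t : ℝ, (t : ℂ) = c := ⟨c.re, Complex.ext rfl (by simpa using h.symm)⟩
      rw [hreal]
      rcases hE.sign t k with ⟨h1, m, hm⟩ | ⟨h1 | h1, m, hm⟩ <;> rw [h1] <;> omega
    · rw [ChainFamily.minusIndex, if_neg h.not_gt, if_neg h.ne']
      omega
  · have hc' : 0 < c.im := by linarith
    rw [ChainFamily.minusIndex, if_neg hc'.not_gt, if_neg hc'.ne']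
    omega
  · rw [hreal] at hh
    rcases hE.sign c k with ⟨h1, m, hm⟩ | ⟨h1 | h1, m, hm⟩ <;> rw [h1] at hh ⊢
    · left; omega
    · left; omega
    · by_cases h2 : h = m
      · right
        exact ⟨by omega, by norm_num⟩
      · left; omega

/-- The number of selected members is the index plus one, with zero for the index `-1`. A middle
member is counted in exactly one of the two selections. -/
lemma IsRegularFamily.plusIndex_add_minusIndex (hE : A.IsRegularFamily n E) (c : ℂ)
    (k : Fin (E.N c)) :
    (E.plusIndex c k + 1).toNat + (E.minusIndex c k + 1).toNat = E.p c k + 1 := by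
  rcases lt_trichotomy 0 c.im with h | h | h
  · rw [ChainFamily.plusIndex, if_pos h, ChainFamily.minusIndex, if_neg h.not_gt, if_neg h.ne']
    omega
  · obtain ⟨t, rfl⟩ : ∃ t : ℝ, (t : ℂ) = c := ⟨c.re, Complex.ext rfl (by simpa using h)⟩
    have h1 : E.plusIndex t k = ((E.p t k : ℤ) + E.ε t k) / 2 := by simp [ChainFamily.plusIndex]
    have h2 : E.minusIndex t k = ((E.p t k : ℤ) - E.ε t k) / 2 := by
      simp [ChainFamily.minusIndex]
    rw [h1, h2]
    rcases hE.sign t k with ⟨h1, m, hm⟩ | ⟨h1 | h1, m, hm⟩ <;> rw [h1] <;> omega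
  · rw [ChainFamily.plusIndex, if_neg h.not_gt, if_neg h.ne, ChainFamily.minusIndex, if_pos h]
    omega

end Pencil
end

/-! ### Dimensions of the spans of truncated chains; division of pencils -/

noncomputable section

namespace Pencil

variable {H : Type*} [NormedAddCommGroup H] [InnerProductSpace ℂ H]
variable {A : Pencil H} {n l : ℕ}

lemma finrank_biSup_of_iSupIndep {V : ℂ → Submodule ℂ (ℕ → H)} (hind : iSupIndep V)
    {W : Submodule ℂ (ℕ → H)} [FiniteDimensional ℂ W] (hW : ∀ c, V c ≤ W) (F : Finset ℂ) :
    Module.finrank ℂ (⨆ c ∈ F, V c : Submodule ℂ (ℕ → H)) = ∑ c ∈ F, Module.finrank ℂ (V c) := by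
  classical
  induction F using Finset.induction_on with
  | empty =>
    have : (⨆ c ∈ (∅ : Finset ℂ), V c) = ⊥ := by simp
    rw [this, finrank_bot, Finset.sum_empty]
  | insert c F hc ih =>
    have h1 : FiniteDimensional ℂ (V c) := Submodule.finiteDimensional_of_le (hW c)
    have h2 : FiniteDimensional ℂ (⨆ d ∈ F, V d : Submodule ℂ (ℕ → H)) :=
      Submodule.finiteDimensional_of_le (iSup₂_le fun d _ => hW d)
    have h3 : Disjoint (V c) (⨆ d ∈ F, V d) := (hind c).mono_right
      (iSup₂_le fun d hd => le_iSup₂_of_le d (by rintro rfl; exact hc hd) le_rfl)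
    have h4 := Submodule.finrank_sup_add_finrank_inf_eq (V c) (⨆ d ∈ F, V d)
    rw [h3.eq_bot, finrank_bot, add_zero] at h4
    rw [Finset.iSup_insert, Finset.sum_insert hc, h4, ih]

lemma finrank_iSup_of_iSupIndep {V : ℂ → Submodule ℂ (ℕ → H)} (hind : iSupIndep V)
    {W : Submodule ℂ (ℕ → H)} [FiniteDimensional ℂ W] (hW : ∀ c, V c ≤ W) {F : Finset ℂ}
    (hF : ∀ c ∉ F, V c = ⊥) :
    Module.finrank ℂ (⨆ c, V c : Submodule ℂ (ℕ → H)) = ∑ c ∈ F, Module.finrank ℂ (V c) := by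
  rw [← finrank_biSup_of_iSupIndep hind hW F]
  suffices h : ⨆ c, V c = ⨆ c ∈ F, V c by rw [h]
  refine le_antisymm (iSup_le fun c => ?_) (iSup₂_le fun c _ => le_iSup V c)
  by_cases hc : c ∈ F
  · exact le_iSup₂_of_le c hc le_rfl
  · rw [hF c hc]; exact bot_le

section Trunc

variable {ι : Type} [Fintype ι] {c : ℂ} {w : ι → ℕ → H} {b : ι → ℤ}

lemma span_chainVec_trunc : Submodule.span ℂ (Set.range
    (chainVec c (fun k : {k // 0 ≤ b k} => (b k).toNat) fun k => w k)) = truncSpan c w b := by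
  rw [truncSpan]
  congr 1
  ext v
  constructor
  · rintro ⟨⟨⟨k, hk⟩, h⟩, rfl⟩
    refine ⟨k, h, ?_, rfl⟩
    have h1 := h.2
    dsimp only at h1
    omega
  · rintro ⟨k, h, hh, rfl⟩
    exact ⟨⟨⟨k, by omega⟩, ⟨h, by dsimp only; omega⟩⟩, rfl⟩

lemma finrank_truncSpan (hli : LinearIndependent ℂ fun k => w k 0) :
    Module.finrank ℂ (truncSpan c w b) = ∑ k, (b k + 1).toNat := by
  classical
  have h1 : LinearIndependent ℂ fun k : {k // 0 ≤ b k} => w k 0 :=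
    hli.comp _ Subtype.val_injective
  rw [← span_chainVec_trunc, finrank_span_eq_card (chainVec_linearIndependent c _ _ h1),
    card_chainIndex]
  have h2 := Finset.sum_subtype (F := inferInstance) (Finset.univ.filter fun k => 0 ≤ b k) (p := fun k => 0 ≤ b k)
    (by simp) (fun k => (b k + 1).toNat)
  rw [Finset.sum_filter_of_ne (fun k _ hk => by by_contra h; exact hk (by omega))] at h2
  rw [h2]
  exact Finset.sum_congr rfl fun k _ => by have := k.2; omega

end Trunc

/-- Right division by a monic pencil. -/
lemma exists_right_division {K : Pencil H} (hK : K.IsMonicOfDegree l) (d : ℕ) (A : Pencil H)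
    (hA : ∀ m, l + d ≤ m → A.coeff m = 0) : ∃ L R : Pencil H,
      (∀ m, d ≤ m → L.coeff m = 0) ∧ (∀ m, l ≤ m → R.coeff m = 0) ∧ A = L * K + R := by
  induction d generalizing A with
  | zero => exact ⟨0, A, by simp, hA, by simp⟩
  | succ d ih =>
    obtain ⟨L, R, hL, hR, hLR⟩ := ih (A - Polynomial.monomial d (A.coeff (l + d)) * K) (by
      intro m hm
      obtain ⟨i, rfl⟩ : ∃ i, m = i + d := ⟨m - d, by omega⟩
      rw [Polynomial.coeff_sub, Polynomial.coeff_monomial_mul]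
      rcases (by omega : l ≤ i).eq_or_lt with h | h
      · rw [← h, hK.2, mul_one, sub_self]
      · rw [hA _ (by omega), Polynomial.coeff_eq_zero_of_natDegree_lt (hK.1.trans_lt h), mul_zero,
          sub_zero])
    refine ⟨L + Polynomial.monomial d (A.coeff (l + d)), R, fun m hm => ?_, hR, ?_⟩
    · rw [Polynomial.coeff_add, hL m (by omega), Polynomial.coeff_monomial, if_neg (by omega),
        add_zero]
    · rw [add_mul, add_right_comm, ← hLR, sub_add_cancel]

/-! ### Factorizations from shift-invariant spaces -/

variable [FiniteDimensional ℂ H]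

/-- A shift invariant space of sequences determined by arbitrary first `l` members is the space
of solutions of a monic pencil. -/
lemma exists_monic_of_invariant {S : Submodule ℂ (ℕ → H)} (hshift : ∀ u ∈ S, shift u ∈ S)
    (hinj : ∀ u ∈ S, (∀ i < l, u i = 0) → u = 0) (hsurj : ∀ x : Fin l → H, ∃ u ∈ S, restr l u = x) :
    ∃ K : Pencil H, K.IsMonicOfDegree l ∧ sol K = S := by
  let e : S ≃ₗ[ℂ] (Fin l → H) := LinearEquiv.ofBijective ((restr l).domRestrict S) <| by
    constructor
    · rw [← LinearMap.ker_eq_bot, LinearMap.ker_eq_bot']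
      intro u hu
      exact Subtype.ext (hinj u u.2 fun i hi => congrFun hu ⟨i, hi⟩)
    · intro x
      obtain ⟨u, hu, hx⟩ := hsurj x
      exact ⟨⟨u, hu⟩, hx⟩
  -- On `S` the member with index `l` is a linear function of the preceding ones; its components are
  -- the coefficients of `K`. Shift invariance propagates the recurrence to all indices.
  let ψ : (Fin l → H) →ₗ[ℂ] H := LinearMap.proj l ∘ₗ S.subtype ∘ₗ e.symm.toLinearMap
  let B : Fin l → (H →L[ℂ] H) := fun j =>
    LinearMap.toContinuousLinearMap (ψ ∘ₗ LinearMap.single ℂ (fun _ => H) j)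
  let K : Pencil H := Polynomial.X ^ l - ∑ j : Fin l, Polynomial.monomial (j : ℕ) (B j)
  have hcoeff : ∀ i, K.coeff i
      = (if i = l then 1 else 0) - ∑ j : Fin l, if (j : ℕ) = i then B j else 0 := by
    intro i
    simp only [K, Polynomial.coeff_sub, Polynomial.coeff_X_pow, Polynomial.finsetSum_coeff,
      Polynomial.coeff_monomial]
  have hlow : ∀ i, l ≤ i → (∑ j : Fin l, if (j : ℕ) = i then B j else 0) = 0 := fun i hi =>
    Finset.sum_eq_zero fun j _ => if_neg (by have := j.2; omega)
  have hmonic : K.IsMonicOfDegree l := by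
    refine ⟨Polynomial.natDegree_le_iff_coeff_eq_zero.2 fun i hi => ?_, ?_⟩
    · rw [hcoeff, hlow i (by omega), if_neg (by omega), sub_zero]
    · rw [hcoeff, hlow l le_rfl, if_pos rfl, sub_zero]
  have hsum : ∀ x : Fin l → H, ∑ j, B j (x j) = ψ x := by
    intro x
    have h1 : ∀ j, B j (x j) = ψ (Pi.single j (x j)) := fun j => rfl
    simp only [h1]
    rw [← map_sum, Finset.univ_sum_single]
  have hact : ∀ u ∈ S, act K u 0 = 0 := by
    intro u hu
    rw [act_apply hmonic.1, Finset.sum_range_succ, hmonic.2]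
    have h1 : ∑ j ∈ Finset.range l, K.coeff j (u (0 + j)) = -∑ j : Fin l, B j (u j) := by
      rw [← Fin.sum_univ_eq_sum_range fun j => K.coeff j (u (0 + j)), ← Finset.sum_neg_distrib]
      refine Finset.sum_congr rfl fun i _ => ?_
      rw [hcoeff, if_neg i.2.ne, Finset.sum_eq_single i, if_pos rfl, zero_sub, zero_add]
      · rfl
      · intro j _ hj
        exact if_neg fun h => hj (Fin.ext h)
      · simp
    have h2 : ψ (fun j : Fin l => u j) = u l := by
      have h3 : (fun j : Fin l => u j) = e ⟨u, hu⟩ := rfl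
      rw [h3]
      change ((e.symm (e ⟨u, hu⟩) : S) : ℕ → H) l = u l
      rw [e.symm_apply_apply]
    rw [h1, hsum (fun j : Fin l => u j), h2, zero_add]
    simp
  have hpow : ∀ i, ∀ u ∈ S, (shift ^ i) u ∈ S := by
    intro i
    induction i with
    | zero => exact fun u hu => hu
    | succ i ih =>
      intro u hu
      rw [pow_succ', Module.End.mul_apply]
      exact hshift _ (ih u hu)
  have hle : S ≤ sol K := by
    intro u hu
    rw [mem_sol]
    ext i
    have h1 := hact _ (hpow i u hu)
    rw [act_apply hmonic.1] at h1 ⊢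
    simp only [shift_pow_apply] at h1
    rw [Pi.zero_apply, ← h1]
    refine Finset.sum_congr rfl fun j _ => ?_
    congr 2
    omega
  refine ⟨K, hmonic, le_antisymm (fun u hu => ?_) hle⟩
  obtain ⟨v, hv, hvu⟩ := hsurj (restr l u)
  have hnd : K.IsNondegenerateOfOrder l := by
    refine ⟨hmonic.1, ?_⟩
    rw [hmonic.2]
    exact LinearMap.ker_id
  have h1 := sol_eq_zero_of_init hnd (sub_mem hu (hle hv)) fun i hi => by
    rw [Pi.sub_apply, sub_eq_zero]
    exact (congrFun hvu ⟨i, hi⟩).symm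
  rw [sub_eq_zero.1 h1]
  exact hv

/-- Divide `A` on the right by the monic pencil that annihilates `S`. The remainder annihilates `S`
too, but has order below `l`, while the first `l` members on `S` are arbitrary. -/
lemma exists_factorization (hA : A.IsNondegenerateOfOrder (2 * l)) {S : Submodule ℂ (ℕ → H)}
    (hS : S ≤ sol A) (hshift : ∀ u ∈ S, shift u ∈ S)
    (hinj : ∀ u ∈ S, (∀ i < l, u i = 0) → u = 0)
    (hdim : Module.finrank ℂ S = l * Module.finrank ℂ H) :
    ∃ L K : Pencil H, L.IsNondegenerateOfOrder l ∧ K.IsMonicOfDegree l ∧ A = L * K ∧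
      sol K = S := by
  have := finiteDimensional_sol hA
  have := Submodule.finiteDimensional_of_le hS
  have hsurj : ∀ x : Fin l → H, ∃ u ∈ S, restr l u = x := by
    have h1 : Function.Injective ((restr l).domRestrict S) := by
      rw [← LinearMap.ker_eq_bot, LinearMap.ker_eq_bot']
      intro u hu
      exact Subtype.ext (hinj u u.2 fun i hi => congrFun hu ⟨i, hi⟩)
    have h2 : Module.finrank ℂ S = Module.finrank ℂ (Fin l → H) := by
      rw [hdim, Module.finrank_pi_fintype]; simp
    intro x
    obtain ⟨u, hu⟩ := (LinearMap.injective_iff_surjective_of_finrank_eq_finrank h2).1 h1 x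
    exact ⟨u, u.2, hu⟩
  obtain ⟨K, hK, hKS⟩ := exists_monic_of_invariant hshift hinj hsurj
  obtain ⟨L, R, hL, hR, hLR⟩ := exists_right_division hK (l + 1) A fun m hm =>
    Polynomial.coeff_eq_zero_of_natDegree_lt (hA.1.trans_lt (by omega))
  have hRdeg : R.natDegree ≤ l := Polynomial.natDegree_le_iff_coeff_eq_zero.2 fun i hi =>
    hR i hi.le
  have hLdeg : L.natDegree ≤ l := Polynomial.natDegree_le_iff_coeff_eq_zero.2 fun i hi =>
    hL i hi
  -- Testing with the solution whose first `l` members are `x` at place `j` and zero elsewhere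
  -- isolates the coefficient `R_j x`.
  have hR0 : R = 0 := by
    ext j x
    rcases lt_or_ge j l with hj | hj
    · obtain ⟨u, hu, hux⟩ := hsurj (Pi.single ⟨j, hj⟩ x)
      have h1 := mem_sol.1 (hS hu)
      have h2 : act K u = 0 := mem_sol.1 (hKS ▸ hu)
      rw [hLR, map_add, map_mul, LinearMap.add_apply, Module.End.mul_apply, h2, map_zero,
        zero_add] at h1
      have h3 := congrFun h1 0
      rw [act_apply hRdeg, Finset.sum_eq_single j] at h3
      · have h4 := congrFun hux ⟨j, hj⟩
        rw [restr_apply, Pi.single_eq_same] at h4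
        rw [zero_add, h4] at h3
        simpa using h3
      · intro i hi hij
        rcases lt_or_ge i l with hil | hil
        · have h4 := congrFun hux ⟨i, hil⟩
          rw [restr_apply, Pi.single_eq_of_ne (fun h => hij (congrArg Fin.val h))] at h4
          rw [zero_add, h4, map_zero]
        · rw [hR i hil]; rfl
      · intro h
        exact absurd (Finset.mem_range.2 (by omega)) h
    · rw [hR j hj]; rfl
  rw [hR0, add_zero] at hLR
  refine ⟨L, K, ⟨hLdeg, ?_⟩, hK, hLR, hKS⟩
  have h1 := Polynomial.coeff_mul_add_eq_of_natDegree_le hLdeg hK.1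
  rw [← hLR, hK.2, mul_one, ← two_mul] at h1
  rw [← h1]
  exact hA.2

variable [CompleteSpace H] {E : ChainFamily H} {η : ℝ} {b : (c : ℂ) → Fin (E.N c) → ℤ}

/-- A pencil whose solutions are spanned by truncated chains has these as canonical systems. -/
lemma IsRegularFamily.hasEAVSystem (hE : A.IsRegularFamily n E) (hle : ∀ c k, b c k ≤ E.p c k)
    {K : Pencil H} (hK : sol K = ⨆ c, truncSpan c (E.w c) (b c)) : K.HasEAVSystem E b := by
  intro c
  refine IsJordanSystem.isCanonicalSystem ⟨fun k => ?_, ?_, ?_⟩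
  · rw [hK]
    exact Submodule.mem_iSup_of_mem c (Submodule.subset_span
      ⟨k, _, (Int.toNat_of_nonneg k.2).le, rfl⟩)
  · exact (hE.1 c).1.2.1.comp _ Subtype.val_injective
  · rw [span_chainVec_trunc, rootSpace, hK]
    have hgen : ∀ d, truncSpan d (E.w d) (b d) ≤ Module.End.maxGenEigenspace shift d := fun d =>
      (truncSpan_le_rootSpace (hE.1 d).1.mem (hle d)).trans inf_le_right
    refine le_antisymm (le_inf (le_iSup (fun d => truncSpan d (E.w d) (b d)) c) (hgen c)) ?_
    have hdis := iSupIndep_maxGenEigenspace_shift (H := H) c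
    intro u hu
    obtain ⟨h1, h2⟩ := Submodule.mem_inf.1 hu
    -- Generalized eigenspaces of the shift are independent, so a solution for `K` that is a root
    -- vector at `c` has no components at other points.
    have h3 : (⨆ d, truncSpan d (E.w d) (b d))
        ≤ truncSpan c (E.w c) (b c) ⊔ ⨆ d ≠ c, Module.End.maxGenEigenspace shift d := by
      refine iSup_le fun d => ?_
      by_cases hd : d = c
      · subst hd; exact le_sup_left
      · exact le_sup_of_le_right (le_iSup₂_of_le d hd (hgen d))
    obtain ⟨v, hv, y, hy, rfl⟩ := Submodule.mem_sup.1 (h3 h1)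
    have h4 : y ∈ Module.End.maxGenEigenspace shift c := by
      have := sub_mem h2 (hgen c hv)
      rwa [add_sub_cancel_left] at this
    have h5 := Submodule.disjoint_def.1 hdis y h4 hy
    rw [h5, add_zero]
    exact hv

lemma finrank_le_of_init {S : Submodule ℂ (ℕ → H)}
    (hinj : ∀ u ∈ S, (∀ i < l, u i = 0) → u = 0) :
    Module.finrank ℂ S ≤ l * Module.finrank ℂ H := by
  have h1 : Function.Injective ((restr l).domRestrict S) := by
    rw [← LinearMap.ker_eq_bot, LinearMap.ker_eq_bot']
    intro u hu
    exact Subtype.ext (hinj u u.2 fun i hi => congrFun hu ⟨i, hi⟩)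
  have h2 := LinearMap.finrank_le_finrank_of_injective h1
  rw [Module.finrank_pi_fintype] at h2
  simpa using h2

/-- Root spaces are independent and all but finitely many are zero, so dimensions add over the
eigenvalues. At each of them the two selections count the chain members exactly once. -/
lemma IsRegularFamily.finrank_plus_add_finrank_minus (hA : A.IsNondegenerateOfOrder n)
    (hE : A.IsRegularFamily n E) :
    Module.finrank ℂ (⨆ c, truncSpan c (E.w c) (E.plusIndex c) : Submodule ℂ (ℕ → H))
      + Module.finrank ℂ (⨆ c, truncSpan c (E.w c) (E.minusIndex c) : Submodule ℂ (ℕ → H))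
      = n * Module.finrank ℂ H := by
  have := finiteDimensional_sol hA
  have hfin := finite_rootSpace_ne_bot (A := A)
  have hF : ∀ c ∉ hfin.toFinset, rootSpace A c = ⊥ := by
    intro c hc
    by_contra h
    exact hc (hfin.mem_toFinset.2 h)
  have hsum : ∀ b : (c : ℂ) → Fin (E.N c) → ℤ, (∀ c k, b c k ≤ E.p c k) →
      Module.finrank ℂ (⨆ c, truncSpan c (E.w c) (b c) : Submodule ℂ (ℕ → H))
        = ∑ c ∈ hfin.toFinset, ∑ k, (b c k + 1).toNat := by
    intro b hb
    have hle : ∀ c, truncSpan c (E.w c) (b c) ≤ rootSpace A c := fun c =>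
      truncSpan_le_rootSpace (hE.1 c).1.mem (hb c)
    rw [finrank_iSup_of_iSupIndep ((iSupIndep_rootSpace A).mono hle)
      (fun c => (hle c).trans (rootSpace_le_sol A c))
      (fun c hc => eq_bot_iff.2 ((hle c).trans (hF c hc).le))]
    exact Finset.sum_congr rfl fun c _ => finrank_truncSpan (hE.1 c).1.2.1
  rw [hsum _ hE.isHalfIndex_plus.le, hsum _ hE.isHalfIndex_minus.le, ← Finset.sum_add_distrib,
    ← finrank_sol hA, ← iSup_rootSpace,
    finrank_iSup_of_iSupIndep (iSupIndep_rootSpace A) (rootSpace_le_sol A) hF]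
  refine Finset.sum_congr rfl fun c _ => ?_
  have := finiteDimensional_rootSpace hA c
  rw [(hE.1 c).isJordanSystem.finrank_rootSpace, ← Finset.sum_add_distrib]
  exact Finset.sum_congr rfl fun k _ => hE.plusIndex_add_minusIndex c k

end Pencil
end

theorem mainTheorem5 {H : Type*} [NormedAddCommGroup H] [InnerProductSpace ℂ H] [CompleteSpace H]
    [FiniteDimensional ℂ H] (l : ℕ) (A : Pencil H)
    (hA : A.IsNondegenerateOfOrder (2 * l)) (hdiss : A.IsDissipative)
    (hnum : ∃ t₀ : ℝ, (0 : ℂ) ∉ numericalRange (A.value (t₀ : ℂ))) :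
    (∃ E : Pencil.ChainFamily H, A.IsRegularFamily (2 * l) E) ∧
    ∀ E : Pencil.ChainFamily H, A.IsRegularFamily (2 * l) E →
      (∃ L K : Pencil H, L.IsNondegenerateOfOrder l ∧ K.IsMonicOfDegree l ∧ A = L * K ∧
        K.HasEAVSystem E E.plusIndex) ∧
      (∃ L K : Pencil H, L.IsNondegenerateOfOrder l ∧ K.IsMonicOfDegree l ∧ A = L * K ∧
        K.HasEAVSystem E E.minusIndex) := by
  obtain ⟨t₀, hnum⟩ := hnum
  refine ⟨Pencil.exists_regularFamily hA hdiss, fun E hE => ?_⟩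
  have hP := hE.isHalfFamily hA hdiss hE.isHalfIndex_plus
  have hM := hE.isHalfFamily hA hdiss hE.isHalfIndex_minus
  have hPinj := fun u hu => hP.eq_zero_of_init (u := u) (Or.inl rfl) rfl hA hdiss hnum hu
  have hMinj := fun u hu => hM.eq_zero_of_init (u := u) (Or.inr rfl) rfl hA hdiss hnum hu
  have hsum := hE.finrank_plus_add_finrank_minus hA
  rw [mul_assoc, two_mul] at hsum
  -- Injectivity bounds each dimension by `l dim H`, while the sum is `2l dim H`; so both bounds are
  -- equalities, which is what factorization requires.
  have hPle := Pencil.finrank_le_of_init hPinj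
  have hMle := Pencil.finrank_le_of_init hMinj
  constructor
  · obtain ⟨L, K, hL, hK, hLK, hsol⟩ := Pencil.exists_factorization hA hP.iSup_le_sol
      (fun u hu => hP.shift_mem hu) hPinj (by omega)
    exact ⟨L, K, hL, hK, hLK, hE.hasEAVSystem hE.isHalfIndex_plus.le hsol⟩
  · obtain ⟨L, K, hL, hK, hLK, hsol⟩ := Pencil.exists_factorization hA hM.iSup_le_sol
      (fun u hu => hM.shift_mem hu) hMinj (by omega)
    exact ⟨L, K, hL, hK, hLK, hE.hasEAVSystem hE.isHalfIndex_minus.le hsol⟩
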